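/- Let $\nu,\alpha,L>0$ with $\alpha\neq\nu$, let $\Omega=\mathbb T\times(0,L)$ with $\mathbb T=\mathbb R/2\pi\mathbb Z$, and let $\Gamma=\mathbb T\times\{0,L\}$ with normal $n$. Let $\mathbf V^0_n(\Omega)$ be the space of complex vector fields $u\in L^2(\Omega)^2$ with $\operatorname{div}u=0$ in $\Omega$ and $u\cdot n=0$ on $\Gamma$, let $\mathbb P$ be the orthogonal projection of $L^2(\Omega)^2$ onto $\mathbf V^0_n(\Omega)$, and let $X=\mathbf V^0_n(\Omega)\times L^2(\Omega)$. Let $A_S=\nu\mathbb P\Delta$ be the Stokes operator on $\mathbf V^0_n(\Omega)$ with domain $\{u\in H^2(\Omega)^2:\operatorname{div}u=0,\ u=0\text{ on }\Gamma\}$, and let $A$ be the operator on $X$ given by $$A(u,\theta)=\big(A_Su+\mathbb P(0,\theta),\ \alpha\Delta\theta\big),\qquad D(A)=D(A_S)\times\big(H^2(\Omega)\cap H^1_0(\Omega)\big).$$ **Proposition.** The operator $A$ is densely defined, and its adjoint $A^*$ on $X$ has the following properties. 1. The spectrum of $A^*$ consists of isolated real eigenvalues with finite algebraic multiplicity, i.e.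 for each $\lambda$ in it $\bigcup_n\ker(A^*-\lambda)^n$ is finite dimensional. 2. $\mathrm{Sp}(A^*)=\mathrm{Sp}_S\cup\mathrm{Sp}_L$. Here $\mathrm{Sp}_S=\bigcup_{k\in\mathbb Z}S_k$, where $S_k$ is the set of the real numbers $\lambda$ for which there is $\tilde\mu>0$ with $k^2+\lambda/\nu=-\tilde\mu^2$ (so $\sqrt{k^2+\lambda/\nu}=i\tilde\mu$) and, if $k\neq0$, $$-\sinh(kL)\sin(\tilde\mu L)\,\tilde\mu^2+2k\big(1-\cosh(kL)\cos(\tilde\mu L)\big)\tilde\mu+k^2\sinh(kL)\sin(\tilde\mu L)=0,$$ while $\sin(\tilde\mu L)=0$ if $k=0$. Each $S_k$ is countably infinite, $S_k=\{\lambda_{k,j}:j\in\mathbb N\}$, and $\mathrm{Sp}_S$ is the set of the eigenvalues of the Stokes operator $A_S$. Moreover $$\mathrm{Sp}_L=\Big\{-\alpha\Big(k^2+\frac{j^2\pi^2}{L^2}\Big):k\in\mathbb Z,\ j\in\mathbb N,\ j\ge1\Big\}.$$ 3. If $A^*(\psi,\xi)=\lambda(\psi,\xi)$, then for each $k\in\mathbb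 Z$ the Fourier mode $\xi_k(x_2)=\frac1{2\pi}\int_0^{2\pi}\xi(x_1,x_2)e^{-ikx_1}\,dx_1$ coincides almost everywhere on $(0,L)$ with a smooth function (again denoted $\xi_k$, smooth up to the boundary) such that, in $(0,L)$, $$-\xi_k^{(6)}+\Big(\frac\lambda\alpha+\frac\lambda\nu+3k^2\Big)\xi_k^{(4)}-\Big(\Big(\frac\lambda\nu+2k^2\Big)\Big(\frac\lambda\alpha+k^2\Big)+k^2\Big(\frac\lambda\nu+k^2\Big)\Big)\xi_k''+k^2\Big(\frac\lambda\nu+k^2\Big)\Big(\frac\lambda\alpha+k^2\Big)\xi_k=0,$$ and, for $y=0$ and $y=L$, $$\xi_k(y)=\xi_k''(y)=\xi_k'''(y)-\Big(\frac\lambda\alpha+k^2\Big)\xi_k'(y)=0.$$ 4. For $k\in\mathbb Z$ and $j\ge1$, the pair $(\psi,\xi)=(0,\sin(j\pi x_2/L)e^{ikx_1})$ is an eigenvector of $A^*$ for the eigenvalue $-\alpha(k^2+j^2\pi^2/L^2)$. For every $\lambda\in\mathbb C$, the set of the $(\psi,\xi)\in\ker(A^*-\lambda)$ with $\psi=0$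 is the span of those pairs whose indices satisfy $-\alpha(k^2+j^2\pi^2/L^2)=\lambda$; if $\lambda\in\mathrm{Sp}_L\setminus\mathrm{Sp}_S$, this span is all of $\ker(A^*-\lambda)$. The associated pressures, i.e. the $q\in L^2(\Omega)$ with $\lambda\psi-\nu\Delta\psi+\nabla q=0$ in the sense of distributions, are for $\psi=0$ exactly the constants; normalizing $q=0$, the eigenfunctions are $(\psi_1,\psi_2,q,\xi)=(0,0,0,\sin(j\pi x_2/L))e^{ikx_1}$. -/

import Mathlib

open Real Set Filter Topology MeasureTheory
open scoped ContDiff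

noncomputable section

namespace Boussinesq

/-! ## The channel, test functions, weak derivatives, traces -/

/-- The channel `𝕋 × (0, L)`; the torus `𝕋` is the interval `(0, 2π)` with periodic boundary
conditions in the first variable. The periodicity enters through the test functions below. -/
def channel (L : ℝ) : Set (ℝ × ℝ) := Ioo 0 (2 * π) ×ˢ Ioo 0 L

/-- The complex Hilbert space `L²(Ω)`. -/
abbrev L2 (L : ℝ) : Type := Lp ℂ 2 (volume.restrict (channel L))

/-- The Hilbert space `L²(Ω)²` of vector fields. -/
abbrev L2Vec (L : ℝ) : Type := WithLp 2 (L2 L × L2 L)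

/-- The canonical basis of the plane. -/
def basisVec (i : Fin 2) : ℝ × ℝ := if i = 0 then (1, 0) else (0, 1)

/-- The classical partial derivative `∂ᵢ φ`. -/
def partialDeriv (i : Fin 2) (φ : ℝ × ℝ → ℂ) (x : ℝ × ℝ) : ℂ := fderiv ℝ φ x (basisVec i)

/-- Smooth functions on `𝕋 × ℝ`; their restrictions to `𝕋 × [0, L]` are the functions that are
smooth up to the boundary, with arbitrary boundary values. -/
structure IsPeriodicSmooth (φ : ℝ × ℝ → ℂ) : Prop where
  smooth : ContDiff ℝ ∞ φ
  periodic : ∀ x : ℝ × ℝ, φ (x.1 + 2 * π, x.2) = φ x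

/-- Smooth functions with compact support in `𝕋 × (0, L)`. -/
structure IsTestFunction (L : ℝ) (φ : ℝ × ℝ → ℂ) : Prop extends IsPeriodicSmooth φ where
  support : ∃ a b : ℝ, 0 < a ∧ b < L ∧ ∀ x : ℝ × ℝ, φ x ≠ 0 → a ≤ x.2 ∧ x.2 ≤ b

/-- `v = ∂ᵢ u` weakly in `𝕋 × (0, L)`. -/
def HasWeakDeriv (L : ℝ) (i : Fin 2) (u v : L2 L) : Prop :=
  ∀ φ : ℝ × ℝ → ℂ, IsTestFunction L φ →
    ∫ x in channel L, u x * partialDeriv i φ x = -∫ x in channel L, v x * φ x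

/-- `u ∈ H²(Ω)` and `w = Δ u`. -/
def HasH2Laplacian (L : ℝ) (u w : L2 L) : Prop :=
  ∃ (d : Fin 2 → L2 L) (dd : Fin 2 → Fin 2 → L2 L),
    (∀ i, HasWeakDeriv L i u (d i)) ∧ (∀ i j, HasWeakDeriv L j (d i) (dd i j)) ∧
    w = dd 0 0 + dd 1 1

/-- The trace of `u` on the two boundary components vanishes, where the trace is given by Green's
formula: `∫_Ω (u ∂₂φ + (∂₂u) φ) = ∫_𝕋 ((u φ)(x₁, L) - (u φ)(x₁, 0)) dx₁`. -/
def HasZeroTrace (L : ℝ) (u : L2 L) : Prop :=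
  ∃ v : L2 L, HasWeakDeriv L 1 u v ∧ ∀ φ : ℝ × ℝ → ℂ, IsPeriodicSmooth φ →
    (∫ x in channel L, u x * partialDeriv 1 φ x) + ∫ x in channel L, v x * φ x = 0

/-- `div u = 0` weakly in `𝕋 × (0, L)`. -/
def IsDivFree (L : ℝ) (u : L2Vec L) : Prop :=
  ∀ φ : ℝ × ℝ → ℂ, IsTestFunction L φ →
    (∫ x in channel L, u.fst x * partialDeriv 0 φ x) +
      ∫ x in channel L, u.snd x * partialDeriv 1 φ x = 0

/-- For a divergence free field `u`, the normal trace `u · n` is given by Green's formula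
`⟨u · n, φ⟩ = ∫_Ω u · ∇φ`; this says that it vanishes. -/
def HasZeroNormalTrace (L : ℝ) (u : L2Vec L) : Prop :=
  ∀ φ : ℝ × ℝ → ℂ, IsPeriodicSmooth φ →
    (∫ x in channel L, u.fst x * partialDeriv 0 φ x) +
      ∫ x in channel L, u.snd x * partialDeriv 1 φ x = 0

/-! ## Auxiliary facts on integrals against continuous functions -/

lemma memLp_channel {L : ℝ} {g : ℝ × ℝ → ℂ} (hg : Continuous g) :
    MemLp g 2 (volume.restrict (channel L)) := by
  have hK : IsCompact (Icc 0 (2 * π) ×ˢ Icc 0 L : Set (ℝ × ℝ)) := isCompact_Icc.prod isCompact_Icc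
  have hsub : channel L ⊆ Icc 0 (2 * π) ×ˢ Icc 0 L :=
    prod_mono Ioo_subset_Icc_self Ioo_subset_Icc_self
  have : IsFiniteMeasure (volume.restrict (channel L)) :=
    ⟨by simpa using (measure_mono hsub).trans_lt hK.measure_lt_top⟩
  obtain ⟨C, hC⟩ := hK.exists_bound_of_continuousOn hg.continuousOn
  refine MemLp.of_bound hg.aestronglyMeasurable C ?_
  exact (ae_restrict_iff' (measurableSet_Ioo.prod measurableSet_Ioo)).2
    (Eventually.of_forall fun x hx => hC x (hsub hx))

lemma integral_mul_eq_inner {L : ℝ} {g : ℝ × ℝ → ℂ} (hg : Continuous g) (u : L2 L) :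
    ∫ x in channel L, u x * g x =
      inner ℂ ((memLp_channel (L := L) (Complex.continuous_conj.comp hg)).toLp _) u := by
  rw [MeasureTheory.L2.inner_def]
  refine integral_congr_ae ?_
  filter_upwards [(memLp_channel (L := L) (Complex.continuous_conj.comp hg)).coeFn_toLp] with x hx
  rw [hx]
  simp [mul_comm]

lemma IsPeriodicSmooth.continuous_partialDeriv {φ : ℝ × ℝ → ℂ} (h : IsPeriodicSmooth φ)
    (i : Fin 2) : Continuous (partialDeriv i φ) := by
  have := h.smooth.continuous_fderiv (by simp)
  unfold partialDeriv
  fun_prop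

/-! ## Solenoidal fields, the Leray projection and the operators -/

/-- The space `V⁰ₙ(Ω)` of square integrable divergence free fields with zero normal trace. -/
def solenoidal (L : ℝ) : Submodule ℂ (L2Vec L) where
  carrier := {u | IsDivFree L u ∧ HasZeroNormalTrace L u}
  add_mem' := by
    rintro u v ⟨hu, hu'⟩ ⟨hv, hv'⟩
    refine ⟨fun φ hφ => ?_, fun φ hφ => ?_⟩
    · have h1 := hu φ hφ
      have h2 := hv φ hφ
      have c := hφ.continuous_partialDeriv
      rw [integral_mul_eq_inner (c 0), integral_mul_eq_inner (c 1)] at *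
      simp only [WithLp.add_fst, WithLp.add_snd, inner_add_right]
      linear_combination h1 + h2
    · have h1 := hu' φ hφ
      have h2 := hv' φ hφ
      have c := hφ.continuous_partialDeriv
      rw [integral_mul_eq_inner (c 0), integral_mul_eq_inner (c 1)] at *
      simp only [WithLp.add_fst, WithLp.add_snd, inner_add_right]
      linear_combination h1 + h2
  zero_mem' := by
    refine ⟨fun φ hφ => ?_, fun φ hφ => ?_⟩ <;>
    · have c := hφ.continuous_partialDeriv
      rw [integral_mul_eq_inner (c 0), integral_mul_eq_inner (c 1)]
      simp
  smul_mem' := by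
    rintro a u ⟨hu, hu'⟩
    refine ⟨fun φ hφ => ?_, fun φ hφ => ?_⟩
    · have h1 := hu φ hφ
      have c := hφ.continuous_partialDeriv
      rw [integral_mul_eq_inner (c 0), integral_mul_eq_inner (c 1)] at *
      simp only [WithLp.smul_fst, WithLp.smul_snd, inner_smul_right]
      linear_combination a * h1
    · have h1 := hu' φ hφ
      have c := hφ.continuous_partialDeriv
      rw [integral_mul_eq_inner (c 0), integral_mul_eq_inner (c 1)] at *
      simp only [WithLp.smul_fst, WithLp.smul_snd, inner_smul_right]
      linear_combination a * h1

lemma isClosed_solenoidal (L : ℝ) : IsClosed (solenoidal L : Set (L2Vec L)) := by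
  have key : ∀ φ : ℝ × ℝ → ℂ, IsPeriodicSmooth φ → IsClosed {u : L2Vec L |
      (∫ x in channel L, u.fst x * partialDeriv 0 φ x) +
        ∫ x in channel L, u.snd x * partialDeriv 1 φ x = 0} := by
    intro φ hφ
    have c := hφ.continuous_partialDeriv
    simp only [integral_mul_eq_inner (c 0), integral_mul_eq_inner (c 1)]
    refine isClosed_eq ?_ continuous_const
    have h1 : Continuous fun u : L2Vec L => u.fst := (WithLp.prod_continuous_ofLp 2 _ _).fst
    have h2 : Continuous fun u : L2Vec L => u.snd := (WithLp.prod_continuous_ofLp 2 _ _).snd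
    exact (continuous_const.inner h1).add (continuous_const.inner h2)
  have : (solenoidal L : Set (L2Vec L)) =
      (⋂ (φ : ℝ × ℝ → ℂ) (_ : IsTestFunction L φ), {u : L2Vec L |
        (∫ x in channel L, u.fst x * partialDeriv 0 φ x) +
          ∫ x in channel L, u.snd x * partialDeriv 1 φ x = 0}) ∩
      (⋂ (φ : ℝ × ℝ → ℂ) (_ : IsPeriodicSmooth φ), {u : L2Vec L |
        (∫ x in channel L, u.fst x * partialDeriv 0 φ x) +
          ∫ x in channel L, u.snd x * partialDeriv 1 φ x = 0}) := by
    ext u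
    simp only [mem_inter_iff, mem_iInter]
    rfl
  rw [this]
  exact (isClosed_iInter fun φ => isClosed_iInter fun h => key φ h.toIsPeriodicSmooth).inter
    (isClosed_iInter fun φ => isClosed_iInter fun h => key φ h)

instance (L : ℝ) : CompleteSpace (solenoidal L) :=
  (isClosed_solenoidal L).completeSpace_coe

/-- The Leray projection, i.e. the orthogonal projection of `L²(Ω)²` onto `V⁰ₙ(Ω)`. -/
def leray (L : ℝ) : L2Vec L →L[ℂ] solenoidal L := (solenoidal L).orthogonalProjectionOnto

/-- The state space `X = V⁰ₙ(Ω) × L²(Ω)`. -/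
abbrev StateSpace (L : ℝ) : Type := WithLp 2 (solenoidal L × L2 L)

lemma HasWeakDeriv.lin {L : ℝ} {i : Fin 2} {u v u' v' : L2 L} (h : HasWeakDeriv L i u v)
    (h' : HasWeakDeriv L i u' v') (a b : ℂ) :
    HasWeakDeriv L i (a • u + b • u') (a • v + b • v') := by
  intro φ hφ
  have h1 := h φ hφ
  have h2 := h' φ hφ
  have c := hφ.continuous_partialDeriv i
  have c' := hφ.smooth.continuous
  rw [integral_mul_eq_inner c, integral_mul_eq_inner c'] at *
  simp only [inner_add_right, inner_smul_right]
  linear_combination a * h1 + b * h2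

lemma HasH2Laplacian.lin {L : ℝ} {u w u' w' : L2 L} (h : HasH2Laplacian L u w)
    (h' : HasH2Laplacian L u' w') (a b : ℂ) :
    HasH2Laplacian L (a • u + b • u') (a • w + b • w') := by
  obtain ⟨d, dd, h1, h2, rfl⟩ := h
  obtain ⟨d', dd', h1', h2', rfl⟩ := h'
  exact ⟨fun i => a • d i + b • d' i, fun i j => a • dd i j + b • dd' i j,
    fun i => (h1 i).lin (h1' i) a b, fun i j => (h2 i j).lin (h2' i j) a b, by
      simp only [smul_add]; abel⟩

lemma HasZeroTrace.lin {L : ℝ} {u u' : L2 L} (h : HasZeroTrace L u)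
    (h' : HasZeroTrace L u') (a b : ℂ) : HasZeroTrace L (a • u + b • u') := by
  obtain ⟨v, h1, h2⟩ := h
  obtain ⟨v', h1', h2'⟩ := h'
  refine ⟨a • v + b • v', h1.lin h1' a b, fun φ hφ => ?_⟩
  have e1 := h2 φ hφ
  have e2 := h2' φ hφ
  have c := hφ.continuous_partialDeriv 1
  have c' := hφ.smooth.continuous
  rw [integral_mul_eq_inner c, integral_mul_eq_inner c'] at *
  simp only [inner_add_right, inner_smul_right]
  linear_combination a * e1 + b * e2

lemma HasWeakDeriv.zero (L : ℝ) (i : Fin 2) : HasWeakDeriv L i 0 0 := by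
  intro φ hφ
  rw [integral_mul_eq_inner (hφ.continuous_partialDeriv i), integral_mul_eq_inner hφ.smooth.continuous]
  simp

lemma HasH2Laplacian.zero (L : ℝ) : HasH2Laplacian L 0 0 :=
  ⟨0, 0, fun i => HasWeakDeriv.zero L i, fun _ j => HasWeakDeriv.zero L j, by simp⟩

lemma HasZeroTrace.zero (L : ℝ) : HasZeroTrace L 0 := by
  refine ⟨0, HasWeakDeriv.zero L 1, fun φ hφ => ?_⟩
  rw [integral_mul_eq_inner (hφ.continuous_partialDeriv 1), integral_mul_eq_inner hφ.smooth.continuous]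
  simp

/-- A smooth function with compact support in one period cell agrees there with a test function. -/
lemma exists_isTestFunction {L : ℝ} {g : ℝ × ℝ → ℝ} (hg : ContDiff ℝ ∞ g)
    (hc : HasCompactSupport g) (hs : tsupport g ⊆ channel L) :
    ∃ φ, IsTestFunction L φ ∧ ∀ x ∈ channel L, φ x = g x := by
  have hp : (0 : ℝ) < 2 * π := by positivity
  have hz : ∀ x, x ∉ channel L → ∀ᶠ y in 𝓝 x, g y = 0 := by
    intro x hx
    have : x ∉ tsupport g := fun h => hx (hs h)
    exact (notMem_tsupport_iff_eventuallyEq.1 this)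
  have hfl : ∀ (t : ℝ) (n : ℤ), 2 * π * n ≤ t → t < 2 * π * (n + 1) → ⌊t / (2 * π)⌋ = n := by
    intro t n h1 h2
    rw [Int.floor_eq_iff, le_div_iff₀ hp, div_lt_iff₀ hp]
    constructor <;> linarith
  let φ : ℝ × ℝ → ℂ := fun x => (g (x.1 - 2 * π * (⌊x.1 / (2 * π)⌋ : ℤ), x.2) : ℂ)
  have hsm : ∀ c : ℝ, ContDiff ℝ ∞ (fun y : ℝ × ℝ => (g (y.1 - c, y.2) : ℂ)) := by
    intro c
    exact Complex.ofRealCLM.contDiff.comp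
      (hg.comp ((contDiff_fst.sub contDiff_const).prodMk contDiff_snd))
  have hcell : ∀ x ∈ channel L, φ x = g x := by
    rintro x ⟨hx, -⟩
    have : ⌊x.1 / (2 * π)⌋ = 0 := hfl _ 0 (by simpa using hx.1.le) (by simpa using hx.2)
    simp [φ, this]
  refine ⟨φ, ⟨⟨?_, ?_⟩, ?_⟩, hcell⟩
  · rw [contDiff_iff_contDiffAt]
    intro x
    set n : ℤ := ⌊x.1 / (2 * π)⌋ with hn
    have hn1 : 2 * π * n ≤ x.1 := by
      have := Int.floor_le (x.1 / (2 * π)); rw [le_div_iff₀ hp] at this; linarith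
    have hn2 : x.1 < 2 * π * (n + 1) := by
      have := Int.lt_floor_add_one (x.1 / (2 * π)); rw [div_lt_iff₀ hp] at this; linarith
    have e2 : ∀ᶠ y : ℝ × ℝ in 𝓝 x, y.1 < 2 * π * (n + 1) :=
      continuous_fst.continuousAt.eventually (gt_mem_nhds hn2)
    rcases hn1.lt_or_eq with h | h
    · have e1 : ∀ᶠ y : ℝ × ℝ in 𝓝 x, 2 * π * n < y.1 :=
        continuous_fst.continuousAt.eventually (lt_mem_nhds h)
      refine (hsm (2 * π * n)).contDiffAt.congr_of_eventuallyEq ?_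
      filter_upwards [e1, e2] with y h1 h2
      simp [φ, hfl y.1 n h1.le h2]
    · have e1 : ∀ᶠ y : ℝ × ℝ in 𝓝 x, 2 * π * (n - 1) < y.1 :=
        continuous_fst.continuousAt.eventually (lt_mem_nhds (by rw [← h]; nlinarith))
      have z : ∀ c : ℝ, (x.1 - c, x.2) ∉ channel L →
          ∀ᶠ y : ℝ × ℝ in 𝓝 x, g (y.1 - c, y.2) = 0 := by
        intro c hcx
        have : Continuous fun y : ℝ × ℝ => (y.1 - c, y.2) := by fun_prop
        exact this.continuousAt.eventually (hz _ hcx)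
      have z1 := z (2 * π * n) (by simp [channel, ← h])
      have z2 := z (2 * π * (n - 1)) (by
        have : x.1 - 2 * π * (n - 1) = 2 * π := by rw [← h]; ring
        simp [channel, this])
      refine (contDiffAt_const (c := (0 : ℂ))).congr_of_eventuallyEq ?_
      filter_upwards [e1, e2, z1, z2] with y h1 h2 h3 h4
      rcases le_or_gt (2 * π * n) y.1 with h5 | h5
      · simp [φ, hfl y.1 n h5 h2, h3]
      · have := hfl y.1 (n - 1) (by push_cast; linarith) (by push_cast; linarith)
        simp only [φ, this]
        push_cast
        simp [h4]
  · intro x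
    have : ⌊(x.1 + 2 * π) / (2 * π)⌋ = ⌊x.1 / (2 * π)⌋ + 1 := by
      rw [add_div, div_self hp.ne', Int.floor_add_one]
    simp only [φ, this]
    push_cast
    congr 3
    ring
  · have hK : IsCompact (Prod.snd '' tsupport g) := hc.isCompact.image continuous_snd
    rcases (Prod.snd '' tsupport g).eq_empty_or_nonempty with h | h
    · refine ⟨1, L - 1, one_pos, by linarith, fun x hx => ?_⟩
      have : tsupport g = ∅ := by simpa using h
      have : g = 0 := by simpa [tsupport_eq_empty_iff] using this
      simp [φ, this] at hx
    · obtain ⟨a, ha⟩ := hK.exists_isLeast h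
      obtain ⟨b, hb⟩ := hK.exists_isGreatest h
      refine ⟨a, b, ?_, ?_, fun x hx => ?_⟩
      · obtain ⟨y, hy, rfl⟩ := ha.1
        exact (hs hy).2.1
      · obtain ⟨y, hy, rfl⟩ := hb.1
        exact (hs hy).2.2
      · have hx' : g (x.1 - 2 * π * (⌊x.1 / (2 * π)⌋ : ℤ), x.2) ≠ 0 := by
          simpa [φ] using hx
        have := mem_image_of_mem Prod.snd (subset_tsupport g hx')
        exact ⟨ha.2 this, hb.2 this⟩

/-- Weak derivatives are unique. -/
lemma HasWeakDeriv.unique {L : ℝ} {i : Fin 2} {u v v' : L2 L} (h : HasWeakDeriv L i u v)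
    (h' : HasWeakDeriv L i u v') : v = v' := by
  have hO : IsOpen (channel L) := isOpen_Ioo.prod isOpen_Ioo
  have hK : IsCompact (Icc 0 (2 * π) ×ˢ Icc 0 L : Set (ℝ × ℝ)) := isCompact_Icc.prod isCompact_Icc
  have hsub : channel L ⊆ Icc 0 (2 * π) ×ˢ Icc 0 L :=
    prod_mono Ioo_subset_Icc_self Ioo_subset_Icc_self
  have : IsFiniteMeasure (volume.restrict (channel L)) :=
    ⟨by simpa using (measure_mono hsub).trans_lt hK.measure_lt_top⟩
  rw [← sub_eq_zero]
  have hint : Integrable (v - v' : L2 L) (volume.restrict (channel L)) :=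
    (Lp.memLp (v - v')).integrable (by norm_num)
  have key := hO.ae_eq_zero_of_integral_contDiff_smul_eq_zero
    (μ := volume.restrict (channel L)) (f := (v - v' : L2 L))
    (hint.locallyIntegrable.locallyIntegrableOn _) ?_
  · refine Lp.eq_zero_iff_ae_eq_zero.2 ?_
    filter_upwards [key, ae_restrict_mem hO.measurableSet] with x hx hx'
    exact hx hx'
  · intro g hg hc hs
    obtain ⟨φ, hφ, hφg⟩ := exists_isTestFunction hg hc hs
    have e1 := h φ hφ
    have e2 := h' φ hφ
    have e3 : ∫ x in channel L, (v - v' : L2 L) x * φ x = 0 := by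
      have c := hφ.smooth.continuous
      rw [integral_mul_eq_inner c] at *
      rw [inner_sub_right]
      linear_combination e1 - e2
    rw [← e3]
    refine setIntegral_congr_fun hO.measurableSet fun x hx => ?_
    simp [hφg x hx, mul_comm]

/-- The weak Laplacian is unique. -/
lemma HasH2Laplacian.unique {L : ℝ} {u w w' : L2 L} (h : HasH2Laplacian L u w)
    (h' : HasH2Laplacian L u w') : w = w' := by
  obtain ⟨d, dd, h1, h2, rfl⟩ := h
  obtain ⟨d', dd', h1', h2', rfl⟩ := h'
  have hd : ∀ i, d i = d' i := fun i => (h1 i).unique (h1' i)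
  have hdd : ∀ i, dd i i = dd' i i := fun i => (h2 i i).unique (by rw [hd i]; exact h2' i i)
  rw [hdd 0, hdd 1]

/-- The relation `θ ∈ H²(Ω) ∩ H¹₀(Ω)`, `g = α Δ θ`: the graph of the Dirichlet Laplacian `A_L`. -/
def dirichletGraph (α L : ℝ) : Submodule ℂ (L2 L × L2 L) where
  carrier := {p | HasZeroTrace L p.1 ∧ ∃ w, HasH2Laplacian L p.1 w ∧ p.2 = (α : ℂ) • w}
  add_mem' := by
    rintro p q ⟨h1, w, h2, h3⟩ ⟨h1', w', h2', h3'⟩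
    refine ⟨by simpa using h1.lin h1' 1 1, w + w', by simpa using h2.lin h2' 1 1, ?_⟩
    simp [h3, h3']
  zero_mem' := ⟨HasZeroTrace.zero L, 0, HasH2Laplacian.zero L, by simp⟩
  smul_mem' := by
    rintro a p ⟨h1, w, h2, h3⟩
    refine ⟨by simpa using h1.lin h1 a 0, a • w, by simpa using h2.lin h2 a 0, ?_⟩
    simp [h3, smul_comm]

/-- The relation `u ∈ H²(Ω)² ∩ V¹₀(Ω)`, `f = ν ℙ Δ u`: the graph of the Stokes operator `A_S`. -/
def stokesGraph (ν L : ℝ) : Submodule ℂ (solenoidal L × solenoidal L) where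
  carrier := {p | HasZeroTrace L (p.1 : L2Vec L).fst ∧ HasZeroTrace L (p.1 : L2Vec L).snd ∧
    ∃ w₁ w₂ : L2 L, HasH2Laplacian L (p.1 : L2Vec L).fst w₁ ∧
      HasH2Laplacian L (p.1 : L2Vec L).snd w₂ ∧ p.2 = (ν : ℂ) • leray L (WithLp.toLp 2 (w₁, w₂))}
  add_mem' := by
    rintro p q ⟨t1, t2, w₁, w₂, h1, h2, h3⟩ ⟨t1', t2', w₁', w₂', h1', h2', h3'⟩
    refine ⟨by simpa using t1.lin t1' 1 1, by simpa using t2.lin t2' 1 1, w₁ + w₁', w₂ + w₂',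
      by simpa using h1.lin h1' 1 1, by simpa using h2.lin h2' 1 1, ?_⟩
    rw [Prod.snd_add, h3, h3', ← smul_add, ← map_add]
    rfl
  zero_mem' := by
    refine ⟨HasZeroTrace.zero L, HasZeroTrace.zero L, 0, 0, HasH2Laplacian.zero L,
      HasH2Laplacian.zero L, ?_⟩
    have : (WithLp.toLp 2 ((0 : L2 L), (0 : L2 L)) : L2Vec L) = 0 := rfl
    simp [this]
  smul_mem' := by
    rintro a p ⟨t1, t2, w₁, w₂, h1, h2, h3⟩
    refine ⟨by simpa using t1.lin t1 a 0, by simpa using t2.lin t2 a 0, a • w₁, a • w₂,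
      by simpa using h1.lin h1 a 0, by simpa using h2.lin h2 a 0, ?_⟩
    rw [Prod.smul_snd, h3, smul_comm, ← map_smul]
    rfl

/-- The buoyancy coupling `A_C θ = ℙ (0, θ)`. -/
def coupling (L : ℝ) (θ : L2 L) : solenoidal L := leray L (WithLp.toLp 2 (0, θ))

lemma coupling_lin {L : ℝ} (θ θ' : L2 L) (a b : ℂ) :
    coupling L (a • θ + b • θ') = a • coupling L θ + b • coupling L θ' := by
  unfold coupling
  rw [← map_smul, ← map_smul, ← map_add]
  congr 1
  refine (WithLp.ofLp_injective 2) (Prod.ext ?_ ?_) <;> simp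

/-- The graph of the linearized Boussinesq operator `A (u, θ) = (A_S u + A_C θ, A_L θ)` with domain
`D(A_S) × D(A_L)`. -/
def boussinesqGraph (ν α L : ℝ) : Submodule ℂ (StateSpace L × StateSpace L) where
  carrier := {p | (∃ f, (p.1.fst, f) ∈ stokesGraph ν L ∧ p.2.fst = f + coupling L p.1.snd) ∧
    (p.1.snd, p.2.snd) ∈ dirichletGraph α L}
  add_mem' := by
    rintro p q ⟨⟨f, h1, h2⟩, h3⟩ ⟨⟨f', h1', h2'⟩, h3'⟩
    refine ⟨⟨f + f', by simpa using add_mem h1 h1', ?_⟩, by simpa using add_mem h3 h3'⟩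
    have := coupling_lin p.1.snd q.1.snd 1 1
    simp only [one_smul] at this
    simp only [Prod.snd_add, Prod.fst_add, WithLp.add_fst, WithLp.add_snd, h2, h2', this]
    abel
  zero_mem' := by
    refine ⟨⟨0, zero_mem (stokesGraph ν L), ?_⟩, zero_mem (dirichletGraph α L)⟩
    have e := coupling_lin (0 : L2 L) 0 0 0
    simp only [smul_zero, add_zero, zero_smul] at e
    change (0 : solenoidal L) = 0 + coupling L 0
    rw [e, add_zero]
  smul_mem' := by
    rintro a p ⟨⟨f, h1, h2⟩, h3⟩
    have e := coupling_lin p.1.snd 0 a 0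
    rw [smul_zero, zero_smul, add_zero, add_zero] at e
    have g1 := (stokesGraph ν L).smul_mem a h1
    have g3 := (dirichletGraph α L).smul_mem a h3
    rw [Prod.smul_mk] at g1 g3
    refine ⟨⟨a • f, ?_, ?_⟩, ?_⟩
    · rw [Prod.smul_fst, WithLp.smul_fst]
      exact g1
    · rw [Prod.smul_fst, Prod.smul_snd, WithLp.smul_fst, WithLp.smul_snd, e, ← smul_add, ← h2]
    · rw [Prod.smul_fst, Prod.smul_snd, WithLp.smul_snd, WithLp.smul_snd]
      exact g3

lemma dirichletGraph_singleValued (α L : ℝ) :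
    ∀ p ∈ dirichletGraph α L, p.1 = 0 → p.2 = 0 := by
  rintro ⟨θ, g⟩ ⟨-, w, h2, h3⟩ rfl
  obtain rfl := h2.unique (HasH2Laplacian.zero L)
  simpa using h3

lemma stokesGraph_singleValued (ν L : ℝ) :
    ∀ p ∈ stokesGraph ν L, p.1 = 0 → p.2 = 0 := by
  rintro ⟨u, f⟩ ⟨-, -, w₁, w₂, h1, h2, h3⟩ rfl
  obtain rfl := h1.unique (HasH2Laplacian.zero L)
  obtain rfl := h2.unique (HasH2Laplacian.zero L)
  have : (WithLp.toLp 2 ((0 : L2 L), (0 : L2 L)) : L2Vec L) = 0 := rfl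
  simpa [this] using h3

lemma boussinesqGraph_singleValued (ν α L : ℝ) :
    ∀ p ∈ boussinesqGraph ν α L, p.1 = 0 → p.2 = 0 := by
  rintro ⟨Φ, F⟩ ⟨⟨f, h1, h2⟩, h3⟩ rfl
  have e1 : f = 0 := stokesGraph_singleValued ν L _ h1 rfl
  have e2 : F.snd = 0 := dirichletGraph_singleValued α L _ h3 rfl
  have e3 := coupling_lin (0 : L2 L) 0 0 0
  simp only [smul_zero, add_zero, zero_smul] at e3
  have e4 : F.fst = 0 := by
    rw [h2, e1, zero_add]
    exact e3
  exact (WithLp.ofLp_injective 2) (Prod.ext e4 e2)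

/-- The Stokes operator `A_S = ν ℙ Δ` on `V⁰ₙ(Ω)`, with domain `H²(Ω)² ∩ V¹₀(Ω)`. -/
def stokesOperator (ν L : ℝ) : solenoidal L →ₗ.[ℂ] solenoidal L := (stokesGraph ν L).toLinearPMap

/-- The linearized Boussinesq operator `A` on `X`. -/
def boussinesqOperator (ν α L : ℝ) : StateSpace L →ₗ.[ℂ] StateSpace L :=
  (boussinesqGraph ν α L).toLinearPMap

lemma stokesOperator_graph (ν L : ℝ) : (stokesOperator ν L).graph = stokesGraph ν L :=
  Submodule.toLinearPMap_graph_eq _ (stokesGraph_singleValued ν L)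

lemma boussinesqOperator_graph (ν α L : ℝ) :
    (boussinesqOperator ν α L).graph = boussinesqGraph ν α L :=
  Submodule.toLinearPMap_graph_eq _ (boussinesqGraph_singleValued ν α L)

/-- The adjoint operator `A*`, with respect to the inner product of `X`. -/
def boussinesqAdjoint (ν α L : ℝ) : StateSpace L →ₗ.[ℂ] StateSpace L :=
  (boussinesqOperator ν α L).adjoint

/-! ## Spectral notions for unbounded operators -/

section Spectral

variable {E : Type*} [NormedAddCommGroup E] [NormedSpace ℂ E]

/-- The spectrum of an unbounded operator `T`: the complement of the set of those `z` for which
`z - T : D(T) → E` has a bounded two-sided inverse. -/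
def unboundedSpectrum (T : E →ₗ.[ℂ] E) : Set ℂ :=
  {z | ¬ ∃ R : E →L[ℂ] E, (∀ x, ∃ h : R x ∈ T.domain, z • R x - T ⟨R x, h⟩ = x) ∧
    ∀ y : T.domain, R (z • (y : E) - T y) = y}

/-- The space `ker (T - z)ⁿ` of root vectors of order at most `n`. -/
def rootSpace (T : E →ₗ.[ℂ] E) (z : ℂ) : ℕ → Submodule ℂ E
  | 0 => ⊥
  | n + 1 => ((rootSpace T z n).comap (T.toFun - z • T.domain.subtype)).map T.domain.subtype

/-- The eigenspace `ker (T - z)`. -/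
def eigenspace (T : E →ₗ.[ℂ] E) (z : ℂ) : Submodule ℂ E := rootSpace T z 1

lemma mem_eigenspace {T : E →ₗ.[ℂ] E} {z : ℂ} {x : E} :
    x ∈ eigenspace T z ↔ ∃ h : x ∈ T.domain, T ⟨x, h⟩ = z • x := by
  simp [eigenspace, rootSpace, sub_eq_zero]

/-- `z` is an eigenvalue of `T`. -/
def IsEigenvalue (T : E →ₗ.[ℂ] E) (z : ℂ) : Prop := eigenspace T z ≠ ⊥

/-- The algebraic multiplicity of `z`, that is the dimension of the space `⋃ₙ ker (T - z)ⁿ` of all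
root vectors, is finite. -/
def HasFiniteAlgebraicMultiplicity (T : E →ₗ.[ℂ] E) (z : ℂ) : Prop :=
  FiniteDimensional ℂ (⨆ n, rootSpace T z n : Submodule ℂ E)

end Spectral

/-! ## The two parts of the spectrum, Fourier modes, eigenfunctions, pressures -/

/-- The transcendental equation for the frequency `m` of the `k`-th mode. For `k = 0`, where the
general equation is void, it is replaced by `sin (m L) = 0`. -/
def stokesDispersion (L : ℝ) (k : ℤ) (m : ℝ) : Prop :=
  if k = 0 then sin (m * L) = 0 else
    -sinh (k * L) * sin (m * L) * m ^ 2 + 2 * k * (1 - cosh (k * L) * cos (m * L)) * m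
      + k ^ 2 * sinh (k * L) * sin (m * L) = 0

/-- The set of the numbers `lam` whose `μ = √(k² + lam / ν)` is `i m` with `m > 0` a solution of the
transcendental equation. -/
def stokesModeSet (ν L : ℝ) (k : ℤ) : Set ℝ :=
  {lam | ∃ m : ℝ, 0 < m ∧ (k : ℝ) ^ 2 + lam / ν = -m ^ 2 ∧ stokesDispersion L k m}

/-- The Stokes part of the spectrum. -/
def SpS (ν L : ℝ) : Set ℂ := ⋃ k : ℤ, (fun r : ℝ => (r : ℂ)) '' stokesModeSet ν L k

/-- The Dirichlet Laplacian eigenvalue with indices `k`, `j`. -/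
def dirichletValue (α L : ℝ) (k : ℤ) (j : ℕ) : ℂ :=
  ((-α * ((k : ℝ) ^ 2 + j ^ 2 * π ^ 2 / L ^ 2) : ℝ) : ℂ)

/-- The Dirichlet Laplacian part of the spectrum. -/
def SpL (α L : ℝ) : Set ℂ := {z | ∃ (k : ℤ) (j : ℕ), 1 ≤ j ∧ z = dirichletValue α L k j}

/-- The function `sin (j π x₂ / L) exp (i k x₁)`. -/
def dirichletFun (L : ℝ) (k : ℤ) (j : ℕ) (x : ℝ × ℝ) : ℂ :=
  (sin (j * π / L * x.2) : ℂ) * Complex.exp (Complex.I * k * x.1)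

lemma continuous_dirichletFun (L : ℝ) (k : ℤ) (j : ℕ) : Continuous (dirichletFun L k j) := by
  unfold dirichletFun
  fun_prop

/-- The element `(ψ, ξ) = (0, sin (j π x₂ / L) exp (i k x₁))` of `X`. -/
def dirichletMode (L : ℝ) (k : ℤ) (j : ℕ) : StateSpace L :=
  WithLp.toLp 2 (0, (memLp_channel (continuous_dirichletFun L k j)).toLp _)

/-- The span of the functions `dirichletMode L k j` that belong to the value `z`. -/
def dirichletSpan (α L : ℝ) (z : ℂ) : Submodule ℂ (StateSpace L) :=
  Submodule.span ℂ {Φ | ∃ (k : ℤ) (j : ℕ), 1 ≤ j ∧ z = dirichletValue α L k j ∧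
    Φ = dirichletMode L k j}

/-- The `k`-th Fourier coefficient in `x₁`, as a function of `x₂`. -/
def fourierMode {L : ℝ} (u : L2 L) (k : ℤ) (y : ℝ) : ℂ :=
  (1 / (2 * π) : ℂ) * ∫ x in Ioo 0 (2 * π), u (x, y) * Complex.exp (-(Complex.I * k * x))

/-- `q` is a pressure for `ψ` and `z`: `z ψ - ν Δ ψ + ∇ q = 0` in the sense of distributions. -/
def IsPressure (ν L : ℝ) (z : ℂ) (ψ : solenoidal L) (q : L2 L) : Prop :=
  ∀ φ : ℝ × ℝ → ℂ, IsTestFunction L φ →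
    (∫ x in channel L, (ψ : L2Vec L).fst x * (z * φ x - ν * (partialDeriv 0 (partialDeriv 0 φ) x +
        partialDeriv 1 (partialDeriv 1 φ) x)) = ∫ x in channel L, q x * partialDeriv 0 φ x) ∧
    ∫ x in channel L, (ψ : L2Vec L).snd x * (z * φ x - ν * (partialDeriv 0 (partialDeriv 0 φ) x +
        partialDeriv 1 (partialDeriv 1 φ) x)) = ∫ x in channel L, q x * partialDeriv 1 φ x

/-- The sixth order differential equation on `(0, L)` for the parameters `k` and `z`. -/
def SixthOrderODE (ν α L : ℝ) (k : ℤ) (z : ℂ) (f : ℝ → ℂ) : Prop :=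
  ∀ y ∈ Ioo 0 L,
    -iteratedDeriv 6 f y + (z / α + z / ν + 3 * (k : ℂ) ^ 2) * iteratedDeriv 4 f y
      - ((z / ν + 2 * (k : ℂ) ^ 2) * (z / α + (k : ℂ) ^ 2) + (k : ℂ) ^ 2 * (z / ν + (k : ℂ) ^ 2))
        * iteratedDeriv 2 f y
      + (k : ℂ) ^ 2 * (z / ν + (k : ℂ) ^ 2) * (z / α + (k : ℂ) ^ 2) * f y = 0

/-- The boundary conditions of the sixth order equation, at the end point `y`. -/
def SixthOrderBC (α : ℝ) (k : ℤ) (z : ℂ) (f : ℝ → ℂ) (y : ℝ) : Prop :=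
  f y = 0 ∧ iteratedDeriv 2 f y = 0 ∧
    iteratedDeriv 3 f y - (z / α + (k : ℂ) ^ 2) * deriv f y = 0

end Boussinesq

end

open Boussinesq

/-!
The operator `A*` has a compact inverse of triangular form, and everything about its spectrum is
read off from the two diagonal entries, the Stokes operator and the Dirichlet Laplacian. Both are
studied by separation of variables, so that no elliptic regularity theory is needed: a Fourier mode
in `x₁` of a weak solution is a weak solution of an ordinary differential equation with constant
coefficients in `x₂`, and such solutions are smooth (`exists_contDiff_of_weak`).

*The Dirichlet Laplacian.* The functions `exp (i k x₁) sin (j π x₂ / L)` form a Hilbert basis of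
`L²(Ω)` (`sinBasis`), by the Stone–Weierstrass theorem. They diagonalize the compact symmetric
operator `K = (-Δ)^{-1/2}`, and `T = -α⁻¹ K²` is the inverse of `α Δ` on `H² ∩ H¹₀`
(`mem_dirichletGraph_iff`).

*The Stokes operator.* With `P` the projection onto the fields `w` for which `K w` is solenoidal,
the operator `S = -ν⁻¹ K P K` on solenoidal fields is compact, symmetric and injective, and `S A_S u
= u` (`eq_stokesInverse_of_mem`). If `u = z S u`, the modes of `u` are smooth, vanish at the
boundary and solve the Stokes eigenvalue problem in the classical sense (`exists_isStokesMode`), so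
that each of them lies in the domain of `A_S`. By the spectral theorem for `S` these modes are
complete (`eq_zero_of_forall_isStokesMode`). Testing with them shows that `A_S* y = w` implies `y =
S w` (`eq_stokesInverse_of_forall`), which is the self-adjointness of `A_S`, obtained without the
`H²`-regularity of the Stokes problem.

*The dispersion relation.* The vertical component `G` of a mode with `k ≠ 0` solves the clamped
problem `(D² - k²)(D² - k² - z / ν) G = 0`, `G = G' = 0` at `0` and `L`. The energy method excludes
`k² + z / ν ≥ 0`. For `k² + z / ν = -m²` the solutions that are clamped at `0` form a two-parameter
family, and the determinant of the two conditions at `L` is the left-hand side of the dispersion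
relation (`determinant_identity`). For `k = 0` the vertical component vanishes and the horizontal
one is a sine. Hence `SpS` consists of the `z` with `ker (1 - z S) ≠ 0` (`mem_SpS_iff`). The
dispersion function changes sign infinitely often (`exists_dispersion_root`), and the compactness of
`S` makes its roots countable.

*The operator `A*`.* By duality, `A* (ψ, ξ) = (f, g)` if and only if `ψ = S f` and `ξ = T (g - ψ₂)`
(`mem_boussinesqAdjoint_graph_iff`). The Fredholm alternative for this compact inverse shows that
the spectrum consists of eigenvalues (`mem_unboundedSpectrum_iff`); an eigenvector has `ψ ≠ 0` and
then `ψ = z S ψ`, or `ψ = 0` and then `ξ = z T ξ`, and conversely the equation for `ξ` is solvable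
if `1 - z T` is injective (`spectrum_adjoint`). As symmetric operators have no Jordan chains, the
chains of `A*` have length at most two, which bounds the algebraic multiplicities
(`hasFiniteAlgebraicMultiplicity_adjoint`). For an eigenvector, `(D² - k² - z / α) ξ_k = -G / α`,
and applying the fourth order operator of `G` gives the sixth order problem
(`sixthOrder_of_temperature_mode`).
-/

noncomputable section

namespace Boussinesq

/-! ### Regularity of weak solutions of ordinary differential equations -/

/-- Smooth functions on the line with compact support in `(0, L)`. -/
structure IsIntervalTest (L : ℝ) (η : ℝ → ℂ) : Prop where
  smooth : ContDiff ℝ ∞ η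
  support : ∃ a b : ℝ, 0 < a ∧ b < L ∧ ∀ y, η y ≠ 0 → a ≤ y ∧ y ≤ b

/-- The operator `(D - r₁) ⋯ (D - rₙ)`. -/
def diffOp : List ℂ → (ℝ → ℂ) → ℝ → ℂ
  | [], f => f
  | r :: rs, f => fun y => deriv (diffOp rs f) y - r * diffOp rs f y

/-- The transpose `(-D - rₙ) ⋯ (-D - r₁)` of `diffOp`. -/
def diffOpTranspose : List ℂ → (ℝ → ℂ) → ℝ → ℂ
  | [], f => f
  | r :: rs, f => diffOpTranspose rs fun y => -deriv f y - r * f y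

lemma contDiff_deriv {f : ℝ → ℂ} (hf : ContDiff ℝ ∞ f) : ContDiff ℝ ∞ (deriv f) :=
  (contDiff_infty_iff_deriv.1 hf).2

lemma hasDerivAt_of_contDiff {f : ℝ → ℂ} (hf : ContDiff ℝ ∞ f) (y : ℝ) :
    HasDerivAt f (deriv f y) y :=
  ((contDiff_infty_iff_deriv.1 hf).1 y).hasDerivAt

lemma contDiff_neg_deriv_sub {f : ℝ → ℂ} (hf : ContDiff ℝ ∞ f) (r : ℂ) :
    ContDiff ℝ ∞ fun y => -deriv f y - r * f y :=
  (contDiff_deriv hf).neg.sub (contDiff_const.mul hf)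

lemma contDiff_diffOp {f : ℝ → ℂ} (hf : ContDiff ℝ ∞ f) (rs : List ℂ) :
    ContDiff ℝ ∞ (diffOp rs f) := by
  induction rs with
  | nil => exact hf
  | cons r rs ih => exact (contDiff_deriv ih).sub (contDiff_const.mul ih)

lemma contDiff_diffOpTranspose (rs : List ℂ) :
    ∀ {f : ℝ → ℂ}, ContDiff ℝ ∞ f → ContDiff ℝ ∞ (diffOpTranspose rs f) := by
  induction rs with
  | nil => exact fun hf => hf
  | cons r rs ih => exact fun hf => ih (contDiff_neg_deriv_sub hf r)

lemma diffOpTranspose_sub_mul (rs : List ℂ) (c : ℂ) : ∀ {f g : ℝ → ℂ}, ContDiff ℝ ∞ f →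
    ContDiff ℝ ∞ g → diffOpTranspose rs (fun y => f y - c * g y) =
      fun y => diffOpTranspose rs f y - c * diffOpTranspose rs g y := by
  induction rs with
  | nil => exact fun _ _ => rfl
  | cons r rs ih =>
    intro f g hf hg
    simp only [diffOpTranspose]
    rw [← ih (contDiff_neg_deriv_sub hf r) (contDiff_neg_deriv_sub hg r)]
    congr 1
    funext y
    have h : HasDerivAt (fun y => f y - c * g y) (deriv f y - c * deriv g y) y :=
      (hasDerivAt_of_contDiff hf y).sub ((hasDerivAt_of_contDiff hg y).const_mul c)
    rw [h.deriv]
    ring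

lemma integrableOn_mul_continuous {L : ℝ} {u g : ℝ → ℂ} (hu : IntegrableOn u (Ioo 0 L))
    (hg : Continuous g) : IntegrableOn (fun y => u y * g y) (Ioo 0 L) :=
  hu.mul_continuousOn_of_subset hg.continuousOn measurableSet_Ioo isCompact_Icc
    Ioo_subset_Icc_self

lemma integrableOn_Ioo_of_continuous {L : ℝ} {g : ℝ → ℂ} (hg : Continuous g) :
    IntegrableOn g (Ioo 0 L) :=
  (hg.continuousOn.integrableOn_compact isCompact_Icc).mono_set Ioo_subset_Icc_self

lemma integrableOn_Ioo_mul {L : ℝ} {f g : ℝ → ℂ} (hf : Continuous f) (hg : Continuous g) :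
    IntegrableOn (fun y => f y * g y) (Ioo 0 L) :=
  integrableOn_Ioo_of_continuous (hf.mul hg)

lemma integral_Ioo_deriv {L : ℝ} (hL : 0 < L) {F F' : ℝ → ℂ} (h : ∀ y, HasDerivAt F (F' y) y)
    (hF' : Continuous F') : ∫ y in Ioo 0 L, F' y = F L - F 0 := by
  rw [← integral_Ioc_eq_integral_Ioo, ← intervalIntegral.integral_of_le hL.le]
  exact intervalIntegral.integral_eq_sub_of_hasDerivAt (fun y _ => h y)
    (hF'.intervalIntegrable _ _)

lemma IsIntervalTest.zero_left {L : ℝ} {η : ℝ → ℂ} (h : IsIntervalTest L η) {y : ℝ}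
    (hy : y ≤ 0) : η y = 0 := by
  obtain ⟨a, b, ha, hb, hs⟩ := h.support
  by_contra hne
  linarith [(hs y hne).1]

lemma IsIntervalTest.zero_right {L : ℝ} {η : ℝ → ℂ} (h : IsIntervalTest L η) {y : ℝ}
    (hy : L ≤ y) : η y = 0 := by
  obtain ⟨a, b, ha, hb, hs⟩ := h.support
  by_contra hne
  linarith [(hs y hne).2]

lemma IsIntervalTest.of_support {L : ℝ} {η ζ : ℝ → ℂ} (h : IsIntervalTest L η)
    (hζ : ContDiff ℝ ∞ ζ) (hs : ∀ y, η y = 0 → ζ y = 0) : IsIntervalTest L ζ := by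
  obtain ⟨a, b, ha, hb, hs'⟩ := h.support
  exact ⟨hζ, a, b, ha, hb, fun y hy => hs' y fun h0 => hy (hs y h0)⟩

lemma IsIntervalTest.deriv {L : ℝ} {η : ℝ → ℂ} (h : IsIntervalTest L η) :
    IsIntervalTest L (deriv η) := by
  obtain ⟨a, b, ha, hb, hs⟩ := h.support
  refine ⟨contDiff_deriv h.smooth, a, b, ha, hb, fun y hy => ?_⟩
  have hsub : tsupport η ⊆ Icc a b :=
    closure_minimal (fun z hz => hs z hz) isClosed_Icc
  exact hsub (support_deriv_subset hy)

lemma IsIntervalTest.sub_mul {L : ℝ} {η ζ : ℝ → ℂ} (h : IsIntervalTest L η)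
    (h' : IsIntervalTest L ζ) (c : ℂ) : IsIntervalTest L fun y => η y - c * ζ y := by
  obtain ⟨a, b, ha, hb, hs⟩ := h.support
  obtain ⟨a', b', ha', hb', hs'⟩ := h'.support
  refine ⟨h.smooth.sub (contDiff_const.mul h'.smooth), min a a', max b b', lt_min ha ha',
    max_lt hb hb', fun y hy => ?_⟩
  by_cases h0 : η y = 0
  · have h1 : ζ y ≠ 0 := by
      rintro h1
      simp [h0, h1] at hy
    exact ⟨(min_le_right _ _).trans (hs' y h1).1, (hs' y h1).2.trans (le_max_right _ _)⟩
  · exact ⟨(min_le_left _ _).trans (hs y h0).1, (hs y h0).2.trans (le_max_left _ _)⟩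

lemma contDiff_cexp_mul (r : ℂ) : ContDiff ℝ ∞ fun y : ℝ => Complex.exp (r * y) := by
  have : ContDiff ℝ ∞ fun y : ℝ => (y : ℂ) := Complex.ofRealCLM.contDiff
  exact (contDiff_const.mul this).cexp

lemma hasDerivAt_cexp_mul (r : ℂ) (y : ℝ) :
    HasDerivAt (fun y : ℝ => Complex.exp (r * y)) (r * Complex.exp (r * y)) y := by
  have h1 : HasDerivAt (fun y : ℝ => r * (y : ℂ)) r y := by
    simpa using (Complex.ofRealCLM.hasDerivAt (x := y)).const_mul r
  simpa [mul_comm] using h1.cexp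

lemma hasDerivAt_integral {g : ℝ → ℂ} (hg : Continuous g) (y : ℝ) :
    HasDerivAt (fun y => ∫ t in (0 : ℝ)..y, g t) (g y) y :=
  intervalIntegral.integral_hasDerivAt_right (hg.intervalIntegrable _ _)
    (hg.stronglyMeasurableAtFilter _ _) hg.continuousAt

lemma contDiff_integral {g : ℝ → ℂ} (hg : ContDiff ℝ ∞ g) :
    ContDiff ℝ ∞ fun y => ∫ t in (0 : ℝ)..y, g t := by
  rw [contDiff_infty_iff_deriv]
  refine ⟨fun y => (hasDerivAt_integral hg.continuous y).differentiableAt, ?_⟩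
  rwa [show _root_.deriv (fun y => ∫ t in (0 : ℝ)..y, g t) = g from
    funext fun y => (hasDerivAt_integral hg.continuous y).deriv]

/-- The primitive of a test function of vanishing integral is a test function. -/
lemma IsIntervalTest.primitive {L : ℝ} {η : ℝ → ℂ} (h : IsIntervalTest L η)
    (h0 : ∫ y in Ioo 0 L, η y = 0) : IsIntervalTest L fun y => ∫ t in (0 : ℝ)..y, η t := by
  obtain ⟨a, b, ha, hb, hs⟩ := h.support
  have hz : ∀ t, ¬ (a ≤ t ∧ t ≤ b) → η t = 0 := fun t ht => by
    by_contra hne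
    exact ht (hs t hne)
  refine ⟨contDiff_integral h.smooth, a, b, ha, hb, fun y hy => ?_⟩
  by_contra hcon
  apply hy
  rw [not_and_or, not_le, not_le] at hcon
  rcases hcon with hya | hyb
  · refine intervalIntegral.integral_zero_ae (Eventually.of_forall fun t ht => hz t ?_)
    rintro ⟨h1, -⟩
    rcases le_total 0 y with h2 | h2
    · rw [uIoc_of_le h2] at ht
      linarith [ht.2]
    · rw [uIoc_of_ge h2] at ht
      linarith [ht.2]
  · have hi : ∀ p q : ℝ, IntervalIntegrable η volume p q :=
      fun p q => h.smooth.continuous.intervalIntegrable p q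
    rcases le_or_gt L 0 with hL | hL
    · have : η = 0 := by
        funext t
        refine hz t ?_
        rintro ⟨h1, h2⟩
        linarith
      simp [this]
    · have e1 : ∫ t in (0 : ℝ)..L, η t = 0 := by
        rw [intervalIntegral.integral_of_le hL.le, integral_Ioc_eq_integral_Ioo, h0]
      rw [← intervalIntegral.integral_add_adjacent_intervals (hi 0 L) (hi L y), e1, zero_add]
      refine intervalIntegral.integral_zero_ae (Eventually.of_forall fun t ht => hz t ?_)
      rintro ⟨-, h1⟩
      rcases le_total L y with h2 | h2
      · rw [uIoc_of_le h2] at ht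
        linarith [ht.1]
      · rw [uIoc_of_ge h2] at ht
        linarith [ht.1]

/-- A first order equation with smooth right-hand side has a smooth solution. -/
lemma exists_contDiff_deriv_sub {h : ℝ → ℂ} (hh : ContDiff ℝ ∞ h) (r : ℂ) :
    ∃ p : ℝ → ℂ, ContDiff ℝ ∞ p ∧ ∀ y, HasDerivAt p (r * p y + h y) y := by
  have hg : ContDiff ℝ ∞ fun y : ℝ => Complex.exp (-r * y) * h y := (contDiff_cexp_mul _).mul hh
  refine ⟨fun y => Complex.exp (r * y) * ∫ t in (0 : ℝ)..y, Complex.exp (-r * t) * h t,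
    (contDiff_cexp_mul r).mul (contDiff_integral hg), fun y => ?_⟩
  refine ((hasDerivAt_cexp_mul r y).mul (hasDerivAt_integral hg.continuous y)).congr_deriv ?_
  have : Complex.exp (r * y) * Complex.exp (-r * y) = 1 := by
    rw [← Complex.exp_add]; simp
  linear_combination (h y) * this

/-- A test function whose integral against `exp (r y)` is `1`. -/
lemma exists_isIntervalTest {L : ℝ} (hL : 0 < L) (r : ℂ) :
    ∃ χ, IsIntervalTest L χ ∧ ∫ y in Ioo 0 L, χ y * Complex.exp (r * y) = 1 := by
  let f : ContDiffBump (L / 2) := ⟨L / 8, L / 4, by positivity, by linarith⟩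
  have hfs : ∀ y, f y ≠ 0 → L / 4 ≤ y ∧ y ≤ 3 * L / 4 := by
    intro y hy
    have : y ∈ Function.support f := hy
    rw [f.support_eq, Metric.mem_ball, Real.dist_eq, abs_lt] at this
    change -(L / 4) < _ ∧ _ < L / 4 at this
    constructor <;> linarith [this.1, this.2]
  have hint : (0 : ℝ) < ∫ y, f y := f.integral_pos
  have hset : ∫ y in Ioo 0 L, f y = ∫ y, f y := by
    apply setIntegral_eq_integral_of_forall_compl_eq_zero
    intro y hy
    by_contra hne
    have := hfs y hne
    exact hy ⟨by linarith, by linarith⟩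
  let c : ℂ := ((∫ y, f y : ℝ) : ℂ)⁻¹
  have hsm : ContDiff ℝ ∞ fun y => (f y : ℂ) := Complex.ofRealCLM.contDiff.comp f.contDiff
  refine ⟨fun y => c * (f y : ℂ) * Complex.exp (-r * y),
    ⟨(contDiff_const.mul hsm).mul (contDiff_cexp_mul _), L / 4, 3 * L / 4, by positivity,
      by linarith, fun y hy => hfs y fun h0 => hy (by simp [h0])⟩, ?_⟩
  have : ∀ y : ℝ, c * (f y : ℂ) * Complex.exp (-r * y) * Complex.exp (r * y) = c * (f y : ℂ) := by
    intro y
    rw [mul_assoc, ← Complex.exp_add]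
    simp
  simp only [this]
  rw [integral_const_mul, integral_complex_ofReal, hset]
  exact inv_mul_cancel₀ (by exact_mod_cast hint.ne')

/-- A functional on test functions that annihilates the range of `-D - r` is the integration
against a multiple of `exp (r y)`. -/
lemma exists_eq_const_mul_integral {L : ℝ} (hL : 0 < L) (r : ℂ) {ℓ : (ℝ → ℂ) → ℂ}
    (hlin : ∀ η ζ c, IsIntervalTest L η → IsIntervalTest L ζ →
      ℓ (fun y => η y - c * ζ y) = ℓ η - c * ℓ ζ)
    (h0 : ∀ η, IsIntervalTest L η → ℓ (fun y => -deriv η y - r * η y) = 0) :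
    ∃ C : ℂ, ∀ η, IsIntervalTest L η →
      ℓ η = C * ∫ y in Ioo 0 L, η y * Complex.exp (r * y) := by
  obtain ⟨χ, hχ, hχ1⟩ := exists_isIntervalTest hL r
  -- subtracting a multiple of `χ` puts `η` into the range of `-D - r`, since the only obstruction
  -- is the integral against `exp (r y)`
  refine ⟨ℓ χ, fun η hη => ?_⟩
  set c := ∫ y in Ioo 0 L, η y * Complex.exp (r * y) with hc
  have hζ := hη.sub_mul hχ c
  have hw : IsIntervalTest L fun y => (η y - c * χ y) * Complex.exp (r * y) :=
    hζ.of_support (hζ.smooth.mul (contDiff_cexp_mul r)) fun y hy => by rw [hy, zero_mul]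
  have hi : ∀ {f : ℝ → ℂ}, IsIntervalTest L f →
      IntegrableOn (fun y => f y * Complex.exp (r * y)) (Ioo 0 L) := fun hf =>
    integrableOn_Ioo_of_continuous (hf.smooth.continuous.mul (contDiff_cexp_mul r).continuous)
  have hw0 : ∫ y in Ioo 0 L, (η y - c * χ y) * Complex.exp (r * y) = 0 := by
    simp only [sub_mul, mul_assoc]
    rw [integral_sub (hi hη) ((hi hχ).const_mul c), integral_const_mul, hχ1, ← hc]
    ring
  have hP := hw.primitive hw0
  have hQ : IsIntervalTest L fun y : ℝ => -(Complex.exp (-r * y) *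
      ∫ t in (0 : ℝ)..y, (η t - c * χ t) * Complex.exp (r * t)) :=
    hP.of_support ((contDiff_cexp_mul _).mul hP.smooth).neg fun y hy => by rw [hy]; simp
  have e := h0 _ hQ
  have e2 : (fun y => -deriv (fun y : ℝ => -(Complex.exp (-r * y) *
      ∫ t in (0 : ℝ)..y, (η t - c * χ t) * Complex.exp (r * t))) y - r * -(Complex.exp (-r * y) *
      ∫ t in (0 : ℝ)..y, (η t - c * χ t) * Complex.exp (r * t))) = fun y => η y - c * χ y := by
    funext y
    have hd : HasDerivAt (fun y : ℝ => -(Complex.exp (-r * y) *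
        ∫ t in (0 : ℝ)..y, (η t - c * χ t) * Complex.exp (r * t))) _ y :=
      ((hasDerivAt_cexp_mul (-r) y).mul (hasDerivAt_integral hw.smooth.continuous y)).neg
    rw [hd.deriv]
    have : Complex.exp (-r * y) * Complex.exp (r * y) = 1 := by
      rw [← Complex.exp_add]; simp
    linear_combination (η y - c * χ y) * this
  rw [e2, hlin η χ c hη hχ] at e
  linear_combination e

/-- The fundamental lemma of the calculus of variations on `(0, L)`. -/
lemma ae_eq_of_integral_mul_eq {L : ℝ} {u h : ℝ → ℂ} (hu : IntegrableOn u (Ioo 0 L))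
    (hh : Continuous h)
    (H : ∀ η, IsIntervalTest L η → ∫ y in Ioo 0 L, u y * η y = ∫ y in Ioo 0 L, h y * η y) :
    ∀ᵐ y ∂volume.restrict (Ioo 0 L), u y = h y := by
  have hi : IntegrableOn (fun y => u y - h y) (Ioo 0 L) :=
    hu.sub (integrableOn_Ioo_of_continuous hh)
  have key := isOpen_Ioo.ae_eq_zero_of_integral_contDiff_smul_eq_zero
    (μ := volume.restrict (Ioo 0 L)) (f := fun y => u y - h y) (U := Ioo 0 L)
    (hi.integrable.locallyIntegrable.locallyIntegrableOn _) ?_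
  · filter_upwards [key, ae_restrict_mem measurableSet_Ioo] with y hy hy'
    exact sub_eq_zero.1 (hy hy')
  · intro g hg hc hs
    have hη : IsIntervalTest L fun y => (g y : ℂ) := by
      refine ⟨Complex.ofRealCLM.contDiff.comp hg, ?_⟩
      rcases (tsupport g).eq_empty_or_nonempty with h | h
      · refine ⟨1, L - 1, one_pos, by linarith, fun y hy => ?_⟩
        have : g = 0 := by simpa [tsupport_eq_empty_iff] using h
        simp [this] at hy
      · obtain ⟨a, ha⟩ := hc.isCompact.exists_isLeast h
        obtain ⟨b, hb⟩ := hc.isCompact.exists_isGreatest h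
        refine ⟨a, b, (hs ha.1).1, (hs hb.1).2, fun y hy => ?_⟩
        have hy' : y ∈ tsupport g := subset_tsupport g (by simpa using hy)
        exact ⟨ha.2 hy', hb.2 hy'⟩
    have e := H _ hη
    have c := hη.smooth.continuous
    rw [← sub_eq_zero, ← integral_sub (integrableOn_mul_continuous hu c)
      (integrableOn_Ioo_mul hh c)] at e
    rw [← e]
    refine integral_congr_ae (Eventually.of_forall fun y => ?_)
    simp only [Complex.real_smul]
    ring

/-- A weak solution of a linear equation with constant coefficients, given in factored form, and
with smooth right-hand side is smooth. The roots are removed one at a time. -/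
theorem exists_contDiff_of_weak {L : ℝ} (hL : 0 < L) {u : ℝ → ℂ} (hu : IntegrableOn u (Ioo 0 L))
    (rs : List ℂ) : ∀ {h : ℝ → ℂ}, ContDiff ℝ ∞ h →
    (∀ η, IsIntervalTest L η →
      ∫ y in Ioo 0 L, u y * diffOpTranspose rs η y = ∫ y in Ioo 0 L, h y * η y) →
    ∃ W : ℝ → ℂ, ContDiff ℝ ∞ W ∧ (∀ᵐ y ∂volume.restrict (Ioo 0 L), u y = W y) ∧
      diffOp rs W = h := by
  induction rs with
  | nil =>
    intro h hh H
    exact ⟨h, hh, ae_eq_of_integral_mul_eq hu hh.continuous H, rfl⟩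
  | cons r rs ih =>
    intro h hh H
    obtain ⟨p, hp, hp'⟩ := exists_contDiff_deriv_sub hh r
    have hu' : ∀ {η}, IsIntervalTest L η →
        IntegrableOn (fun y => u y * diffOpTranspose rs η y) (Ioo 0 L) := fun hη =>
      integrableOn_mul_continuous hu (contDiff_diffOpTranspose rs hη.smooth).continuous
    have hpi : ∀ {η}, IsIntervalTest L η → IntegrableOn (fun y => p y * η y) (Ioo 0 L) :=
      fun hη => integrableOn_Ioo_of_continuous (hp.continuous.mul hη.smooth.continuous)
    set ℓ : (ℝ → ℂ) → ℂ := fun η => (∫ y in Ioo 0 L, u y * diffOpTranspose rs η y) -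
      ∫ y in Ioo 0 L, p y * η y with hℓ
    have hlin : ∀ η ζ c, IsIntervalTest L η → IsIntervalTest L ζ →
        ℓ (fun y => η y - c * ζ y) = ℓ η - c * ℓ ζ := by
      intro η ζ c hη hζ
      simp only [hℓ]
      rw [diffOpTranspose_sub_mul rs c hη.smooth hζ.smooth]
      have e1 : ∫ y in Ioo 0 L, u y * (diffOpTranspose rs η y - c * diffOpTranspose rs ζ y) =
          (∫ y in Ioo 0 L, u y * diffOpTranspose rs η y) -
            c * ∫ y in Ioo 0 L, u y * diffOpTranspose rs ζ y := by
        rw [← integral_const_mul, ← integral_sub (hu' hη) ((hu' hζ).const_mul c)]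
        refine integral_congr_ae (Eventually.of_forall fun y => ?_)
        simp only
        ring
      have e2 : ∫ y in Ioo 0 L, p y * (η y - c * ζ y) =
          (∫ y in Ioo 0 L, p y * η y) - c * ∫ y in Ioo 0 L, p y * ζ y := by
        rw [← integral_const_mul, ← integral_sub (hpi hη) ((hpi hζ).const_mul c)]
        refine integral_congr_ae (Eventually.of_forall fun y => ?_)
        simp only
        ring
      rw [e1, e2]
      ring
    have h0 : ∀ η, IsIntervalTest L η → ℓ (fun y => -deriv η y - r * η y) = 0 := by
      intro η hη
      have e1 := H η hη
      simp only [diffOpTranspose] at e1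
      simp only [hℓ]
      rw [e1, ← integral_sub (integrableOn_Ioo_mul hh.continuous hη.smooth.continuous)
        (integrableOn_Ioo_mul hp.continuous (contDiff_neg_deriv_sub hη.smooth r).continuous)]
      have e2 := integral_Ioo_deriv hL (F := fun y => p y * η y)
        (F' := fun y => (r * p y + h y) * η y + p y * deriv η y)
        (fun y => (hp' y).mul (hasDerivAt_of_contDiff hη.smooth y))
        (by
          have := hp.continuous
          have := hh.continuous
          have := hη.smooth.continuous
          have := hη.deriv.smooth.continuous
          fun_prop)
      rw [hη.zero_left le_rfl, hη.zero_right le_rfl] at e2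
      rw [show (0 : ℂ) = p L * 0 - p 0 * 0 by ring, ← e2]
      refine integral_congr_ae (Eventually.of_forall fun y => ?_)
      simp only
      ring
    -- peeling off the factor `D - r` changes the right-hand side by a solution of `(D - r) p = 0`
    obtain ⟨C, hC⟩ := exists_eq_const_mul_integral hL r hlin h0
    have hexp := contDiff_cexp_mul r
    obtain ⟨W, hW, hW1, hW2⟩ := ih (h := fun y => p y + C * Complex.exp (r * y))
      (hp.add (contDiff_const.mul hexp)) (fun η hη => by
        have e := hC η hη
        have e2 : ∫ y in Ioo 0 L, (p y + C * Complex.exp (r * y)) * η y =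
            (∫ y in Ioo 0 L, p y * η y) +
              C * ∫ y in Ioo 0 L, η y * Complex.exp (r * y) := by
          rw [← integral_const_mul, ← integral_add (hpi hη)
            ((integrableOn_Ioo_of_continuous (g := fun y => η y * Complex.exp (r * y))
              (hη.smooth.continuous.mul hexp.continuous)).const_mul C)]
          refine integral_congr_ae (Eventually.of_forall fun y => ?_)
          simp only
          ring
        rw [e2]
        linear_combination e)
    refine ⟨W, hW, hW1, ?_⟩
    funext y
    simp only [diffOp, hW2]
    have hd : HasDerivAt (fun y => p y + C * Complex.exp (r * y)) _ y :=
      (hp' y).add ((hasDerivAt_cexp_mul r y).const_mul C)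
    rw [hd.deriv]
    ring

/-- A solution of a homogeneous linear equation with vanishing Cauchy data at `0` vanishes. -/
lemma eq_zero_of_diffOp_eq_zero {W : ℝ → ℂ} (hW : ContDiff ℝ ∞ W) (rs : List ℂ)
    (h : ∀ y, diffOp rs W y = 0) (h0 : ∀ n < rs.length, diffOp (rs.drop (n + 1)) W 0 = 0) :
    ∀ y, W y = 0 := by
  induction rs with
  | nil => exact h
  | cons r rs ih =>
    refine ih (fun y => ?_) fun n hn => by simpa using h0 (n + 1) (by simpa using hn)
    have hd : ∀ y, HasDerivAt (fun y : ℝ => Complex.exp (-r * y) * diffOp rs W y) 0 y := by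
      intro y
      refine ((hasDerivAt_cexp_mul (-r) y).mul
        (hasDerivAt_of_contDiff (contDiff_diffOp hW rs) y)).congr_deriv ?_
      have := h y
      simp only [diffOp] at this
      linear_combination (Complex.exp (-r * y)) * this
    have e := is_const_of_deriv_eq_zero (fun y => (hd y).differentiableAt)
      (fun y => (hd y).deriv) y 0
    have e0 : diffOp rs W 0 = 0 := by simpa using h0 0 (by simp)
    simpa [e0, Complex.exp_ne_zero] using e

/-! ### Integration by parts on the channel -/

lemma restrict_channel (L : ℝ) : (volume.restrict (channel L) : Measure (ℝ × ℝ)) =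
    (volume.restrict (Ioo 0 (2 * π))).prod (volume.restrict (Ioo 0 L)) := by
  rw [Measure.prod_restrict, channel, Measure.volume_eq_prod]

instance isFiniteMeasure_channel (L : ℝ) : IsFiniteMeasure (volume.restrict (channel L)) := by
  rw [restrict_channel]
  infer_instance

lemma integrable_channel {L : ℝ} {g : ℝ × ℝ → ℂ} (hg : Continuous g) :
    Integrable g (volume.restrict (channel L)) :=
  (memLp_channel hg).integrable (by norm_num)

lemma integrable_channel_mul {L : ℝ} {f g : ℝ × ℝ → ℂ} (hf : Continuous f) (hg : Continuous g) :
    Integrable (fun x => f x * g x) (volume.restrict (channel L)) :=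
  integrable_channel (hf.mul hg)

lemma integral_channel {L : ℝ} {f : ℝ × ℝ → ℂ} (hf : Integrable f (volume.restrict (channel L))) :
    ∫ x in channel L, f x = ∫ y in Ioo 0 L, ∫ x in Ioo 0 (2 * π), f (x, y) := by
  rw [restrict_channel] at hf ⊢
  exact integral_prod_symm _ hf

lemma integrableOn_integral_slice {L : ℝ} {f : ℝ × ℝ → ℂ}
    (hf : Integrable f (volume.restrict (channel L))) :
    IntegrableOn (fun y => ∫ x in Ioo 0 (2 * π), f (x, y)) (Ioo 0 L) := by
  rw [restrict_channel] at hf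
  exact hf.integral_prod_right

lemma integrable_coeFn_mul {L : ℝ} (u : L2 L) {g : ℝ × ℝ → ℂ} (hg : Continuous g) :
    Integrable (fun x => u x * g x) (volume.restrict (channel L)) :=
  (Lp.memLp u).integrable_mul (memLp_channel hg)

/-- The class in `L²(Ω)` of a continuous function. -/
def contL2 (L : ℝ) {φ : ℝ × ℝ → ℂ} (hφ : Continuous φ) : L2 L := (memLp_channel hφ).toLp φ

lemma coeFn_contL2 (L : ℝ) {φ : ℝ × ℝ → ℂ} (hφ : Continuous φ) :
    contL2 L hφ =ᵐ[volume.restrict (channel L)] φ :=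
  MemLp.coeFn_toLp _

lemma integral_contL2_mul {L : ℝ} {φ : ℝ × ℝ → ℂ} (hφ : Continuous φ) (g : ℝ × ℝ → ℂ) :
    ∫ x in channel L, contL2 L hφ x * g x = ∫ x in channel L, φ x * g x := by
  refine integral_congr_ae ?_
  filter_upwards [coeFn_contL2 L hφ] with x hx
  rw [hx]

lemma inner_contL2 {L : ℝ} {φ : ℝ × ℝ → ℂ} (hφ : Continuous φ) (u : L2 L) :
    inner ℂ (contL2 L hφ) u = ∫ x in channel L, u x * (starRingEnd ℂ) (φ x) := by
  rw [integral_mul_eq_inner (g := fun x => (starRingEnd ℂ) (φ x))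
    (Complex.continuous_conj.comp hφ)]
  simp [contL2, Function.comp_def]

lemma IsPeriodicSmooth.differentiable {φ : ℝ × ℝ → ℂ} (h : IsPeriodicSmooth φ) :
    Differentiable ℝ φ := h.smooth.differentiable (by simp)

lemma IsPeriodicSmooth.mul {φ ψ : ℝ × ℝ → ℂ} (h : IsPeriodicSmooth φ) (h' : IsPeriodicSmooth ψ) :
    IsPeriodicSmooth fun x => φ x * ψ x :=
  ⟨h.smooth.mul h'.smooth, fun x => by rw [h.periodic, h'.periodic]⟩

lemma IsPeriodicSmooth.partialDeriv {φ : ℝ × ℝ → ℂ} (h : IsPeriodicSmooth φ) (i : Fin 2) :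
    IsPeriodicSmooth (partialDeriv i φ) := by
  refine ⟨?_, fun x => ?_⟩
  · have : ContDiff ℝ ∞ (fderiv ℝ φ) := h.smooth.fderiv_right (by simp)
    exact this.clm_apply contDiff_const
  · have e : (fun y : ℝ × ℝ => φ (y + (2 * π, 0))) = φ := by
      funext y
      rw [show y + ((2 * π, 0) : ℝ × ℝ) = (y.1 + 2 * π, y.2) by ext <;> simp]
      exact h.periodic y
    have e2 : fderiv ℝ φ (x + (2 * π, 0)) = fderiv ℝ φ x := by
      rw [← fderiv_comp_add_right, e]
    rw [show (x.1 + 2 * π, x.2) = x + ((2 * π, 0) : ℝ × ℝ) by ext <;> simp]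
    simp only [Boussinesq.partialDeriv, e2]

lemma partialDeriv_mul {φ ψ : ℝ × ℝ → ℂ} (h : Differentiable ℝ φ) (h' : Differentiable ℝ ψ)
    (i : Fin 2) (x : ℝ × ℝ) : partialDeriv i (fun x => φ x * ψ x) x =
      φ x * partialDeriv i ψ x + partialDeriv i φ x * ψ x := by
  simp only [partialDeriv]
  have := fderiv_fun_mul (h x) (h' x)
  rw [this]
  simp [mul_comm]

lemma hasDerivAt_slice_fst {φ : ℝ × ℝ → ℂ} (h : Differentiable ℝ φ) (x y : ℝ) :
    HasDerivAt (fun x => φ (x, y)) (partialDeriv 0 φ (x, y)) x := by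
  have h1 : HasDerivAt (fun x : ℝ => (x, y)) ((1 : ℝ), (0 : ℝ)) x :=
    (hasDerivAt_id x).prodMk (hasDerivAt_const x y)
  exact ((h (x, y)).hasFDerivAt.comp_hasDerivAt x h1)

lemma hasDerivAt_slice_snd {φ : ℝ × ℝ → ℂ} (h : Differentiable ℝ φ) (x y : ℝ) :
    HasDerivAt (fun y => φ (x, y)) (partialDeriv 1 φ (x, y)) y := by
  have h1 : HasDerivAt (fun y : ℝ => (x, y)) ((0 : ℝ), (1 : ℝ)) y :=
    (hasDerivAt_const y x).prodMk (hasDerivAt_id y)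
  exact ((h (x, y)).hasFDerivAt.comp_hasDerivAt y h1)

lemma integral_partialDeriv_zero {L : ℝ} {φ : ℝ × ℝ → ℂ} (h : IsPeriodicSmooth φ) :
    ∫ x in channel L, partialDeriv 0 φ x = 0 := by
  have c := h.continuous_partialDeriv 0
  rw [integral_channel (integrable_channel c)]
  refine integral_eq_zero_of_ae (Eventually.of_forall fun y => ?_)
  simp only [Pi.zero_apply]
  rw [integral_Ioo_deriv (F := fun x => φ (x, y)) (by positivity)
    (fun x => hasDerivAt_slice_fst h.differentiable x y) (c.comp (by fun_prop))]
  have := h.periodic (0, y)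
  simp only [zero_add] at this
  simp [this]

lemma integral_partialDeriv_one {L : ℝ} (hL : 0 < L) {φ : ℝ × ℝ → ℂ} (h : IsPeriodicSmooth φ)
    (h0 : ∀ x, φ (x, 0) = 0) (h1 : ∀ x, φ (x, L) = 0) :
    ∫ x in channel L, partialDeriv 1 φ x = 0 := by
  have c := h.continuous_partialDeriv 1
  have hi := integrable_channel (L := L) c
  rw [restrict_channel] at hi ⊢
  rw [integral_prod _ hi]
  refine integral_eq_zero_of_ae (Eventually.of_forall fun x => ?_)
  simp only [Pi.zero_apply]
  rw [integral_Ioo_deriv (F := fun y => φ (x, y)) hL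
    (fun y => hasDerivAt_slice_snd h.differentiable x y) (c.comp (by fun_prop))]
  simp [h0, h1]

lemma IsTestFunction.zero_bottom {L : ℝ} {φ : ℝ × ℝ → ℂ} (h : IsTestFunction L φ) (x : ℝ) :
    φ (x, 0) = 0 := by
  obtain ⟨a, b, ha, hb, hs⟩ := h.support
  by_contra hne
  have := (hs _ hne).1
  simp only at this
  linarith

lemma IsTestFunction.zero_top {L : ℝ} {φ : ℝ × ℝ → ℂ} (h : IsTestFunction L φ) (x : ℝ) :
    φ (x, L) = 0 := by
  obtain ⟨a, b, ha, hb, hs⟩ := h.support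
  by_contra hne
  have := (hs _ hne).2
  simp only at this
  linarith

lemma integral_mul_partialDeriv {L : ℝ} (hL : 0 < L) {φ ψ : ℝ × ℝ → ℂ} (h : IsPeriodicSmooth φ)
    (h' : IsPeriodicSmooth ψ) (i : Fin 2)
    (hb : i = 1 → ∀ x, φ (x, 0) * ψ (x, 0) = 0 ∧ φ (x, L) * ψ (x, L) = 0) :
    (∫ x in channel L, φ x * partialDeriv i ψ x) +
      ∫ x in channel L, partialDeriv i φ x * ψ x = 0 := by
  rw [← integral_add (integrable_channel_mul h.smooth.continuous (h'.continuous_partialDeriv i))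
    (integrable_channel_mul (h.continuous_partialDeriv i) h'.smooth.continuous)]
  simp only [← partialDeriv_mul h.differentiable h'.differentiable]
  fin_cases i
  · exact integral_partialDeriv_zero (h.mul h')
  · exact integral_partialDeriv_one hL (h.mul h') (fun x => (hb rfl x).1) fun x => (hb rfl x).2

lemma hasWeakDeriv_contL2 {L : ℝ} (hL : 0 < L) {φ : ℝ × ℝ → ℂ} (h : IsPeriodicSmooth φ)
    (i : Fin 2) :
    HasWeakDeriv L i (contL2 L h.smooth.continuous) (contL2 L (h.continuous_partialDeriv i)) := by
  intro ψ hψ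
  rw [integral_contL2_mul, integral_contL2_mul, eq_neg_iff_add_eq_zero]
  exact integral_mul_partialDeriv hL h hψ.toIsPeriodicSmooth i fun _ x => by
    simp [hψ.zero_bottom, hψ.zero_top]

lemma hasZeroTrace_contL2 {L : ℝ} (hL : 0 < L) {φ : ℝ × ℝ → ℂ} (h : IsPeriodicSmooth φ)
    (h0 : ∀ x, φ (x, 0) = 0) (h1 : ∀ x, φ (x, L) = 0) :
    HasZeroTrace L (contL2 L h.smooth.continuous) := by
  refine ⟨_, hasWeakDeriv_contL2 hL h 1, fun ψ hψ => ?_⟩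
  rw [integral_contL2_mul, integral_contL2_mul]
  exact integral_mul_partialDeriv hL h hψ 1 fun _ x => by simp [h0, h1]

/-! ### Separated functions and Fourier modes -/

/-- The function `exp (i k x₁) f(x₂)`. -/
def separated (k : ℤ) (f : ℝ → ℂ) (x : ℝ × ℝ) : ℂ := Complex.exp (Complex.I * k * x.1) * f x.2

lemma isPeriodicSmooth_separated (k : ℤ) {f : ℝ → ℂ} (hf : ContDiff ℝ ∞ f) :
    IsPeriodicSmooth (separated k f) := by
  refine ⟨((contDiff_cexp_mul (Complex.I * k)).comp contDiff_fst).mul (hf.comp contDiff_snd),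
    fun x => ?_⟩
  simp only [separated]
  congr 1
  rw [Complex.exp_eq_exp_iff_exists_int]
  exact ⟨k, by push_cast; ring⟩

lemma continuous_separated (k : ℤ) {f : ℝ → ℂ} (hf : Continuous f) :
    Continuous (separated k f) := by
  unfold separated
  fun_prop

lemma isTestFunction_separated {L : ℝ} (k : ℤ) {η : ℝ → ℂ} (hη : IsIntervalTest L η) :
    IsTestFunction L (separated k η) := by
  obtain ⟨a, b, ha, hb, hs⟩ := hη.support
  refine ⟨isPeriodicSmooth_separated k hη.smooth, a, b, ha, hb, fun x hx => hs _ fun h0 => hx ?_⟩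
  simp [separated, h0]

lemma partialDeriv_zero_separated (k : ℤ) {f : ℝ → ℂ} (hf : ContDiff ℝ ∞ f) :
    partialDeriv 0 (separated k f) = separated k fun y => Complex.I * k * f y := by
  funext x
  have h1 := hasDerivAt_slice_fst (isPeriodicSmooth_separated k hf).differentiable x.1 x.2
  have h2 : HasDerivAt (fun t => separated k f (t, x.2))
      (Complex.I * k * Complex.exp (Complex.I * k * x.1) * f x.2) x.1 :=
    (hasDerivAt_cexp_mul (Complex.I * k) x.1).mul_const (f x.2)
  rw [h1.unique h2]
  simp only [separated]
  ring

lemma partialDeriv_one_separated (k : ℤ) {f : ℝ → ℂ} (hf : ContDiff ℝ ∞ f) :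
    partialDeriv 1 (separated k f) = separated k (deriv f) := by
  funext x
  have h1 := hasDerivAt_slice_snd (isPeriodicSmooth_separated k hf).differentiable x.1 x.2
  have h2 : HasDerivAt (fun t => separated k f (x.1, t)) (separated k (deriv f) x) x.2 :=
    (hasDerivAt_of_contDiff hf x.2).const_mul (Complex.exp (Complex.I * k * x.1))
  exact h1.unique h2

lemma integrableOn_fourierMode {L : ℝ} (u : L2 L) (k : ℤ) :
    IntegrableOn (fourierMode u k) (Ioo 0 L) := by
  have h := integrable_coeFn_mul u (g := fun x => Complex.exp (-(Complex.I * k * x.1)))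
    (by fun_prop)
  exact (integrableOn_integral_slice h).const_mul _

/-- Testing against a separated function is testing a Fourier mode. -/
lemma integral_mul_separated {L : ℝ} (u : L2 L) (k : ℤ) {g : ℝ → ℂ} (hg : Continuous g) :
    ∫ x in channel L, u x * separated (-k) g x =
      2 * π * ∫ y in Ioo 0 L, fourierMode u k y * g y := by
  rw [integral_channel (integrable_coeFn_mul u (continuous_separated (-k) hg)),
    ← integral_const_mul]
  refine integral_congr_ae (Eventually.of_forall fun y => ?_)
  simp only [separated, fourierMode, Int.cast_neg]
  have hp : (π : ℂ) ≠ 0 := by exact_mod_cast pi_ne_zero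
  calc _ = ∫ x in Ioo 0 (2 * π), u (x, y) * Complex.exp (-(Complex.I * k * x)) * g y := by
        refine integral_congr_ae (Eventually.of_forall fun x => ?_)
        simp only [mul_neg, neg_mul]
        ring
    _ = _ := by
        rw [integral_mul_const]
        field_simp

/-- The inner products with separated functions are those of the Fourier modes on `(0, L)`. -/
lemma inner_contL2_separated {L : ℝ} (u : L2 L) (k : ℤ) {f : ℝ → ℂ} (hf : Continuous f) :
    inner ℂ (contL2 L (continuous_separated k hf)) u =
      2 * π * ∫ y in Ioo 0 L, fourierMode u k y * (starRingEnd ℂ) (f y) := by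
  rw [inner_contL2, ← integral_mul_separated u k (g := fun y => (starRingEnd ℂ) (f y)) (Complex.continuous_conj.comp hf)]
  refine integral_congr_ae (Eventually.of_forall fun x => ?_)
  simp only [separated, map_mul, ← Complex.exp_conj, Complex.conj_I, map_intCast,
    Complex.conj_ofReal, Int.cast_neg]
  ring_nf

/-! ### Completeness of the Dirichlet modes -/

section Completeness

instance fact_two_pi_pos : Fact ((0 : ℝ) < 2 * π) := ⟨by positivity⟩

/-- The function `exp (i k x₁) cos (j π x₂ / L)` on the compact channel `𝕋 × [0, L]`. -/
def cosMonomial (L : ℝ) (p : ℤ × ℤ) : C(AddCircle (2 * π) × Icc 0 L, ℂ) where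
  toFun z := fourier p.1 z.1 * (Real.cos (p.2 * (π / L * z.2)) : ℂ)
  continuous_toFun := by fun_prop

/-- The trigonometric polynomials that are even in `x₂`; they are closed under multiplication by the
product formula for the cosine. -/
def cosAlgebra (L : ℝ) : StarSubalgebra ℂ C(AddCircle (2 * π) × Icc 0 L, ℂ) where
  carrier := Submodule.span ℂ (range (cosMonomial L))
  add_mem' := fun ha hb => add_mem ha hb
  zero_mem' := zero_mem _
  mul_mem' := by
    intro F G hF hG
    induction hF using Submodule.span_induction with
    | mem F hF =>
      obtain ⟨p, rfl⟩ := hF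
      induction hG using Submodule.span_induction with
      | mem G hG =>
        obtain ⟨q, rfl⟩ := hG
        have : cosMonomial L p * cosMonomial L q =
            (1 / 2 : ℂ) • cosMonomial L (p.1 + q.1, p.2 + q.2) +
              (1 / 2 : ℂ) • cosMonomial L (p.1 + q.1, p.2 - q.2) := by
          ext z
          simp only [cosMonomial, ContinuousMap.mul_apply, ContinuousMap.coe_mk,
            ContinuousMap.add_apply, ContinuousMap.smul_apply, smul_eq_mul, fourier_add,
            Int.cast_add, Int.cast_sub, add_mul, sub_mul, Real.cos_add, Real.cos_sub]
          push_cast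
          ring
        rw [this]
        exact add_mem (Submodule.smul_mem _ _ (Submodule.subset_span ⟨_, rfl⟩))
          (Submodule.smul_mem _ _ (Submodule.subset_span ⟨_, rfl⟩))
      | zero => simp
      | add G G' _ _ h h' => rw [mul_add]; exact add_mem h h'
      | smul a G _ h => rw [mul_smul_comm]; exact Submodule.smul_mem _ _ h
    | zero => simp
    | add F F' _ _ h h' => rw [add_mul]; exact add_mem h h'
    | smul a F _ h => rw [smul_mul_assoc]; exact Submodule.smul_mem _ _ h
  one_mem' := by
    refine Submodule.subset_span ⟨0, ?_⟩
    ext z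
    simp [cosMonomial]
  algebraMap_mem' := by
    intro a
    have : algebraMap ℂ C(AddCircle (2 * π) × Icc 0 L, ℂ) a = a • cosMonomial L 0 := by
      ext z
      simp [cosMonomial]
    rw [this]
    exact Submodule.smul_mem _ _ (Submodule.subset_span ⟨_, rfl⟩)
  star_mem' := by
    intro F hF
    induction hF using Submodule.span_induction with
    | mem F hF =>
      obtain ⟨p, rfl⟩ := hF
      refine Submodule.subset_span ⟨(-p.1, p.2), ?_⟩
      ext z
      simp only [cosMonomial, ContinuousMap.coe_mk, ContinuousMap.star_apply, fourier_neg,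
        RCLike.star_def, map_mul, Complex.conj_ofReal]
    | zero => simp
    | add F F' _ _ h h' => rw [star_add]; exact add_mem h h'
    | smul a F _ h => rw [star_smul]; exact Submodule.smul_mem _ _ h

lemma cosAlgebra_separatesPoints {L : ℝ} (hL : 0 < L) :
    (cosAlgebra L).SeparatesPoints := by
  rintro ⟨z, y⟩ ⟨z', y'⟩ hne
  by_cases hz : z = z'
  · have hy : (y : ℝ) ≠ y' := fun h => hne (by rw [hz, Subtype.ext h])
    refine ⟨_, ⟨cosMonomial L (0, 1), Submodule.subset_span ⟨_, rfl⟩, rfl⟩, fun h => hy ?_⟩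
    have h' : Real.cos (π / L * y) = Real.cos (π / L * y') := by
      simpa [cosMonomial, -Complex.ofReal_cos] using h
    have hm : ∀ t ∈ Icc 0 L, π / L * t ∈ Icc 0 π := by
      rintro t ⟨h1, h2⟩
      refine ⟨by positivity, ?_⟩
      rw [div_mul_eq_mul_div, div_le_iff₀ hL]
      gcongr
    have := Real.injOn_cos (hm _ y.2) (hm _ y'.2) h'
    exact mul_left_cancel₀ (by positivity) this
  · refine ⟨_, ⟨cosMonomial L (1, 0), Submodule.subset_span ⟨_, rfl⟩, rfl⟩, fun h => hz ?_⟩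
    have h' : (AddCircle.toCircle z : ℂ) = AddCircle.toCircle z' := by
      simpa [cosMonomial, fourier_one] using h
    exact AddCircle.injective_toCircle (by positivity) (Subtype.ext h')

lemma cosAlgebra_dense {L : ℝ} (hL : 0 < L) : (cosAlgebra L).topologicalClosure = ⊤ :=
  ContinuousMap.starSubalgebra_topologicalClosure_eq_top_of_separatesPoints _
    (cosAlgebra_separatesPoints hL)

lemma exists_continuousMap_of_periodic {L : ℝ} {φ : ℝ × ℝ → ℂ} (h : IsPeriodicSmooth φ) :
    ∃ F : C(AddCircle (2 * π) × Icc 0 L, ℂ), ∀ (x : ℝ) (y : Icc 0 L), F (x, y) = φ (x, y) := by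
  have hper : ∀ y : Icc 0 L, Function.Periodic (fun x : ℝ => φ (x, y)) (2 * π) :=
    fun y x => h.periodic (x, y)
  refine ⟨⟨fun z => (hper z.2).lift z.1, ?_⟩, fun x y => (hper y).lift_coe x⟩
  have hq : IsOpenQuotientMap (fun x : ℝ => (x : AddCircle (2 * π))) :=
    QuotientAddGroup.isOpenQuotientMap_mk
  have hq' := hq.prodMap (IsOpenQuotientMap.id (X := Icc 0 L))
  rw [hq'.isQuotientMap.continuous_iff]
  exact h.smooth.continuous.comp (by fun_prop : Continuous fun z : ℝ × Icc 0 L => (z.1, (z.2 : ℝ)))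

/-- The Dirichlet modes are complete in `L²(Ω)`. The sines do not span an algebra with unit, but the
function `u(x) sin (π x₂ / L)` is orthogonal to all `exp (i k x₁) cos (j π x₂ / L)`, which are dense
among the continuous functions by the Stone–Weierstrass theorem; the factor `sin (π x₂ / L)` does
not vanish in the channel. -/
theorem eq_zero_of_integral_sin_eq_zero {L : ℝ} (hL : 0 < L) (u : L2 L)
    (hu : ∀ (k : ℤ) (j : ℕ), ∫ x in channel L,
      u x * separated k (fun y => (Real.sin ((j + 1) * (π / L * y)) : ℂ)) x = 0) : u = 0 := by
  have hpL : 0 < π / L := by positivity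
  let s : ℝ × ℝ → ℂ := fun x => (Real.sin (π / L * x.2) : ℂ)
  have hs : Continuous s := by fun_prop
  have hw := integrable_coeFn_mul u hs
  -- the hypothesis for all integer frequencies, as needed for the frequencies `j ± 1` below
  have hZ : ∀ (k j : ℤ), ∫ x in channel L,
      u x * separated k (fun y => (Real.sin (j * (π / L * y)) : ℂ)) x = 0 := by
    intro k j
    rcases lt_trichotomy j 0 with hj | rfl | hj
    · obtain ⟨n, rfl⟩ : ∃ n : ℕ, j = -(n + 1) := ⟨(-j - 1).toNat, by omega⟩
      rw [← neg_eq_zero, ← integral_neg, ← hu k n]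
      refine integral_congr_ae (Eventually.of_forall fun x => ?_)
      have : ((-((n : ℤ) + 1) : ℤ) : ℝ) * (π / L * x.2) = -((n + 1) * (π / L * x.2)) := by
        push_cast; ring
      simp only [separated, this, Real.sin_neg]
      push_cast
      ring
    · simp [separated]
    · obtain ⟨n, rfl⟩ : ∃ n : ℕ, j = n + 1 := ⟨(j - 1).toNat, by omega⟩
      rw [← hu k n]
      norm_cast
  let q : ℝ × ℝ → AddCircle (2 * π) × Icc 0 L := fun x => (x.1, projIcc 0 L hL.le x.2)
  have hq : Continuous q :=
    ((AddCircle.continuous_mk' _).comp continuous_fst).prodMk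
      (continuous_projIcc.comp continuous_snd)
  have hi : ∀ F : C(AddCircle (2 * π) × Icc 0 L, ℂ),
      Integrable (fun x => u x * s x * F (q x)) (volume.restrict (channel L)) := fun F => by
    simp only [mul_assoc]
    exact integrable_coeFn_mul u (hs.mul (F.continuous.comp hq))
  let Λ : C(AddCircle (2 * π) × Icc 0 L, ℂ) →L[ℂ] ℂ := LinearMap.mkContinuous
    { toFun := fun F => ∫ x in channel L, u x * s x * F (q x)
      map_add' := fun F G => by
        rw [← integral_add (hi F) (hi G)]
        simp only [ContinuousMap.add_apply, mul_add]
      map_smul' := fun a F => by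
        simp only [ContinuousMap.smul_apply, smul_eq_mul, RingHom.id_apply]
        rw [← integral_const_mul]
        congr 1
        funext x
        ring }
    (∫ x in channel L, ‖u x * s x‖) (fun F => by
      simp only [LinearMap.coe_mk, AddHom.coe_mk]
      rw [← integral_mul_const]
      refine norm_integral_le_of_norm_le (hw.norm.mul_const _) (Eventually.of_forall fun x => ?_)
      rw [norm_mul]
      gcongr
      exact F.norm_coe_le_norm _)
  have hΛ : ∀ F, Λ F = ∫ x in channel L, u x * s x * F (q x) := fun F => rfl
  have hmon : ∀ p, Λ (cosMonomial L p) = 0 := by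
    intro p
    have e1 := hZ p.1 (p.2 + 1)
    have e2 := hZ p.1 (p.2 - 1)
    have hc : ∀ j : ℤ, Continuous fun y : ℝ => (Real.sin (j * (π / L * y)) : ℂ) := fun j => by
      fun_prop
    rw [hΛ]
    calc ∫ x in channel L, u x * s x * cosMonomial L p (q x)
        = ∫ x in channel L, ((1 / 2 : ℂ) *
            (u x * separated p.1 (fun y => (Real.sin ((p.2 + 1 : ℤ) * (π / L * y)) : ℂ)) x) -
            (1 / 2 : ℂ) *
            (u x * separated p.1 (fun y => (Real.sin ((p.2 - 1 : ℤ) * (π / L * y)) : ℂ)) x)) := by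
          refine setIntegral_congr_fun (measurableSet_Ioo.prod measurableSet_Ioo) fun x hx => ?_
          have hx2 : projIcc 0 L hL.le x.2 = ⟨x.2, Ioo_subset_Icc_self hx.2⟩ :=
            projIcc_of_mem hL.le _
          have hf : fourier p.1 (x.1 : AddCircle (2 * π)) =
              Complex.exp (Complex.I * p.1 * x.1) := by
            rw [fourier_coe_apply]
            congr 1
            have hp : (π : ℂ) ≠ 0 := by exact_mod_cast pi_ne_zero
            push_cast
            field_simp
          simp only [q, s, hx2, cosMonomial, ContinuousMap.coe_mk, hf, separated, Int.cast_add,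
            Int.cast_sub, Int.cast_one, add_mul, sub_mul, one_mul, Real.sin_add, Real.sin_sub]
          push_cast
          ring
      _ = 0 := by
          rw [integral_sub ((integrable_coeFn_mul u (continuous_separated _ (hc _))).const_mul _)
            ((integrable_coeFn_mul u (continuous_separated _ (hc _))).const_mul _),
            integral_const_mul, integral_const_mul, e1, e2]
          simp
  have hall : ∀ F, Λ F = 0 := by
    intro F
    have hF : F ∈ (cosAlgebra L).topologicalClosure := by rw [cosAlgebra_dense hL]; trivial
    have hcl : IsClosed {F | Λ F = 0} := isClosed_eq Λ.continuous continuous_const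
    refine closure_minimal (fun G hG => ?_) hcl hF
    have : Submodule.span ℂ (range (cosMonomial L)) ≤ LinearMap.ker Λ.toLinearMap :=
      Submodule.span_le.2 (by rintro _ ⟨p, rfl⟩; exact hmon p)
    exact this hG
  have hO : IsOpen (channel L) := isOpen_Ioo.prod isOpen_Ioo
  have key := hO.ae_eq_zero_of_integral_contDiff_smul_eq_zero
    (μ := volume.restrict (channel L)) (f := fun x => u x * s x)
    (hw.locallyIntegrable.locallyIntegrableOn _) ?_
  · refine Lp.eq_zero_iff_ae_eq_zero.2 ?_
    filter_upwards [key, ae_restrict_mem hO.measurableSet] with x hx hx'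
    have hpos : 0 < Real.sin (π / L * x.2) := by
      refine Real.sin_pos_of_pos_of_lt_pi (mul_pos hpL hx'.2.1) ?_
      rw [div_mul_eq_mul_div, div_lt_iff₀ hL]
      exact mul_lt_mul_of_pos_left hx'.2.2 pi_pos
    have hne : s x ≠ 0 := Complex.ofReal_ne_zero.2 hpos.ne'
    simpa [hne] using hx hx'
  · intro g hg hc hsupp
    obtain ⟨φ, hφ, hφg⟩ := exists_isTestFunction hg hc hsupp
    obtain ⟨F, hF⟩ := exists_continuousMap_of_periodic (L := L) hφ.toIsPeriodicSmooth
    rw [← hall F, hΛ]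
    refine setIntegral_congr_fun hO.measurableSet fun x hx => ?_
    have hx2 : projIcc 0 L hL.le x.2 = ⟨x.2, Ioo_subset_Icc_self hx.2⟩ := projIcc_of_mem hL.le _
    simp only [q, hx2, hF, Complex.real_smul, hφg x hx]
    ring

end Completeness

/-! ### The sine and cosine families -/

/-- The frequency `(j + 1) π / L`; the Dirichlet modes are indexed from `0`. -/
def freq (L : ℝ) (j : ℕ) : ℝ := (j + 1) * (π / L)

/-- The sine profile; the factor makes `exp (i k x₁) sin ((j + 1) π x₂ / L)` a unit vector. -/
def sinProfile (L : ℝ) (j : ℕ) (y : ℝ) : ℂ := (((√(π * L))⁻¹ * Real.sin (freq L j * y) : ℝ) : ℂ)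

/-- The cosine profile, with the same normalization; it occurs in the `x₂`-derivatives of the
Dirichlet modes. -/
def cosProfile (L : ℝ) (j : ℕ) (y : ℝ) : ℂ := (((√(π * L))⁻¹ * Real.cos (freq L j * y) : ℝ) : ℂ)

lemma freq_pos {L : ℝ} (hL : 0 < L) (j : ℕ) : 0 < freq L j := by
  unfold freq
  positivity

lemma contDiff_sinProfile (L : ℝ) (j : ℕ) : ContDiff ℝ ∞ (sinProfile L j) :=
  Complex.ofRealCLM.contDiff.comp
    (contDiff_const.mul (Real.contDiff_sin.comp (contDiff_const.mul contDiff_id)))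

lemma contDiff_cosProfile (L : ℝ) (j : ℕ) : ContDiff ℝ ∞ (cosProfile L j) :=
  Complex.ofRealCLM.contDiff.comp
    (contDiff_const.mul (Real.contDiff_cos.comp (contDiff_const.mul contDiff_id)))

lemma hasDerivAt_freq_mul (L : ℝ) (j : ℕ) (y : ℝ) :
    HasDerivAt (fun y => freq L j * y) (freq L j) y := by
  simpa using (hasDerivAt_id y).const_mul (freq L j)

lemma deriv_sinProfile (L : ℝ) (j : ℕ) :
    deriv (sinProfile L j) = fun y => (freq L j : ℂ) * cosProfile L j y := by
  funext y
  have h : HasDerivAt (sinProfile L j) _ y :=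
    (((hasDerivAt_freq_mul L j y).sin).const_mul ((√(π * L))⁻¹)).ofReal_comp
  rw [h.deriv, cosProfile]
  push_cast
  ring

lemma deriv_cosProfile (L : ℝ) (j : ℕ) :
    deriv (cosProfile L j) = fun y => (-freq L j : ℂ) * sinProfile L j y := by
  funext y
  have h : HasDerivAt (cosProfile L j) _ y :=
    (((hasDerivAt_freq_mul L j y).cos).const_mul ((√(π * L))⁻¹)).ofReal_comp
  rw [h.deriv, sinProfile]
  push_cast
  ring

lemma sinProfile_zero (L : ℝ) (j : ℕ) : sinProfile L j 0 = 0 := by simp [sinProfile]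

lemma sinProfile_length {L : ℝ} (hL : 0 < L) (j : ℕ) : sinProfile L j L = 0 := by
  have : freq L j * L = (j + 1 : ℕ) * π := by
    unfold freq
    push_cast
    field_simp
  rw [sinProfile, this, Real.sin_nat_mul_pi]
  simp

lemma integral_cexp_int (n : ℤ) :
    ∫ x in Ioo 0 (2 * π), Complex.exp (Complex.I * n * x) = if n = 0 then (2 * π : ℂ) else 0 := by
  split_ifs with h
  · have : volume.real (Ioo 0 (2 * π)) = 2 * π := by
      rw [Real.volume_real_Ioo_of_le (by positivity)]; ring
    simp [h, this]
  · have hn : (Complex.I * n : ℂ) ≠ 0 := mul_ne_zero Complex.I_ne_zero (by exact_mod_cast h)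
    rw [integral_Ioo_deriv (F := fun x : ℝ => Complex.exp (Complex.I * n * x) / (Complex.I * n))
      (by positivity) (fun y => by
        refine ((hasDerivAt_cexp_mul (Complex.I * n) y).div_const _).congr_deriv ?_
        field_simp) (by fun_prop)]
    have : Complex.exp (Complex.I * n * ((2 * π : ℝ) : ℂ)) = 1 := by
      rw [Complex.exp_eq_one_iff]
      exact ⟨n, by push_cast; ring⟩
    rw [this]
    simp

lemma integral_cos_int {L : ℝ} (hL : 0 < L) (n : ℤ) :
    ∫ y in Ioo 0 L, Real.cos (n * (π / L) * y) = if n = 0 then L else 0 := by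
  split_ifs with h
  · simp [h, hL.le]
  · have hn : (n * (π / L) : ℝ) ≠ 0 :=
      mul_ne_zero (by exact_mod_cast h) (by positivity)
    rw [← integral_Ioc_eq_integral_Ioo, ← intervalIntegral.integral_of_le hL.le,
      intervalIntegral.integral_comp_mul_left (fun y => Real.cos y) hn, integral_cos]
    have : n * (π / L) * L = n * π := by field_simp
    rw [this, Real.sin_int_mul_pi]
    simp

lemma inner_separated {L : ℝ} (k k' : ℤ) {f g : ℝ → ℂ} (hf : Continuous f) (hg : Continuous g) :
    inner ℂ (contL2 L (continuous_separated k hf)) (contL2 L (continuous_separated k' hg)) =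
      if k = k' then 2 * π * ∫ y in Ioo 0 L, g y * (starRingEnd ℂ) (f y) else 0 := by
  rw [inner_contL2, integral_contL2_mul]
  have e : ∀ x, separated k' g x * (starRingEnd ℂ) (separated k f x) =
      Complex.exp (Complex.I * ((k' - k : ℤ) : ℂ) * x.1) * (g x.2 * (starRingEnd ℂ) (f x.2)) := by
    intro x
    have : Complex.exp (Complex.I * ((k' - k : ℤ) : ℂ) * x.1) =
        Complex.exp (Complex.I * k' * x.1) * Complex.exp (-(Complex.I * k * x.1)) := by
      rw [← Complex.exp_add]
      congr 1
      push_cast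
      ring
    rw [this]
    simp only [separated, map_mul, ← Complex.exp_conj, Complex.conj_I, map_intCast,
      Complex.conj_ofReal]
    ring_nf
  simp only [e]
  rw [restrict_channel,
    integral_prod_mul (fun x : ℝ => Complex.exp (Complex.I * ((k' - k : ℤ) : ℂ) * x))
      (fun y => g y * (starRingEnd ℂ) (f y)), integral_cexp_int]
  have : k' - k = 0 ↔ k = k' := by omega
  simp only [this, ite_mul, zero_mul]

/-- The normalized Dirichlet mode `exp (i k x₁) sin ((j + 1) π x₂ / L)`. -/
def sinMode (L : ℝ) (p : ℤ × ℕ) : L2 L :=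
  contL2 L (continuous_separated p.1 (contDiff_sinProfile L p.2).continuous)

/-- The normalized mode `exp (i k x₁) cos ((j + 1) π x₂ / L)`. -/
def cosMode (L : ℝ) (p : ℤ × ℕ) : L2 L :=
  contL2 L (continuous_separated p.1 (contDiff_cosProfile L p.2).continuous)

lemma integral_freq_mul_freq {L : ℝ} (hL : 0 < L) (j l : ℕ) :
    (∫ y in Ioo 0 L, Real.cos (freq L j * y) * Real.cos (freq L l * y)) =
        (if j = l then L / 2 else 0) ∧
      (∫ y in Ioo 0 L, Real.sin (freq L j * y) * Real.sin (freq L l * y)) =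
        if j = l then L / 2 else 0 := by
  have h1 := integral_cos_int hL ((j : ℤ) - l)
  have h2 := integral_cos_int hL ((j : ℤ) + l + 2)
  rw [if_neg (by omega)] at h2
  have hi : ∀ n : ℤ, IntegrableOn (fun y => Real.cos (n * (π / L) * y)) (Ioo 0 L) := fun n =>
    ((by fun_prop : Continuous fun y => Real.cos (n * (π / L) * y)).continuousOn.integrableOn_compact
      isCompact_Icc).mono_set Ioo_subset_Icc_self
  have hj : ((j : ℤ) - l = 0) ↔ j = l := by omega
  simp only [hj] at h1
  have ea : ∀ y, Real.cos ((((j : ℤ) - l : ℤ) : ℝ) * (π / L) * y) =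
      Real.cos (freq L j * y) * Real.cos (freq L l * y) +
        Real.sin (freq L j * y) * Real.sin (freq L l * y) := fun y => by
    rw [← Real.cos_sub]
    congr 1
    unfold freq
    push_cast
    ring
  have eb : ∀ y, Real.cos ((((j : ℤ) + l + 2 : ℤ) : ℝ) * (π / L) * y) =
      Real.cos (freq L j * y) * Real.cos (freq L l * y) -
        Real.sin (freq L j * y) * Real.sin (freq L l * y) := fun y => by
    rw [← Real.cos_add]
    congr 1
    unfold freq
    push_cast
    ring
  constructor
  · calc _ = ∫ y in Ioo 0 L, ((1 / 2) * Real.cos ((((j : ℤ) - l : ℤ) : ℝ) * (π / L) * y) +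
          (1 / 2) * Real.cos ((((j : ℤ) + l + 2 : ℤ) : ℝ) * (π / L) * y)) := by
          congr 1
          funext y
          rw [ea, eb]
          ring
      _ = _ := by
          rw [integral_add ((hi _).const_mul _) ((hi _).const_mul _), integral_const_mul,
            integral_const_mul, h1, h2]
          split_ifs <;> ring
  · calc _ = ∫ y in Ioo 0 L, ((1 / 2) * Real.cos ((((j : ℤ) - l : ℤ) : ℝ) * (π / L) * y) -
          (1 / 2) * Real.cos ((((j : ℤ) + l + 2 : ℤ) : ℝ) * (π / L) * y)) := by
          congr 1
          funext y
          rw [ea, eb]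
          ring
      _ = _ := by
          rw [integral_sub ((hi _).const_mul _) ((hi _).const_mul _), integral_const_mul,
            integral_const_mul, h1, h2]
          split_ifs <;> ring

lemma orthonormal_separated {L : ℝ} (hL : 0 < L) {t : ℕ → ℝ → ℝ}
    (h : ∀ j l, ∫ y in Ioo 0 L, t j y * t l y = if j = l then L / 2 else 0)
    (hc : ∀ j, Continuous fun y => (((√(π * L))⁻¹ * t j y : ℝ) : ℂ)) :
    Orthonormal ℂ fun p : ℤ × ℕ => contL2 L (continuous_separated p.1 (hc p.2)) := by
  rw [orthonormal_iff_ite]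
  rintro ⟨k, j⟩ ⟨k', l⟩
  rw [inner_separated k k' (hc j) (hc l)]
  have e : ∫ y in Ioo 0 L, (((√(π * L))⁻¹ * t l y : ℝ) : ℂ) *
      (starRingEnd ℂ) (((√(π * L))⁻¹ * t j y : ℝ) : ℂ) =
        (((√(π * L))⁻¹ * (√(π * L))⁻¹ * if j = l then L / 2 else 0 : ℝ) : ℂ) := by
    rw [← h j l, ← integral_const_mul, ← integral_complex_ofReal]
    congr 1
    funext y
    rw [Complex.conj_ofReal]
    push_cast
    ring
  have hs : (√(π * L))⁻¹ * (√(π * L))⁻¹ = (π * L)⁻¹ := by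
    rw [← mul_inv, Real.mul_self_sqrt (by positivity)]
  simp only [e, hs, Prod.mk.injEq]
  by_cases hk : k = k' <;> by_cases hjl : j = l <;> simp only [hk, hjl, if_true, if_false,
    true_and, false_and, mul_zero, Complex.ofReal_zero]
  have : (π : ℂ) ≠ 0 := by exact_mod_cast pi_ne_zero
  have : (L : ℂ) ≠ 0 := by exact_mod_cast hL.ne'
  push_cast
  field_simp

lemma orthonormal_sinMode {L : ℝ} (hL : 0 < L) : Orthonormal ℂ (sinMode L) :=
  orthonormal_separated hL (t := fun j y => Real.sin (freq L j * y))
    (fun j l => (integral_freq_mul_freq hL j l).2) fun j => (contDiff_sinProfile L j).continuous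

lemma orthonormal_cosMode {L : ℝ} (hL : 0 < L) : Orthonormal ℂ (cosMode L) :=
  orthonormal_separated hL (t := fun j y => Real.cos (freq L j * y))
    (fun j l => (integral_freq_mul_freq hL j l).1) fun j => (contDiff_cosProfile L j).continuous

lemma eq_zero_of_inner_sinMode_eq_zero {L : ℝ} (hL : 0 < L) {u : L2 L}
    (hu : ∀ p, inner ℂ (sinMode L p) u = 0) : u = 0 := by
  refine eq_zero_of_integral_sin_eq_zero hL u fun k j => ?_
  have h := hu (-k, j)
  rw [sinMode, inner_contL2] at h
  have hs : ((√(π * L))⁻¹ : ℂ) ≠ 0 :=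
    inv_ne_zero (Complex.ofReal_ne_zero.2 (Real.sqrt_pos.2 (by positivity)).ne')
  refine (mul_eq_zero.1 ?_).resolve_left hs
  rw [← h, ← integral_const_mul]
  congr 1
  funext x
  simp only [separated, sinProfile, map_mul, ← Complex.exp_conj, Complex.conj_I, map_intCast,
    Complex.conj_ofReal, freq]
  push_cast
  ring_nf

/-- The Hilbert basis of `L²(Ω)` formed by the normalized Dirichlet modes. -/
def sinBasis {L : ℝ} (hL : 0 < L) : HilbertBasis (ℤ × ℕ) ℂ (L2 L) :=
  HilbertBasis.mkOfOrthogonalEqBot (orthonormal_sinMode hL) (by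
    rw [Submodule.eq_bot_iff]
    intro u hu
    refine eq_zero_of_inner_sinMode_eq_zero hL fun p => ?_
    exact (Submodule.mem_orthogonal _ _).1 hu _ (Submodule.subset_span ⟨p, rfl⟩))

lemma sinBasis_apply {L : ℝ} (hL : 0 < L) (p : ℤ × ℕ) : sinBasis hL p = sinMode L p := by
  simp [sinBasis]

/-- A function all of whose Fourier modes vanish is zero. -/
lemma eq_zero_of_fourierMode {L : ℝ} (hL : 0 < L) {u : L2 L}
    (hu : ∀ k, ∀ᵐ y ∂volume.restrict (Ioo 0 L), fourierMode u k y = 0) : u = 0 := by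
  refine eq_zero_of_inner_sinMode_eq_zero hL fun p => ?_
  rw [sinMode, inner_contL2_separated u p.1 (contDiff_sinProfile L p.2).continuous,
    integral_eq_zero_of_ae, mul_zero]
  filter_upwards [hu p.1] with y hy
  simp [hy]

/-! ### Diagonal operators -/

section Diagonal

variable {ι E : Type*} [NormedAddCommGroup E] [InnerProductSpace ℂ E]

lemma hilbertBasis_ext (b : HilbertBasis ι ℂ E) {x y : E}
    (h : ∀ i, inner ℂ (b i) x = inner ℂ (b i) y) : x = y := by
  apply b.repr.injective
  ext i
  rw [b.repr_apply_apply, b.repr_apply_apply, h]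

lemma exists_diagonal (b : HilbertBasis ι ℂ E) {d : ι → ℂ} {C : ℝ} (hC : 0 ≤ C)
    (hd : ∀ i, ‖d i‖ ≤ C) :
    ∃ K : E →L[ℂ] E, (∀ i x, inner ℂ (b i) (K x) = d i * inner ℂ (b i) x) ∧ ‖K‖ ≤ C := by
  have hp : (0 : ℝ) < (2 : ENNReal).toReal := by norm_num
  have hle : ∀ (x : E) (i : ι), ‖d i * b.repr x i‖ ^ (2 : ENNReal).toReal ≤
      C ^ (2 : ENNReal).toReal * ‖b.repr x i‖ ^ (2 : ENNReal).toReal := by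
    intro x i
    rw [norm_mul, Real.mul_rpow (norm_nonneg _) (norm_nonneg _)]
    gcongr
    exact hd i
  have hmem : ∀ x : E, Memℓp (fun i => d i * b.repr x i) 2 := by
    intro x
    rw [memℓp_gen_iff hp]
    exact Summable.of_nonneg_of_le (fun i => by positivity) (hle x)
      (((memℓp_gen_iff hp).1 (lp.memℓp (b.repr x))).mul_left _)
  let K₀ : E →ₗ[ℂ] E :=
    { toFun := fun x => b.repr.symm ⟨fun i => d i * b.repr x i, hmem x⟩
      map_add' := fun x y => by
        rw [← map_add]
        congr 1
        ext i
        change d i * b.repr (x + y) i = d i * b.repr x i + d i * b.repr y i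
        rw [map_add]
        exact mul_add _ _ _
      map_smul' := fun a x => by
        rw [RingHom.id_apply, ← map_smul]
        congr 1
        ext i
        simp [mul_left_comm] }
  have hK₀ : ∀ x, K₀ x = b.repr.symm ⟨fun i => d i * b.repr x i, hmem x⟩ := fun x => rfl
  have hbound : ∀ x, ‖K₀ x‖ ≤ C * ‖x‖ := by
    intro x
    rw [hK₀, LinearIsometryEquiv.norm_map]
    refine lp.norm_le_of_forall_sum_le hp (by positivity) fun s => ?_
    calc _ ≤ ∑ i ∈ s, C ^ (2 : ENNReal).toReal * ‖b.repr x i‖ ^ (2 : ENNReal).toReal :=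
          Finset.sum_le_sum fun i _ => hle x i
      _ ≤ C ^ (2 : ENNReal).toReal * ‖b.repr x‖ ^ (2 : ENNReal).toReal := by
          rw [← Finset.mul_sum]
          gcongr
          exact lp.sum_rpow_le_norm_rpow hp _ s
      _ = _ := by
          rw [LinearIsometryEquiv.norm_map, Real.mul_rpow hC (norm_nonneg _)]
  refine ⟨K₀.mkContinuous C hbound, fun i x => ?_, K₀.mkContinuous_norm_le hC hbound⟩
  rw [LinearMap.mkContinuous_apply, hK₀, ← b.repr_apply_apply, ← b.repr_apply_apply]
  simp

lemma isCompactOperator_inner_smul (x y : E) :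
    IsCompactOperator fun z : E => inner ℂ x z • y := by
  have h : IsCompactOperator (innerSL ℂ x) := isCompactOperator_of_locallyCompactSpace_dom _
  exact h.clm_comp (ContinuousLinearMap.toSpanSingleton ℂ y)

/-- A diagonal operator whose entries tend to zero is compact, as the limit of its finite
truncations. -/
lemma exists_compact_diagonal [CompleteSpace E] (b : HilbertBasis ι ℂ E) {d : ι → ℂ}
    (hd : Tendsto d cofinite (𝓝 0)) :
    ∃ K : E →L[ℂ] E, (∀ i x, inner ℂ (b i) (K x) = d i * inner ℂ (b i) x) ∧
      IsCompactOperator K := by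
  classical
  have hfin : ∀ ε > 0, {i | ε ≤ ‖d i‖}.Finite := by
    intro ε hε
    have := (tendsto_zero_iff_norm_tendsto_zero.1 hd).eventually (gt_mem_nhds hε)
    simpa [Filter.Eventually, mem_cofinite, compl_ofPred] using this
  have hsum : ∀ (s : Finset ι) (x : E) (i : ι),
      inner ℂ (b i) (∑ j ∈ s, (d j * inner ℂ (b j) x) • b j) =
        if i ∈ s then d i * inner ℂ (b i) x else 0 := by
    intro s x i
    simp [orthonormal_iff_ite.1 b.orthonormal]
  have hbdd : ∃ C, 0 ≤ C ∧ ∀ i, ‖d i‖ ≤ C := by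
    refine ⟨1 + ∑ i ∈ (hfin 1 one_pos).toFinset, ‖d i‖, by positivity, fun i => ?_⟩
    by_cases hi : 1 ≤ ‖d i‖
    · have := Finset.single_le_sum (f := fun i => ‖d i‖) (fun j _ => norm_nonneg (d j))
        ((hfin 1 one_pos).mem_toFinset.2 hi)
      linarith
    · have := Finset.sum_nonneg (s := (hfin 1 one_pos).toFinset) fun j _ => norm_nonneg (d j)
      linarith
  obtain ⟨C, hC, hdC⟩ := hbdd
  obtain ⟨K, hK, -⟩ := exists_diagonal b hC hdC
  refine ⟨K, hK, ?_⟩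
  have hcl := isClosed_setOfPred_isCompactOperator (𝕜₁ := ℂ) (𝕜₂ := ℂ) (σ₁₂ := RingHom.id ℂ)
    (M₁ := E) (M₂ := E)
  change K ∈ {f : E →L[ℂ] E | IsCompactOperator f}
  refine hcl.closure_subset (Metric.mem_closure_iff.2 fun ε hε => ?_)
  let s := (hfin (ε / 2) (by positivity)).toFinset
  obtain ⟨R, hR, hRn⟩ := exists_diagonal b (d := fun i => if i ∈ s then 0 else d i)
    (by positivity : 0 ≤ ε / 2) (fun i => by
      by_cases hi : i ∈ s
      · simp only [hi, if_true, norm_zero]; positivity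
      · simp only [hi, if_false]
        have : ¬ ε / 2 ≤ ‖d i‖ := fun h => hi ((Set.Finite.mem_toFinset _).2 h)
        exact (not_le.1 this).le)
  refine ⟨K - R, ?_, ?_⟩
  · have hKR : ⇑(K - R) = ⇑(∑ j ∈ s, (innerSL ℂ (b j)).smulRight (d j • b j)) := by
      funext x
      refine hilbertBasis_ext b fun i => ?_
      have e : (∑ j ∈ s, (innerSL ℂ (b j)).smulRight (d j • b j)) x =
          ∑ j ∈ s, (d j * inner ℂ (b j) x) • b j := by
        rw [sum_apply]
        refine Finset.sum_congr rfl fun j _ => ?_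
        simp [smul_smul, mul_comm]
      rw [e, hsum, sub_apply, inner_sub_right, hK, hR]
      split_ifs <;> simp
    change IsCompactOperator ⇑(K - R)
    rw [hKR]
    exact (compactOperator (RingHom.id ℂ) E E).sum_mem fun j _ =>
      isCompactOperator_inner_smul (b j) (d j • b j)
  · rw [dist_eq_norm, sub_sub_cancel]
    linarith

lemma diagonal_symm (b : HilbertBasis ι ℂ E) {d : ι → ℝ} {K : E →L[ℂ] E}
    (hK : ∀ i x, inner ℂ (b i) (K x) = d i * inner ℂ (b i) x) (x y : E) :
    inner ℂ (K x) y = inner ℂ x (K y) := by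
  rw [← b.tsum_inner_mul_inner, ← b.tsum_inner_mul_inner]
  congr 1
  funext i
  rw [hK, ← inner_conj_symm (K x), hK, map_mul, inner_conj_symm, Complex.conj_ofReal]
  ring

/-- A series in an orthonormal family converges if its coefficients are dominated by the Fourier
coefficients of a vector in another space. -/
lemma exists_hasSum_of_norm_le [CompleteSpace E] {F : Type*} [NormedAddCommGroup F]
    [InnerProductSpace ℂ F] (b : HilbertBasis ι ℂ F) {v : ι → E} (hv : Orthonormal ℂ v)
    {a : ι → ℂ} {g : F} (ha : ∀ i, ‖a i‖ ≤ ‖inner ℂ (b i) g‖) :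
    ∃ w, HasSum (fun i => a i • v i) w := by
  have h1 : Summable fun i => ‖inner ℂ (b i) g‖ ^ 2 := by
    have := (b.summable_inner_mul_inner g g).norm
    refine this.congr fun i => ?_
    rw [norm_mul, ← norm_inner_symm g (b i), sq]
  have h2 : Summable fun i => ‖a i‖ ^ 2 :=
    h1.of_nonneg_of_le (fun i => by positivity) fun i => by gcongr; exact ha i
  have h3 := (hv.orthogonalFamily.summable_iff_norm_sq_summable a).2 h2
  exact ⟨_, h3.hasSum⟩

end Diagonal

/-! ### Weak derivatives of series -/

lemma contL2_congr {L : ℝ} {φ ψ : ℝ × ℝ → ℂ} {hφ : Continuous φ} {hψ : Continuous ψ}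
    (h : φ = ψ) : contL2 L hφ = contL2 L hψ := by
  subst h
  rfl

lemma contL2_smul {L : ℝ} {φ : ℝ × ℝ → ℂ} (hφ : Continuous φ) (c : ℂ) :
    contL2 L (φ := fun x => c * φ x) (continuous_const.mul hφ) = c • contL2 L hφ :=
  rfl

/-- The class of `exp (i k x₁) f(x₂)` in `L²(Ω)`. -/
def sepL2 (L : ℝ) (k : ℤ) {f : ℝ → ℂ} (hf : ContDiff ℝ ∞ f) : L2 L :=
  contL2 L (continuous_separated k hf.continuous)

lemma sepL2_congr {L : ℝ} {k : ℤ} {f g : ℝ → ℂ} {hf : ContDiff ℝ ∞ f} {hg : ContDiff ℝ ∞ g}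
    (h : f = g) : sepL2 L k hf = sepL2 L k hg := by
  subst h
  rfl

lemma sepL2_smul {L : ℝ} {k : ℤ} {f : ℝ → ℂ} (hf : ContDiff ℝ ∞ f) (c : ℂ) :
    sepL2 L k (f := fun y => c * f y) (contDiff_const.mul hf) = c • sepL2 L k hf := by
  unfold sepL2
  rw [← contL2_smul]
  refine contL2_congr ?_
  funext x
  simp only [separated]
  ring

lemma sepL2_add {L : ℝ} {k : ℤ} {f g : ℝ → ℂ} (hf : ContDiff ℝ ∞ f) (hg : ContDiff ℝ ∞ g) :
    sepL2 L k (f := fun y => f y + g y) (hf.add hg) = sepL2 L k hf + sepL2 L k hg := by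
  have : sepL2 L k hf + sepL2 L k hg = contL2 L
    (φ := fun x => separated k f x + separated k g x)
    ((continuous_separated k hf.continuous).add (continuous_separated k hg.continuous)) := rfl
  rw [this]
  refine contL2_congr ?_
  funext x
  simp only [separated]
  ring

lemma HasWeakDeriv.smul {L : ℝ} {i : Fin 2} {u v : L2 L} (h : HasWeakDeriv L i u v) (a : ℂ) :
    HasWeakDeriv L i (a • u) (a • v) := by
  simpa using h.lin h a 0

lemma hasWeakDeriv_zero_sepL2 {L : ℝ} (hL : 0 < L) (k : ℤ) {f : ℝ → ℂ} (hf : ContDiff ℝ ∞ f) :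
    HasWeakDeriv L 0 (sepL2 L k hf) ((Complex.I * k) • sepL2 L k hf) := by
  have h := hasWeakDeriv_contL2 hL (isPeriodicSmooth_separated k hf) 0
  rw [contL2_congr (partialDeriv_zero_separated k hf) (hψ := continuous_separated k
    (continuous_const.mul hf.continuous))] at h
  rw [← sepL2_smul]
  exact h

lemma hasWeakDeriv_one_sepL2 {L : ℝ} (hL : 0 < L) (k : ℤ) {f : ℝ → ℂ} (hf : ContDiff ℝ ∞ f) :
    HasWeakDeriv L 1 (sepL2 L k hf) (sepL2 L k (contDiff_deriv hf)) := by
  have h := hasWeakDeriv_contL2 hL (isPeriodicSmooth_separated k hf) 1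
  rw [contL2_congr (partialDeriv_one_separated k hf) (hψ := continuous_separated k
    (contDiff_deriv hf).continuous)] at h
  exact h

lemma hasZeroTrace_sepL2 {L : ℝ} (hL : 0 < L) (k : ℤ) {f : ℝ → ℂ} (hf : ContDiff ℝ ∞ f)
    (h0 : f 0 = 0) (h1 : f L = 0) : HasZeroTrace L (sepL2 L k hf) :=
  hasZeroTrace_contL2 hL (isPeriodicSmooth_separated k hf) (fun x => by simp [separated, h0])
    fun x => by simp [separated, h1]

lemma hasH2Laplacian_sepL2 {L : ℝ} (hL : 0 < L) (k : ℤ) {f g : ℝ → ℂ} (hf : ContDiff ℝ ∞ f)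
    (hg : ContDiff ℝ ∞ g) (h : ∀ y, g y = deriv (deriv f) y - k ^ 2 * f y) :
    HasH2Laplacian L (sepL2 L k hf) (sepL2 L k hg) := by
  have hf' := contDiff_deriv hf
  refine ⟨![(Complex.I * k) • sepL2 L k hf, sepL2 L k hf'],
    ![![(Complex.I * k) • (Complex.I * k) • sepL2 L k hf, (Complex.I * k) • sepL2 L k hf'],
      ![(Complex.I * k) • sepL2 L k hf', sepL2 L k (contDiff_deriv hf')]], ?_, ?_, ?_⟩
  · intro i
    fin_cases i
    · exact hasWeakDeriv_zero_sepL2 hL k hf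
    · exact hasWeakDeriv_one_sepL2 hL k hf
  · intro i j
    have e0 := hasWeakDeriv_zero_sepL2 hL k hf
    have e1 := hasWeakDeriv_one_sepL2 hL k hf
    fin_cases i <;> fin_cases j
    · exact e0.smul _
    · exact e1.smul _
    · exact hasWeakDeriv_zero_sepL2 hL k hf'
    · exact hasWeakDeriv_one_sepL2 hL k hf'
  · simp only [Matrix.cons_val_zero, Matrix.cons_val_one]
    rw [smul_smul, ← sepL2_smul, ← sepL2_add]
    refine sepL2_congr ?_
    funext y
    rw [h]
    linear_combination (-(k : ℂ) ^ 2 * f y) * Complex.I_sq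

lemma hasSum_integral_mul {L : ℝ} {ι : Type*} {f : ι → L2 L} {u : L2 L} (h : HasSum f u)
    {g : ℝ × ℝ → ℂ} (hg : Continuous g) :
    HasSum (fun i => ∫ x in channel L, f i x * g x) (∫ x in channel L, u x * g x) := by
  simp only [integral_mul_eq_inner hg]
  exact h.mapL (innerSL ℂ _)

lemma hasWeakDeriv_of_hasSum {L : ℝ} {ι : Type*} {i : Fin 2} {f g : ι → L2 L} {u v : L2 L}
    (hf : HasSum f u) (hg : HasSum g v) (h : ∀ n, HasWeakDeriv L i (f n) (g n)) :
    HasWeakDeriv L i u v := by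
  intro φ hφ
  have h1 := hasSum_integral_mul hf (hφ.continuous_partialDeriv i)
  have h2 := (hasSum_integral_mul hg hφ.smooth.continuous).neg
  simp only [h _ φ hφ] at h1
  exact h1.unique h2

/-- The vanishing trace is preserved under limits for which the `x₂`-derivatives converge as well.
-/
lemma hasZeroTrace_of_hasSum {L : ℝ} (hL : 0 < L) {ι : Type*} {k : ι → ℤ} {f : ι → ℝ → ℂ}
    (hf : ∀ i, ContDiff ℝ ∞ (f i)) (h0 : ∀ i, f i 0 = 0) (h1 : ∀ i, f i L = 0) {a : ι → ℂ}
    {u v : L2 L} (hu : HasSum (fun i => a i • sepL2 L (k i) (hf i)) u)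
    (hv : HasSum (fun i => a i • sepL2 L (k i) (contDiff_deriv (hf i))) v) :
    HasZeroTrace L u := by
  refine ⟨v, hasWeakDeriv_of_hasSum hu hv fun i => ?_, fun φ hφ => ?_⟩
  · have e := hasWeakDeriv_one_sepL2 hL (k i) (hf i)
    exact e.smul (a i)
  · have s1 := hasSum_integral_mul hu (hφ.continuous_partialDeriv 1)
    have s2 := hasSum_integral_mul hv hφ.smooth.continuous
    refine (s1.add s2).unique ?_
    convert hasSum_zero using 1
    funext i
    obtain ⟨w, hw, hw'⟩ := hasZeroTrace_sepL2 hL (k i) (hf i) (h0 i) (h1 i)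
    obtain rfl := hw.unique (hasWeakDeriv_one_sepL2 hL (k i) (hf i))
    have e := hw' φ hφ
    have c := hφ.continuous_partialDeriv 1
    have c' := hφ.smooth.continuous
    rw [integral_mul_eq_inner c, integral_mul_eq_inner c'] at *
    simp only [inner_smul_right]
    linear_combination a i * e

/-! ### The inverse of the Dirichlet Laplacian and its square root -/

/-- The symbol `k² + ((j + 1) π / L)²` of the negative Dirichlet Laplacian. -/
def symbol (L : ℝ) (p : ℤ × ℕ) : ℝ := (p.1 : ℝ) ^ 2 + freq L p.2 ^ 2

lemma symbol_pos {L : ℝ} (hL : 0 < L) (p : ℤ × ℕ) : 0 < symbol L p := by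
  have := freq_pos hL p.2
  unfold symbol
  positivity

lemma finite_symbol_le {L : ℝ} (hL : 0 < L) (R : ℝ) : {p | symbol L p ≤ R}.Finite := by
  obtain ⟨N, hN⟩ := exists_nat_ge (|R| + 1)
  obtain ⟨M, hM⟩ := exists_nat_ge ((|R| + 1) / (π / L))
  refine ((Set.finite_Icc (-(N : ℤ)) N).prod (Set.finite_Iic M)).subset ?_
  rintro ⟨k, j⟩ h
  have hpL : 0 < π / L := by positivity
  simp only [mem_ofPred_eq, symbol] at h
  have hR := le_abs_self R
  have h0 := abs_nonneg R
  have hf := freq_pos hL j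
  have hk : |(k : ℝ)| ≤ N := by
    refine (abs_le_of_sq_le_sq (b := |R| + 1) ?_ (by positivity)).trans hN
    nlinarith [sq_nonneg (freq L j)]
  have hj : freq L j ≤ |R| + 1 := by
    refine (le_abs_self _).trans (abs_le_of_sq_le_sq (b := |R| + 1) ?_ (by positivity))
    nlinarith [sq_nonneg (k : ℝ)]
  have hj' : (j : ℝ) ≤ M := by
    refine le_trans ?_ hM
    rw [le_div_iff₀ hpL]
    unfold freq at hj
    linarith
  refine ⟨⟨?_, ?_⟩, ?_⟩
  · have := (abs_le.1 hk).1
    exact_mod_cast this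
  · have := (abs_le.1 hk).2
    exact_mod_cast this
  · exact_mod_cast hj'

lemma exists_dirichletRoot {L : ℝ} (hL : 0 < L) : ∃ K : L2 L →L[ℂ] L2 L,
    (∀ p x, inner ℂ (sinBasis hL p) (K x) =
      ((√(symbol L p))⁻¹ : ℝ) * inner ℂ (sinBasis hL p) x) ∧ IsCompactOperator K := by
  refine exists_compact_diagonal (sinBasis hL) ?_
  rw [tendsto_zero_iff_norm_tendsto_zero]
  have h1 : Tendsto (symbol L) cofinite atTop := by
    rw [tendsto_atTop]
    intro R
    have := finite_symbol_le hL R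
    refine (this.subset fun p hp => ?_ : {p | R ≤ symbol L p}ᶜ.Finite)
    exact (not_le.1 (show ¬ R ≤ symbol L p from hp)).le
  have h2 := tendsto_inv_atTop_zero.comp (Real.tendsto_sqrt_atTop.comp h1)
  refine h2.congr fun p => ?_
  rw [Complex.norm_real, Real.norm_of_nonneg (by positivity)]
  rfl

/-- The operator `(-Δ)^{-1/2}` for the Dirichlet Laplacian. -/
def dirichletRoot {L : ℝ} (hL : 0 < L) : L2 L →L[ℂ] L2 L := (exists_dirichletRoot hL).choose

lemma inner_dirichletRoot {L : ℝ} (hL : 0 < L) (p : ℤ × ℕ) (x : L2 L) :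
    inner ℂ (sinMode L p) (dirichletRoot hL x) =
      ((√(symbol L p))⁻¹ : ℝ) * inner ℂ (sinMode L p) x := by
  rw [← sinBasis_apply hL]
  exact (exists_dirichletRoot hL).choose_spec.1 p x

lemma isCompactOperator_dirichletRoot {L : ℝ} (hL : 0 < L) :
    IsCompactOperator (dirichletRoot hL) :=
  (exists_dirichletRoot hL).choose_spec.2

lemma dirichletRoot_symm {L : ℝ} (hL : 0 < L) (x y : L2 L) :
    inner ℂ (dirichletRoot hL x) y = inner ℂ x (dirichletRoot hL y) :=
  diagonal_symm (sinBasis hL) (exists_dirichletRoot hL).choose_spec.1 x y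

lemma inner_dirichletRoot_twice {L : ℝ} (hL : 0 < L) (p : ℤ × ℕ) (x : L2 L) :
    inner ℂ (sinMode L p) (dirichletRoot hL (dirichletRoot hL x)) =
      ((symbol L p)⁻¹ : ℝ) * inner ℂ (sinMode L p) x := by
  rw [inner_dirichletRoot, inner_dirichletRoot, ← mul_assoc, ← Complex.ofReal_mul, ← mul_inv,
    Real.mul_self_sqrt (symbol_pos hL p).le]

lemma eq_of_inner_sinMode {L : ℝ} (hL : 0 < L) {x y : L2 L}
    (h : ∀ p, inner ℂ (sinMode L p) x = inner ℂ (sinMode L p) y) : x = y :=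
  hilbertBasis_ext (sinBasis hL) fun p => by simpa only [sinBasis_apply] using h p

lemma dirichletRoot_injective {L : ℝ} (hL : 0 < L) {x : L2 L} (h : dirichletRoot hL x = 0) :
    x = 0 := by
  refine eq_of_inner_sinMode hL fun p => ?_
  have e := inner_dirichletRoot hL p x
  rw [h, inner_zero_right] at e
  have hne : (((√(symbol L p))⁻¹ : ℝ) : ℂ) ≠ 0 :=
    Complex.ofReal_ne_zero.2 (inv_ne_zero (Real.sqrt_pos.2 (symbol_pos hL p)).ne')
  rw [inner_zero_right]
  exact (mul_eq_zero.1 e.symm).resolve_left hne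

lemma hasSum_sinMode {L : ℝ} (hL : 0 < L) (u : L2 L) :
    HasSum (fun p => inner ℂ (sinMode L p) u • sinMode L p) u := by
  have := (sinBasis hL).hasSum_repr u
  simpa only [(sinBasis hL).repr_apply_apply, sinBasis_apply] using this

lemma sinMode_eq (L : ℝ) (p : ℤ × ℕ) :
    sinMode L p = sepL2 L p.1 (contDiff_sinProfile L p.2) := rfl

lemma cosMode_eq (L : ℝ) (p : ℤ × ℕ) :
    cosMode L p = sepL2 L p.1 (contDiff_cosProfile L p.2) := rfl

lemma sepL2_deriv_sinProfile (L : ℝ) (p : ℤ × ℕ) :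
    sepL2 L p.1 (contDiff_deriv (contDiff_sinProfile L p.2)) = (freq L p.2 : ℂ) • cosMode L p := by
  rw [cosMode_eq, ← sepL2_smul (contDiff_cosProfile L p.2)]
  exact sepL2_congr (deriv_sinProfile L p.2)

lemma sepL2_deriv_cosProfile (L : ℝ) (p : ℤ × ℕ) :
    sepL2 L p.1 (contDiff_deriv (contDiff_cosProfile L p.2)) =
      (-freq L p.2 : ℂ) • sinMode L p := by
  rw [sinMode_eq, ← sepL2_smul (contDiff_sinProfile L p.2)]
  exact sepL2_congr (deriv_cosProfile L p.2)

lemma exists_hasSum_sinMode {L : ℝ} (hL : 0 < L) {a : ℤ × ℕ → ℂ} {g : L2 L}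
    (ha : ∀ p, ‖a p‖ ≤ ‖inner ℂ (sinMode L p) g‖) :
    (∃ w, HasSum (fun p => a p • sinMode L p) w) ∧ ∃ w, HasSum (fun p => a p • cosMode L p) w := by
  have ha' : ∀ p, ‖a p‖ ≤ ‖inner ℂ (sinBasis hL p) g‖ := by simpa only [sinBasis_apply] using ha
  exact ⟨exists_hasSum_of_norm_le (sinBasis hL) (orthonormal_sinMode hL) ha',
    exists_hasSum_of_norm_le (sinBasis hL) (orthonormal_cosMode hL) ha'⟩

lemma freq_mul_le {L : ℝ} (hL : 0 < L) (p : ℤ × ℕ) : freq L p.2 * (√(symbol L p))⁻¹ ≤ 1 := by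
  rw [← div_eq_mul_inv, div_le_one (Real.sqrt_pos.2 (symbol_pos hL p))]
  refine Real.le_sqrt_of_sq_le ?_
  unfold symbol
  nlinarith [sq_nonneg (p.1 : ℝ)]

lemma abs_mul_le {L : ℝ} (hL : 0 < L) (p : ℤ × ℕ) : |(p.1 : ℝ)| * (√(symbol L p))⁻¹ ≤ 1 := by
  rw [← div_eq_mul_inv, div_le_one (Real.sqrt_pos.2 (symbol_pos hL p))]
  refine Real.le_sqrt_of_sq_le ?_
  rw [sq_abs]
  unfold symbol
  nlinarith [sq_nonneg (freq L p.2)]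

/-- The range of `(-Δ)^{-1/2}` consists of functions of vanishing trace: the differentiated sine
series converges since the frequency is at most the square root of the symbol. -/
lemma hasZeroTrace_dirichletRoot {L : ℝ} (hL : 0 < L) (g : L2 L) :
    HasZeroTrace L (dirichletRoot hL g) := by
  have hu := hasSum_sinMode hL (dirichletRoot hL g)
  obtain ⟨-, v, hv⟩ := exists_hasSum_sinMode hL (g := g)
    (a := fun p => inner ℂ (sinMode L p) (dirichletRoot hL g) * freq L p.2) (fun p => by
      rw [inner_dirichletRoot, norm_mul, norm_mul, Complex.norm_real, Complex.norm_real,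
        Real.norm_of_nonneg (by positivity), Real.norm_of_nonneg (freq_pos hL _).le]
      have := freq_mul_le hL p
      have := norm_nonneg (inner ℂ (sinMode L p) g)
      nlinarith)
  refine hasZeroTrace_of_hasSum hL (k := fun p : ℤ × ℕ => p.1)
    (fun p => contDiff_sinProfile L p.2) (fun p => sinProfile_zero L p.2)
    (fun p => sinProfile_length hL p.2) hu (v := v) ?_
  simpa only [sepL2_deriv_sinProfile, smul_smul] using hv

/-- The function `-(-Δ)^{-1} w` is in `H²(Ω)` and its Laplacian is `w`: the sine series may be
differentiated twice, since products of two frequencies are bounded by the symbol. -/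
lemma hasH2Laplacian_dirichletRoot {L : ℝ} (hL : 0 < L) (w : L2 L) :
    HasH2Laplacian L (-dirichletRoot hL (dirichletRoot hL w)) w := by
  -- the coefficients `s` and the square root `z` of the inverse symbol
  set s : ℤ × ℕ → ℂ := fun p => inner ℂ (sinMode L p) (dirichletRoot hL (dirichletRoot hL w))
    with hs
  set z : ℤ × ℕ → ℝ := fun p => (√(symbol L p))⁻¹ with hz
  have hz0 : ∀ p, 0 ≤ z p := fun p => by positivity
  have hu := hasSum_sinMode hL (dirichletRoot hL (dirichletRoot hL w))
  have s1 : ∀ p, ‖s p‖ = z p * ‖inner ℂ (sinMode L p) (dirichletRoot hL w)‖ := fun p => by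
    rw [hs]
    simp only
    rw [inner_dirichletRoot, norm_mul, Complex.norm_real, Real.norm_of_nonneg (hz0 p)]
  have s2 : ∀ p, ‖s p‖ = z p * z p * ‖inner ℂ (sinMode L p) w‖ := fun p => by
    rw [s1, inner_dirichletRoot, norm_mul, Complex.norm_real, Real.norm_of_nonneg (hz0 p), mul_assoc]
  have nf : ∀ p : ℤ × ℕ, ‖(freq L p.2 : ℂ)‖ = freq L p.2 := fun p => by
    rw [Complex.norm_real, Real.norm_of_nonneg (freq_pos hL _).le]
  have nk : ∀ p : ℤ × ℕ, ‖Complex.I * (p.1 : ℂ)‖ = |(p.1 : ℝ)| := fun p => by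
    rw [norm_mul, Complex.norm_I, one_mul, Complex.norm_intCast]
  have bf := freq_mul_le hL
  have bk := abs_mul_le hL
  have f0 : ∀ p : ℤ × ℕ, 0 ≤ freq L p.2 := fun p => (freq_pos hL _).le
  have two : ∀ a b c t : ℝ, 0 ≤ a → 0 ≤ b → 0 ≤ t → 0 ≤ c → a * c ≤ 1 → b * c ≤ 1 →
      c * c * t * a * b ≤ t := by
    intro a b c t ha hb ht hc h1 h2
    have h3 : a * c * (b * c) ≤ 1 := mul_le_one₀ h1 (by positivity) h2
    calc c * c * t * a * b = a * c * (b * c) * t := by ring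
      _ ≤ 1 * t := by gcongr
      _ = t := one_mul t
  have one' : ∀ a c t : ℝ, 0 ≤ t → a * c ≤ 1 → c * t * a ≤ t := by
    intro a c t ht h1
    calc c * t * a = a * c * t := by ring
      _ ≤ 1 * t := by gcongr
      _ = t := one_mul t
  obtain ⟨⟨d0, hd0⟩, -⟩ := exists_hasSum_sinMode hL (g := dirichletRoot hL w)
    (a := fun p => s p * (Complex.I * p.1)) fun p => by
      rw [norm_mul, nk, s1]
      exact one' _ _ _ (norm_nonneg _) (bk p)
  obtain ⟨-, d1, hd1⟩ := exists_hasSum_sinMode hL (g := dirichletRoot hL w)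
    (a := fun p => s p * freq L p.2) fun p => by
      rw [norm_mul, nf, s1]
      exact one' _ _ _ (norm_nonneg _) (bf p)
  obtain ⟨⟨d00, hd00⟩, -⟩ := exists_hasSum_sinMode hL (g := w)
    (a := fun p => s p * (Complex.I * p.1) * (Complex.I * p.1)) fun p => by
      rw [norm_mul, norm_mul, nk, s2]
      exact two _ _ _ _ (abs_nonneg _) (abs_nonneg _) (norm_nonneg _) (hz0 p) (bk p) (bk p)
  obtain ⟨-, d01, hd01⟩ := exists_hasSum_sinMode hL (g := w)
    (a := fun p => s p * (Complex.I * p.1) * freq L p.2) fun p => by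
      rw [norm_mul, norm_mul, nk, nf, s2]
      exact two _ _ _ _ (abs_nonneg _) (f0 p) (norm_nonneg _) (hz0 p) (bk p) (bf p)
  obtain ⟨⟨d11, hd11⟩, -⟩ := exists_hasSum_sinMode hL (g := w)
    (a := fun p => s p * freq L p.2 * (-freq L p.2)) fun p => by
      rw [norm_mul, norm_mul, norm_neg, nf, s2]
      exact two _ _ _ _ (f0 p) (f0 p) (norm_nonneg _) (hz0 p) (bf p) (bf p)
  have sx : ∀ (p : ℤ × ℕ) (c : ℂ), HasWeakDeriv L 0 (c • sinMode L p)
      ((c * (Complex.I * p.1)) • sinMode L p) := fun p c => by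
    have e := hasWeakDeriv_zero_sepL2 hL p.1 (contDiff_sinProfile L p.2)
    simpa only [smul_smul, sinMode_eq, cosMode_eq] using e.smul c
  have cx : ∀ (p : ℤ × ℕ) (c : ℂ), HasWeakDeriv L 0 (c • cosMode L p)
      ((c * (Complex.I * p.1)) • cosMode L p) := fun p c => by
    have e := hasWeakDeriv_zero_sepL2 hL p.1 (contDiff_cosProfile L p.2)
    simpa only [smul_smul, sinMode_eq, cosMode_eq] using e.smul c
  have sy : ∀ (p : ℤ × ℕ) (c : ℂ), HasWeakDeriv L 1 (c • sinMode L p)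
      ((c * freq L p.2) • cosMode L p) := fun p c => by
    have e := hasWeakDeriv_one_sepL2 hL p.1 (contDiff_sinProfile L p.2)
    rw [sepL2_deriv_sinProfile] at e
    simpa only [smul_smul, sinMode_eq, cosMode_eq] using e.smul c
  have cy : ∀ (p : ℤ × ℕ) (c : ℂ), HasWeakDeriv L 1 (c • cosMode L p)
      ((c * (-freq L p.2)) • sinMode L p) := fun p c => by
    have e := hasWeakDeriv_one_sepL2 hL p.1 (contDiff_cosProfile L p.2)
    rw [sepL2_deriv_cosProfile] at e
    simpa only [smul_smul, sinMode_eq, cosMode_eq] using e.smul c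
  have hd10 : HasSum (fun p => (s p * freq L p.2 * (Complex.I * p.1)) • cosMode L p) d01 := by
    simpa only [mul_right_comm] using hd01
  have main : HasH2Laplacian L (dirichletRoot hL (dirichletRoot hL w)) (d00 + d11) := by
    refine ⟨![d0, d1], ![![d00, d01], ![d01, d11]], fun i => ?_, fun i j => ?_, rfl⟩
    · fin_cases i
      · exact hasWeakDeriv_of_hasSum hu hd0 fun p => sx p _
      · exact hasWeakDeriv_of_hasSum hu hd1 fun p => sy p _
    · fin_cases i <;> fin_cases j
      · exact hasWeakDeriv_of_hasSum hd0 hd00 fun p => sx p _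
      · exact hasWeakDeriv_of_hasSum hd0 hd01 fun p => sy p _
      · exact hasWeakDeriv_of_hasSum hd1 hd10 fun p => cx p _
      · exact hasWeakDeriv_of_hasSum hd1 hd11 fun p => cy p _
  have hw : d00 + d11 = -w := by
    refine (hd00.add hd11).unique ?_
    convert (hasSum_sinMode hL w).neg using 1
    funext p
    have e : s p = ((symbol L p)⁻¹ : ℝ) * inner ℂ (sinMode L p) w :=
      inner_dirichletRoot_twice hL p w
    have hne : (symbol L p : ℂ) ≠ 0 := Complex.ofReal_ne_zero.2 (symbol_pos hL p).ne'
    have hsym : (symbol L p : ℂ) = (p.1 : ℂ) ^ 2 + (freq L p.2 : ℂ) ^ 2 := by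
      unfold symbol
      push_cast
      rfl
    rw [← add_smul, ← neg_smul]
    congr 1
    have e2 : (symbol L p : ℂ) * s p = inner ℂ (sinMode L p) w := by
      rw [e, Complex.ofReal_inv, mul_inv_cancel_left₀ hne]
    rw [← e2, hsym]
    linear_combination (s p * (p.1 : ℂ) ^ 2) * Complex.I_sq
  simpa [hw] using main.lin main (-1) 0

/-! ### Weak equations for Fourier modes -/

lemma IsTestFunction.partialDeriv {L : ℝ} {φ : ℝ × ℝ → ℂ} (h : IsTestFunction L φ) (i : Fin 2) :
    IsTestFunction L (partialDeriv i φ) := by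
  obtain ⟨a, b, ha, hb, hs⟩ := h.support
  refine ⟨h.toIsPeriodicSmooth.partialDeriv i, a, b, ha, hb, fun x hx => ?_⟩
  have hsub : tsupport φ ⊆ Prod.snd ⁻¹' Icc a b :=
    closure_minimal (fun z hz => hs z hz) (isClosed_Icc.preimage continuous_snd)
  by_contra hcon
  have hx' : x ∉ tsupport φ := fun hmem => hcon (hsub hmem)
  have hz : φ =ᶠ[𝓝 x] 0 := notMem_tsupport_iff_eventuallyEq.1 hx'
  apply hx
  simp only [Boussinesq.partialDeriv]
  rw [hz.fderiv_eq]
  simp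

lemma HasH2Laplacian.integral_mul {L : ℝ} {u w : L2 L} (h : HasH2Laplacian L u w)
    {φ : ℝ × ℝ → ℂ} (hφ : IsTestFunction L φ) :
    ∫ x in channel L, w x * φ x = (∫ x in channel L, u x * partialDeriv 0 (partialDeriv 0 φ) x) +
      ∫ x in channel L, u x * partialDeriv 1 (partialDeriv 1 φ) x := by
  obtain ⟨d, dd, h1, h2, rfl⟩ := h
  rw [h1 0 _ (hφ.partialDeriv 0), h1 1 _ (hφ.partialDeriv 1), h2 0 0 _ hφ, h2 1 1 _ hφ, neg_neg,
    neg_neg]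
  have c := hφ.smooth.continuous
  rw [integral_mul_eq_inner c, integral_mul_eq_inner c, integral_mul_eq_inner c, inner_add_right]

lemma two_pi_ne_zero' : (2 * π : ℂ) ≠ 0 :=
  mul_ne_zero two_ne_zero (Complex.ofReal_ne_zero.2 pi_ne_zero)

/-- The Fourier modes of `w = Δ u` are the weak `w_k = u_k'' - k² u_k`. -/
lemma HasH2Laplacian.integral_fourierMode {L : ℝ} {u w : L2 L} (h : HasH2Laplacian L u w)
    (k : ℤ) {η : ℝ → ℂ} (hη : IsIntervalTest L η) :
    ∫ y in Ioo 0 L, fourierMode w k y * η y =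
      ∫ y in Ioo 0 L, fourierMode u k y * (deriv (deriv η) y - (k : ℂ) ^ 2 * η y) := by
  have e := h.integral_mul (isTestFunction_separated (-k) hη)
  have s0 : ContDiff ℝ ∞ fun y => Complex.I * ((-k : ℤ) : ℂ) * η y :=
    contDiff_const.mul hη.smooth
  have s00 : ContDiff ℝ ∞ fun y => Complex.I * ((-k : ℤ) : ℂ) * (Complex.I * ((-k : ℤ) : ℂ) * η y) :=
    contDiff_const.mul s0
  rw [partialDeriv_zero_separated _ hη.smooth, partialDeriv_zero_separated _ s0,
    partialDeriv_one_separated _ hη.smooth, partialDeriv_one_separated _ hη.deriv.smooth,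
    integral_mul_separated _ _ hη.smooth.continuous, integral_mul_separated _ _ s00.continuous,
    integral_mul_separated _ _ hη.deriv.deriv.smooth.continuous, ← mul_add] at e
  rw [mul_left_cancel₀ two_pi_ne_zero' e, ← integral_add
    (integrableOn_mul_continuous (integrableOn_fourierMode u k) s00.continuous)
    (integrableOn_mul_continuous (integrableOn_fourierMode u k)
      hη.deriv.deriv.smooth.continuous)]
  congr 1
  funext y
  push_cast
  linear_combination (fourierMode u k y * (k : ℂ) ^ 2 * η y) * Complex.I_sq

lemma deriv_sub_const_mul {f g : ℝ → ℂ} (hf : ContDiff ℝ ∞ f) (hg : ContDiff ℝ ∞ g) (c : ℂ) :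
    deriv (fun y => f y - c * g y) = fun y => deriv f y - c * deriv g y := by
  funext y
  have h : HasDerivAt (fun y => f y - c * g y) _ y :=
    (hasDerivAt_of_contDiff hf y).sub ((hasDerivAt_of_contDiff hg y).const_mul c)
  exact h.deriv

lemma diffOp_cons_neg (r : ℂ) (rs : List ℂ) {f : ℝ → ℂ} (hf : ContDiff ℝ ∞ f) :
    diffOp (r :: -r :: rs) f =
      fun y => deriv (deriv (diffOp rs f)) y - r ^ 2 * diffOp rs f y := by
  have h := contDiff_diffOp hf rs
  funext y
  simp only [diffOp]
  rw [deriv_sub_const_mul (contDiff_deriv h) h]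
  ring

/-- A pair of opposite roots gives the operator `D² - r²`, which is its own transpose. -/
lemma diffOpTranspose_cons_neg (r : ℂ) (rs : List ℂ) {f : ℝ → ℂ} (hf : ContDiff ℝ ∞ f) :
    diffOpTranspose (r :: -r :: rs) f =
      diffOpTranspose rs fun y => deriv (deriv f) y - r ^ 2 * f y := by
  simp only [diffOpTranspose]
  congr 1
  funext y
  have h : HasDerivAt (fun y => -deriv f y - r * f y) _ y :=
    (hasDerivAt_of_contDiff (contDiff_deriv hf) y).neg.sub
      ((hasDerivAt_of_contDiff hf y).const_mul r)
  rw [h.deriv]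
  ring

/-- The boundary values of `W` are recovered by testing the integration by parts with `1` and `y`.
-/
lemma boundary_eq_zero {L : ℝ} (hL : 0 < L) {W : ℝ → ℂ} (hW : ContDiff ℝ ∞ W)
    (h : ∀ η : ℝ → ℂ, ContDiff ℝ ∞ η →
      (∫ y in Ioo 0 L, W y * deriv η y) + ∫ y in Ioo 0 L, deriv W y * η y = 0) :
    W 0 = 0 ∧ W L = 0 := by
  have key : ∀ η : ℝ → ℂ, ContDiff ℝ ∞ η → W L * η L - W 0 * η 0 = 0 := by
    intro η hη
    rw [← h η hη, ← integral_add
      (integrableOn_Ioo_mul hW.continuous (contDiff_deriv hη).continuous)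
      (integrableOn_Ioo_mul (contDiff_deriv hW).continuous hη.continuous)]
    refine (integral_Ioo_deriv hL (F := fun y => W y * η y) (fun y => ?_) ?_).symm
    · refine ((hasDerivAt_of_contDiff hW y).mul (hasDerivAt_of_contDiff hη y)).congr_deriv ?_
      ring
    · exact (hW.continuous.mul (contDiff_deriv hη).continuous).add
        ((contDiff_deriv hW).continuous.mul hη.continuous)
  have h1 := key (fun _ => 1) contDiff_const
  have h2 := key (fun y => (y : ℂ)) Complex.ofRealCLM.contDiff
  have hLne : (L : ℂ) ≠ 0 := by exact_mod_cast hL.ne'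
  have hWL : W L = 0 := by
    have : W L * L = 0 := by simpa using h2
    exact (mul_eq_zero.1 this).resolve_right hLne
  refine ⟨?_, hWL⟩
  simpa [hWL] using h1

lemma integral_mul_deriv_test {L : ℝ} (hL : 0 < L) {W η : ℝ → ℂ} (hW : ContDiff ℝ ∞ W)
    (hη : IsIntervalTest L η) :
    ∫ y in Ioo 0 L, deriv W y * η y = -∫ y in Ioo 0 L, W y * deriv η y := by
  rw [eq_neg_iff_add_eq_zero, ← integral_add
    (integrableOn_Ioo_mul (contDiff_deriv hW).continuous hη.smooth.continuous)
    (integrableOn_Ioo_mul hW.continuous hη.deriv.smooth.continuous)]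
  rw [integral_Ioo_deriv hL (F := fun y => W y * η y)
    (fun y => (hasDerivAt_of_contDiff hW y).mul (hasDerivAt_of_contDiff hη.smooth y))
    (((contDiff_deriv hW).continuous.mul hη.smooth.continuous).add
      (hW.continuous.mul hη.deriv.smooth.continuous))]
  simp [hη.zero_left le_rfl, hη.zero_right le_rfl]

lemma integral_mul_congr_ae {L : ℝ} {f W : ℝ → ℂ}
    (h : ∀ᵐ y ∂volume.restrict (Ioo 0 L), f y = W y) (g : ℝ → ℂ) :
    ∫ y in Ioo 0 L, f y * g y = ∫ y in Ioo 0 L, W y * g y := by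
  refine integral_congr_ae ?_
  filter_upwards [h] with y hy
  rw [hy]

/-- If a Fourier mode of a function of vanishing trace is smooth, it vanishes at the end points. -/
lemma HasZeroTrace.fourierMode_eq_zero {L : ℝ} (hL : 0 < L) {u : L2 L} (h : HasZeroTrace L u)
    {k : ℤ} {W : ℝ → ℂ} (hW : ContDiff ℝ ∞ W)
    (hu : ∀ᵐ y ∂volume.restrict (Ioo 0 L), fourierMode u k y = W y) : W 0 = 0 ∧ W L = 0 := by
  obtain ⟨v, hv, ht⟩ := h
  have hv' : ∀ᵐ y ∂volume.restrict (Ioo 0 L), fourierMode v k y = deriv W y := by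
    refine ae_eq_of_integral_mul_eq (integrableOn_fourierMode v k)
      (contDiff_deriv hW).continuous fun η hη => ?_
    have e := hv _ (isTestFunction_separated (-k) hη)
    rw [partialDeriv_one_separated _ hη.smooth,
      integral_mul_separated _ _ hη.deriv.smooth.continuous,
      integral_mul_separated _ _ hη.smooth.continuous, ← mul_neg] at e
    rw [integral_mul_deriv_test hL hW hη, ← integral_mul_congr_ae hu,
      mul_left_cancel₀ two_pi_ne_zero' e, neg_neg]
  refine boundary_eq_zero hL hW fun η hη => ?_
  have e := ht _ (isPeriodicSmooth_separated (-k) hη)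
  rw [partialDeriv_one_separated _ hη,
    integral_mul_separated _ _ (contDiff_deriv hη).continuous,
    integral_mul_separated _ _ hη.continuous, ← mul_add, integral_mul_congr_ae hu,
    integral_mul_congr_ae hv'] at e
  exact (mul_eq_zero.1 e).resolve_left two_pi_ne_zero'

/-! ### Energy arguments -/

/-- The energy method: if a flux `G` vanishes at both ends and its derivative dominates `f'²`, then
`f` is constant, hence zero. -/
lemma eq_zero_of_energy {L : ℝ} (hL : 0 < L) {f f' G q : ℝ → ℝ} {c : ℝ} (hc : 0 < c)
    (hf : ∀ y, HasDerivAt f (f' y) y) (hG : ∀ y, HasDerivAt G (q y) y)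
    (hq : ∀ y, c * f' y ^ 2 ≤ q y) (h0 : f 0 = 0) (hG0 : G 0 = 0) (hGL : G L = 0) :
    ∀ y ∈ Icc 0 L, f y = 0 := by
  have hq0 : ∀ y, 0 ≤ q y := fun y => (by positivity : 0 ≤ c * f' y ^ 2).trans (hq y)
  have hmono : Monotone G := monotone_of_hasDerivAt_nonneg hG hq0
  have hGz : ∀ y ∈ Icc 0 L, G y = 0 := fun y hy =>
    le_antisymm ((hmono hy.2).trans_eq hGL) (hG0.symm.le.trans (hmono hy.1))
  have hqz : ∀ y ∈ Ioo 0 L, q y = 0 := by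
    intro y hy
    have e : G =ᶠ[𝓝 y] fun _ => 0 := by
      filter_upwards [isOpen_Ioo.mem_nhds hy] with z hz
      exact hGz z (Ioo_subset_Icc_self hz)
    exact ((hG y).congr_of_eventuallyEq e.symm).unique (hasDerivAt_const y 0)
  have hf'z : ∀ y ∈ Ioo 0 L, f' y = 0 := by
    intro y hy
    have h1 := hq y
    rw [hqz y hy] at h1
    have h2 : f' y ^ 2 ≤ 0 := by
      by_contra hcon
      nlinarith [mul_pos hc (not_le.1 hcon)]
    exact pow_eq_zero_iff two_ne_zero |>.1 (le_antisymm h2 (sq_nonneg _))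
  intro y hy
  have := constant_of_has_deriv_right_zero (f := f) (a := 0) (b := L)
    (fun z _ => (hf z).continuousAt.continuousWithinAt) (fun z hz => ?_) y hy
  · rw [this, h0]
  · have hc' : ContinuousOn f (Icc 0 L) := fun z _ => (hf z).continuousAt.continuousWithinAt
    rcases hz.1.eq_or_lt with rfl | hz0
    · have hlim : Tendsto f' (𝓝[>] (0 : ℝ)) (𝓝 0) := by
        refine tendsto_const_nhds.congr' ?_
        filter_upwards [Ioo_mem_nhdsGT hL] with z hz
        exact (hf'z z hz).symm
      refine hasDerivWithinAt_Ici_of_tendsto_deriv (s := Ioo 0 L)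
        (fun z hz => (hf z).differentiableAt.differentiableWithinAt)
        (hf 0).continuousAt.continuousWithinAt (Ioo_mem_nhdsGT hL) ?_
      simpa only [(hf _).deriv] using hlim
    · rw [← hf'z z ⟨hz0, hz.2⟩]
      exact (hf z).hasDerivWithinAt

lemma hasDerivAt_comp_clm (ℓ : ℂ →L[ℝ] ℝ) {f : ℝ → ℂ} (hf : ContDiff ℝ ∞ f) (y : ℝ) :
    HasDerivAt (fun y => ℓ (f y)) (ℓ (deriv f y)) y :=
  ℓ.hasFDerivAt.comp_hasDerivAt y (hasDerivAt_of_contDiff hf y)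

lemma clm_real_mul (ℓ : ℂ →L[ℝ] ℝ) (a : ℝ) (z : ℂ) : ℓ ((a : ℂ) * z) = a * ℓ z := by
  rw [← Complex.real_smul, map_smul, smul_eq_mul]

lemma eq_zero_of_re_im {f : ℝ → ℂ} {y : ℝ} (h : ∀ ℓ : ℂ →L[ℝ] ℝ, ℓ (f y) = 0) : f y = 0 :=
  Complex.ext (h Complex.reCLM) (h Complex.imCLM)

lemma eq_zero_of_deriv_deriv_eq {L : ℝ} (hL : 0 < L) {W : ℝ → ℂ} (hW : ContDiff ℝ ∞ W) {a : ℝ}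
    (ha : 0 ≤ a) (h : ∀ y, deriv (deriv W) y = a * W y) (h0 : W 0 = 0) (h1 : W L = 0) :
    ∀ y ∈ Icc 0 L, W y = 0 := by
  intro y hy
  refine eq_zero_of_re_im fun ℓ => ?_
  have d0 := hasDerivAt_comp_clm ℓ hW
  have d1 := hasDerivAt_comp_clm ℓ (contDiff_deriv hW)
  refine eq_zero_of_energy hL one_pos d0 (fun y => (d0 y).mul (d1 y)) (fun y => ?_)
    (by simp [h0]) (by simp [h0]) (by simp [h1]) y hy
  rw [h, clm_real_mul]
  nlinarith [mul_nonneg ha (sq_nonneg (ℓ (W y)))]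

/-- The clamped problem `(D² - k²)(D² - a) W = 0` has only the trivial solution if `a ≥ 0`. The
energy flux is `W'' W' - W''' W + (k² + a) W' W`. -/
lemma eq_zero_of_clamped {L : ℝ} (hL : 0 < L) {W : ℝ → ℂ} (hW : ContDiff ℝ ∞ W) {k a : ℝ}
    (hk : k ≠ 0) (ha : 0 ≤ a) (h : ∀ y, deriv (deriv (deriv (deriv W))) y =
      ((k ^ 2 + a : ℝ) : ℂ) * deriv (deriv W) y - ((k ^ 2 * a : ℝ) : ℂ) * W y) (h0 : W 0 = 0)
    (h0' : deriv W 0 = 0) (h1 : W L = 0) (h1' : deriv W L = 0) :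
    ∀ y ∈ Icc 0 L, W y = 0 := by
  intro y hy
  refine eq_zero_of_re_im fun ℓ => ?_
  have d0 := hasDerivAt_comp_clm ℓ hW
  have d1 := hasDerivAt_comp_clm ℓ (contDiff_deriv hW)
  have d2 := hasDerivAt_comp_clm ℓ (contDiff_deriv (contDiff_deriv hW))
  have d3 := hasDerivAt_comp_clm ℓ (contDiff_deriv (contDiff_deriv (contDiff_deriv hW)))
  have hc : 0 < k ^ 2 + a := by positivity
  refine eq_zero_of_energy hL hc d0
    (fun y => ((((d2 y).mul (d1 y)).sub ((d3 y).mul (d0 y))).add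
      (((d1 y).mul (d0 y)).const_mul (k ^ 2 + a)))) (fun y => ?_)
    (by simp [h0]) (by simp [h0, h0']) (by simp [h1, h1']) y hy
  rw [h, map_sub, clm_real_mul, clm_real_mul]
  nlinarith [mul_nonneg (mul_nonneg (sq_nonneg k) ha) (sq_nonneg (ℓ (W y))),
    sq_nonneg (ℓ (deriv (deriv W) y))]

/-! ### The graph of the Dirichlet Laplacian -/

/-- Uniqueness for the Dirichlet problem. -/
lemma eq_zero_of_laplacian_eq_zero {L : ℝ} (hL : 0 < L) {u : L2 L} (ht : HasZeroTrace L u)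
    (h : HasH2Laplacian L u 0) : u = 0 := by
  refine eq_zero_of_fourierMode hL fun k => ?_
  obtain ⟨W, hW, hWu, hWeq⟩ := exists_contDiff_of_weak hL (integrableOn_fourierMode u k)
    [(k : ℂ), -(k : ℂ)] (h := fun _ => 0) contDiff_const (fun η hη => by
      rw [diffOpTranspose_cons_neg _ _ hη.smooth]
      simp only [diffOpTranspose]
      rw [← h.integral_fourierMode k hη]
      have e := integral_mul_separated (0 : L2 L) k hη.smooth.continuous
      rw [integral_mul_eq_inner (continuous_separated _ hη.smooth.continuous),
        inner_zero_right] at e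
      simpa using (mul_eq_zero.1 e.symm).resolve_left two_pi_ne_zero')
  rw [diffOp_cons_neg _ _ hW] at hWeq
  obtain ⟨h0, h1⟩ := ht.fourierMode_eq_zero hL hW hWu
  have hz := eq_zero_of_deriv_deriv_eq hL hW (a := (k : ℝ) ^ 2) (by positivity) (fun y => by
    have := congrFun hWeq y
    simp only [diffOp] at this
    push_cast
    linear_combination this) h0 h1
  filter_upwards [hWu, ae_restrict_mem measurableSet_Ioo] with y hy hy'
  rw [hy, hz y (Ioo_subset_Icc_self hy')]

/-- `u ∈ H²(Ω) ∩ H¹₀(Ω)` and `Δ u = w` if and only if `u = -(-Δ)^{-1} w`. -/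
lemma zeroTrace_and_laplacian_iff {L : ℝ} (hL : 0 < L) {u w : L2 L} :
    HasZeroTrace L u ∧ HasH2Laplacian L u w ↔ u = -dirichletRoot hL (dirichletRoot hL w) := by
  have ht : HasZeroTrace L (-dirichletRoot hL (dirichletRoot hL w)) := by
    rw [← map_neg]
    exact hasZeroTrace_dirichletRoot hL _
  have hl := hasH2Laplacian_dirichletRoot hL w
  constructor
  · rintro ⟨h1, h2⟩
    have e1 := h1.lin ht 1 (-1)
    have e2 := h2.lin hl 1 (-1)
    rw [one_smul, neg_one_smul] at e1 e2
    rw [one_smul, neg_one_smul, add_neg_cancel] at e2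
    exact add_neg_eq_zero.1 (eq_zero_of_laplacian_eq_zero hL e1 e2)
  · rintro rfl
    exact ⟨ht, hl⟩

/-- The inverse of the Dirichlet Laplacian `α Δ`. -/
def dirichletInverse {L : ℝ} (hL : 0 < L) (α : ℝ) : L2 L →L[ℂ] L2 L :=
  (-(α : ℂ)⁻¹) • (dirichletRoot hL ∘L dirichletRoot hL)

lemma dirichletInverse_apply {L : ℝ} (hL : 0 < L) (α : ℝ) (w : L2 L) :
    dirichletInverse hL α w = (-(α : ℂ)⁻¹) • dirichletRoot hL (dirichletRoot hL w) := rfl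

/-- `dirichletInverse` is the two-sided inverse of the Dirichlet Laplacian on `H²(Ω) ∩ H¹₀(Ω)`. -/
lemma mem_dirichletGraph_iff {L : ℝ} (hL : 0 < L) {α : ℝ} (hα : 0 < α) {θ g : L2 L} :
    (θ, g) ∈ dirichletGraph α L ↔ θ = dirichletInverse hL α g := by
  have hα' : (α : ℂ) ≠ 0 := Complex.ofReal_ne_zero.2 hα.ne'
  constructor
  · rintro ⟨h1, w, h2, h3⟩
    simp only at h1 h2 h3
    rw [h3, dirichletInverse_apply, map_smul, map_smul, smul_smul, neg_mul, inv_mul_cancel₀ hα',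
      neg_one_smul]
    exact (zeroTrace_and_laplacian_iff hL).1 ⟨h1, h2⟩
  · intro h
    obtain ⟨h1, h2⟩ := (zeroTrace_and_laplacian_iff hL (u := θ) (w := (α : ℂ)⁻¹ • g)).2 (by
      rw [h, dirichletInverse_apply, map_smul, map_smul, neg_smul])
    exact ⟨h1, _, h2, by simp [smul_smul, hα']⟩

lemma dirichletInverse_symm {L : ℝ} (hL : 0 < L) (α : ℝ) (x y : L2 L) :
    inner ℂ (dirichletInverse hL α x) y = inner ℂ x (dirichletInverse hL α y) := by
  simp only [dirichletInverse_apply, inner_smul_left, inner_smul_right, dirichletRoot_symm]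
  simp

lemma isCompactOperator_dirichletInverse {L : ℝ} (hL : 0 < L) (α : ℝ) :
    IsCompactOperator (dirichletInverse hL α) :=
  ((isCompactOperator_dirichletRoot hL).clm_comp (dirichletRoot hL)).smul (-(α : ℂ)⁻¹)

lemma dirichletInverse_injective {L : ℝ} (hL : 0 < L) {α : ℝ} (hα : 0 < α) {x : L2 L}
    (h : dirichletInverse hL α x = 0) : x = 0 := by
  rw [dirichletInverse_apply, smul_eq_zero] at h
  have hα' : -(α : ℂ)⁻¹ ≠ 0 := neg_ne_zero.2 (inv_ne_zero (Complex.ofReal_ne_zero.2 hα.ne'))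
  exact dirichletRoot_injective hL (dirichletRoot_injective hL (h.resolve_left hα'))

/-! ### The inverse of the Stokes operator -/

section Compression

variable {H : Type*} [NormedAddCommGroup H] [InnerProductSpace ℂ H]

/-- The preimage under `K` of a subspace. For `K = (-Δ)^{-1/2}` and solenoidal fields this is the
image under `(-Δ)^{1/2}` of the solenoidal fields in `H¹₀`. -/
def preimageSpace (V : Submodule ℂ H) (K : H →L[ℂ] H) : Submodule ℂ H :=
  V.comap (K : H →ₗ[ℂ] H)

lemma mem_preimageSpace {V : Submodule ℂ H} {K : H →L[ℂ] H} {x : H} :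
    x ∈ preimageSpace V K ↔ K x ∈ V := Iff.rfl

variable [CompleteSpace H]

instance (V : Submodule ℂ H) [CompleteSpace V] (K : H →L[ℂ] H) :
    CompleteSpace (preimageSpace V K) := by
  have hV : IsClosed (V : Set H) := (completeSpace_coe_iff_isComplete.1 ‹_›).isClosed
  exact (hV.preimage K.continuous).completeSpace_coe

/-- The operator `K P K` on `V`, where `P` is the orthogonal projection onto `K⁻¹(V)`. For `K =
(-Δ)^{-1/2}` and solenoidal fields `V` it is the solution operator of the variational problem for
`-ℙ Δ`. -/
def compression (V : Submodule ℂ H) [CompleteSpace V] (K : H →L[ℂ] H) : V →L[ℂ] V :=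
  ((K ∘L (preimageSpace V K).starProjection ∘L K) ∘L V.subtypeL).codRestrict V fun _ =>
    mem_preimageSpace.1 ((preimageSpace V K).starProjection_apply_mem _)

variable {V : Submodule ℂ H} [CompleteSpace V] {K : H →L[ℂ] H}

lemma coe_compression (f : V) :
    (compression V K f : H) = K ((preimageSpace V K).starProjection (K f)) := rfl

lemma isCompactOperator_compression (hK : IsCompactOperator K) :
    IsCompactOperator (compression V K) := by
  have hV : IsClosed (V : Set H) := (completeSpace_coe_iff_isComplete.1 ‹_›).isClosed
  refine IsCompactOperator.codRestrict ?_ _ hV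
  exact hK.comp_clm (((preimageSpace V K).starProjection ∘L K) ∘L V.subtypeL)

lemma inner_compression (hK : ∀ x y, inner ℂ (K x) y = inner ℂ x (K y)) (f g : V) :
    inner ℂ (compression V K f) g = inner ℂ ((preimageSpace V K).starProjection (K f))
      ((preimageSpace V K).starProjection (K g)) := by
  rw [Submodule.coe_inner, coe_compression, hK,
    ← Submodule.inner_starProjection_left_eq_right,
    Submodule.starProjection_eq_self_iff.2 (Submodule.starProjection_apply_mem _ _)]

lemma compression_symm (hK : ∀ x y, inner ℂ (K x) y = inner ℂ x (K y)) (f g : V) :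
    inner ℂ (compression V K f) g = inner ℂ f (compression V K g) := by
  rw [inner_compression hK, ← inner_conj_symm f, inner_compression hK, inner_conj_symm]

/-- On the projections of the `w` with `K² w ∈ V` the compression acts as `K²`. -/
lemma compression_projection (hK : ∀ x y, inner ℂ (K x) y = inner ℂ x (K y)) {w : H}
    (hw : K (K w) ∈ V) : (compression V K (V.orthogonalProjectionOnto w) : H) = K (K w) := by
  rw [coe_compression]
  congr 1
  refine Submodule.eq_starProjection_of_mem_of_inner_eq_zero (K := preimageSpace V K) hw
    fun g hg => ?_
  rw [inner_sub_left, hK, hK, sub_eq_zero]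
  exact V.inner_orthogonalProjectionOnto_eq_of_mem_right ⟨K g, hg⟩ w

lemma inner_eq_zero_of_compression_eq_zero (hK : ∀ x y, inner ℂ (K x) y = inner ℂ x (K y)) {f : V}
    (hf : compression V K f = 0) {w : H} (hw : K (K w) ∈ V) : inner ℂ (K (K w)) (f : H) = 0 := by
  have h0 : (preimageSpace V K).starProjection (K f) = 0 := by
    rw [← inner_self_eq_zero (𝕜 := ℂ), ← inner_compression hK, hf, inner_zero_left]
  rw [hK]
  have hw' : K w ∈ preimageSpace V K := hw
  rw [← Submodule.starProjection_eq_self_iff.2 hw', Submodule.inner_starProjection_left_eq_right, h0,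
    inner_zero_right]

end Compression

/-- The operator `(-Δ)^{-1/2}` on vector fields. -/
def vectorRoot {L : ℝ} (hL : 0 < L) : L2Vec L →L[ℂ] L2Vec L :=
  ((WithLp.prodContinuousLinearEquiv 2 ℂ (L2 L) (L2 L)).symm : _ →L[ℂ] L2Vec L) ∘L
    (ContinuousLinearMap.inl ℂ (L2 L) (L2 L) ∘L dirichletRoot hL ∘L WithLp.fstL 2 ℂ (L2 L) (L2 L) +
      ContinuousLinearMap.inr ℂ (L2 L) (L2 L) ∘L dirichletRoot hL ∘L WithLp.sndL 2 ℂ (L2 L) (L2 L))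

lemma vectorRoot_fst {L : ℝ} (hL : 0 < L) (u : L2Vec L) :
    (vectorRoot hL u).fst = dirichletRoot hL u.fst := by
  simp [vectorRoot]

lemma vectorRoot_snd {L : ℝ} (hL : 0 < L) (u : L2Vec L) :
    (vectorRoot hL u).snd = dirichletRoot hL u.snd := by
  simp [vectorRoot]

lemma isCompactOperator_vectorRoot {L : ℝ} (hL : 0 < L) : IsCompactOperator (vectorRoot hL) := by
  have h := isCompactOperator_dirichletRoot hL
  have h1 := (h.comp_clm (WithLp.fstL 2 ℂ (L2 L) (L2 L))).clm_comp
    (ContinuousLinearMap.inl ℂ (L2 L) (L2 L))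
  have h2 := (h.comp_clm (WithLp.sndL 2 ℂ (L2 L) (L2 L))).clm_comp
    (ContinuousLinearMap.inr ℂ (L2 L) (L2 L))
  exact (h1.add h2).clm_comp
    ((WithLp.prodContinuousLinearEquiv 2 ℂ (L2 L) (L2 L)).symm : _ →L[ℂ] L2Vec L)

lemma vectorRoot_symm {L : ℝ} (hL : 0 < L) (u v : L2Vec L) :
    inner ℂ (vectorRoot hL u) v = inner ℂ u (vectorRoot hL v) := by
  rw [WithLp.prod_inner_apply, WithLp.prod_inner_apply]
  change inner ℂ (vectorRoot hL u).fst v.fst + inner ℂ (vectorRoot hL u).snd v.snd =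
    inner ℂ u.fst (vectorRoot hL v).fst + inner ℂ u.snd (vectorRoot hL v).snd
  simp only [vectorRoot_fst, vectorRoot_snd, dirichletRoot_symm]

/-- The solution operator `S` of the variational Stokes problem. It is defined on all solenoidal
fields and `S A_S u = u` for `u` in the domain of `A_S`; that its range is contained in that domain
is not needed. -/
def stokesInverse {L : ℝ} (hL : 0 < L) (ν : ℝ) : solenoidal L →L[ℂ] solenoidal L :=
  (-(ν : ℂ)⁻¹) • compression (solenoidal L) (vectorRoot hL)

lemma stokesInverse_apply {L : ℝ} (hL : 0 < L) (ν : ℝ) (f : solenoidal L) :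
    stokesInverse hL ν f = (-(ν : ℂ)⁻¹) • compression (solenoidal L) (vectorRoot hL) f := rfl

lemma stokesInverse_symm {L : ℝ} (hL : 0 < L) (ν : ℝ) (f g : solenoidal L) :
    inner ℂ (stokesInverse hL ν f) g = inner ℂ f (stokesInverse hL ν g) := by
  rw [stokesInverse_apply, stokesInverse_apply]
  have h1 := inner_smul_left (𝕜 := ℂ) (compression (solenoidal L) (vectorRoot hL) f) g (-(ν : ℂ)⁻¹)
  have h2 := inner_smul_right (𝕜 := ℂ) f (compression (solenoidal L) (vectorRoot hL) g) (-(ν : ℂ)⁻¹)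
  rw [compression_symm (vectorRoot_symm hL)] at h1
  refine h1.trans (Eq.trans ?_ h2.symm)
  simp

lemma isCompactOperator_stokesInverse {L : ℝ} (hL : 0 < L) (ν : ℝ) :
    IsCompactOperator (stokesInverse hL ν) :=
  (isCompactOperator_compression (isCompactOperator_vectorRoot hL)).smul (-(ν : ℂ)⁻¹)

lemma eq_vectorRoot {L : ℝ} (hL : 0 < L) {u : L2Vec L} {w₁ w₂ : L2 L} (t1 : HasZeroTrace L u.fst)
    (t2 : HasZeroTrace L u.snd) (h1 : HasH2Laplacian L u.fst w₁) (h2 : HasH2Laplacian L u.snd w₂) :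
    u = -vectorRoot hL (vectorRoot hL (WithLp.toLp 2 (w₁, w₂))) := by
  refine (WithLp.ofLp_injective 2) (Prod.ext ?_ ?_)
  · change u.fst = -(vectorRoot hL (vectorRoot hL (WithLp.toLp 2 (w₁, w₂)))).fst
    rw [vectorRoot_fst, vectorRoot_fst]
    exact (zeroTrace_and_laplacian_iff hL).1 ⟨t1, h1⟩
  · change u.snd = -(vectorRoot hL (vectorRoot hL (WithLp.toLp 2 (w₁, w₂)))).snd
    rw [vectorRoot_snd, vectorRoot_snd]
    exact (zeroTrace_and_laplacian_iff hL).1 ⟨t2, h2⟩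

/-- `S` is a left inverse of the Stokes operator. -/
lemma eq_stokesInverse_of_mem {L : ℝ} (hL : 0 < L) {ν : ℝ} (hν : 0 < ν) {u f : solenoidal L}
    (h : (u, f) ∈ stokesGraph ν L) : u = stokesInverse hL ν f := by
  obtain ⟨t1, t2, w₁, w₂, h1, h2, h3⟩ := h
  have e := eq_vectorRoot hL t1 t2 h1 h2
  simp only at e h3
  have hν' : (ν : ℂ) ≠ 0 := Complex.ofReal_ne_zero.2 hν.ne'
  have hm : vectorRoot hL (vectorRoot hL (WithLp.toLp 2 (w₁, w₂))) ∈ solenoidal L := by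
    rw [← neg_mem_iff, ← e]
    exact u.2
  rw [h3, stokesInverse_apply, map_smul, smul_smul, neg_mul, inv_mul_cancel₀ hν', neg_one_smul]
  refine Subtype.ext ?_
  rw [e, Submodule.coe_neg]
  exact congrArg _ (compression_projection (vectorRoot_symm hL) hm).symm

lemma hasZeroTrace_stokesInverse {L : ℝ} (hL : 0 < L) (ν : ℝ) (f : solenoidal L) :
    HasZeroTrace L (stokesInverse hL ν f : L2Vec L).fst ∧
      HasZeroTrace L (stokesInverse hL ν f : L2Vec L).snd := by
  obtain ⟨g, hg⟩ : ∃ g, (stokesInverse hL ν f : L2Vec L) = vectorRoot hL g := by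
    refine ⟨(-(ν : ℂ)⁻¹) • (preimageSpace (solenoidal L) (vectorRoot hL)).starProjection
      (vectorRoot hL f), ?_⟩
    rw [map_smul, ← coe_compression, stokesInverse_apply, Submodule.coe_smul]
  rw [hg, vectorRoot_fst, vectorRoot_snd]
  exact ⟨hasZeroTrace_dirichletRoot hL _, hasZeroTrace_dirichletRoot hL _⟩

/-- The kernel of `S` is orthogonal to the domain of the Stokes operator. -/
lemma inner_eq_zero_of_stokesInverse_eq_zero {L : ℝ} (hL : 0 < L) {ν : ℝ} (hν : 0 < ν)
    {f u g : solenoidal L} (hf : stokesInverse hL ν f = 0) (h : (u, g) ∈ stokesGraph ν L) :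
    inner ℂ u f = 0 := by
  obtain ⟨t1, t2, w₁, w₂, h1, h2, h3⟩ := h
  have e := eq_vectorRoot hL t1 t2 h1 h2
  simp only at e
  have hν' : -(ν : ℂ)⁻¹ ≠ 0 := neg_ne_zero.2 (inv_ne_zero (Complex.ofReal_ne_zero.2 hν.ne'))
  rw [stokesInverse_apply, smul_eq_zero] at hf
  have hm : vectorRoot hL (vectorRoot hL (WithLp.toLp 2 (w₁, w₂))) ∈ solenoidal L := by
    rw [← neg_mem_iff, ← e]
    exact u.2
  rw [Submodule.coe_inner, e, inner_neg_left,
    inner_eq_zero_of_compression_eq_zero (vectorRoot_symm hL) (hf.resolve_left hν') hm, neg_zero]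

/-! ### Fourier modes of solenoidal fields -/

/-- The vector field `exp (i k x₁) (f(x₂), g(x₂))`. -/
def modeField (L : ℝ) (k : ℤ) {f g : ℝ → ℂ} (hf : ContDiff ℝ ∞ f) (hg : ContDiff ℝ ∞ g) : L2Vec L :=
  WithLp.toLp 2 (sepL2 L k hf, sepL2 L k hg)

lemma inner_modeField {L : ℝ} (k : ℤ) {f g : ℝ → ℂ} (hf : ContDiff ℝ ∞ f) (hg : ContDiff ℝ ∞ g)
    (u : L2Vec L) : inner ℂ (modeField L k hf hg) u =
      2 * π * ((∫ y in Ioo 0 L, fourierMode u.fst k y * (starRingEnd ℂ) (f y)) +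
        ∫ y in Ioo 0 L, fourierMode u.snd k y * (starRingEnd ℂ) (g y)) := by
  rw [WithLp.prod_inner_apply, mul_add, ← inner_contL2_separated u.fst k hf.continuous,
    ← inner_contL2_separated u.snd k hg.continuous]
  rfl

lemma modeField_mem_solenoidal {L : ℝ} (hL : 0 < L) (k : ℤ) {f g : ℝ → ℂ} (hf : ContDiff ℝ ∞ f)
    (hg : ContDiff ℝ ∞ g) (h : ∀ y, Complex.I * k * f y + deriv g y = 0) (h0 : g 0 = 0)
    (h1 : g L = 0) : modeField L k hf hg ∈ solenoidal L := by
  have key : ∀ φ : ℝ × ℝ → ℂ, IsPeriodicSmooth φ →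
      (∫ x in channel L, (modeField L k hf hg).fst x * partialDeriv 0 φ x) +
        ∫ x in channel L, (modeField L k hf hg).snd x * partialDeriv 1 φ x = 0 := by
    intro φ hφ
    have e0 := integral_mul_partialDeriv hL (isPeriodicSmooth_separated k hf) hφ 0
      (fun h => absurd h (by decide))
    have e1 := integral_mul_partialDeriv hL (isPeriodicSmooth_separated k hg) hφ 1
      (fun _ x => by simp [separated, h0, h1])
    have i0 : ∫ x in channel L, (modeField L k hf hg).fst x * partialDeriv 0 φ x =
        ∫ x in channel L, separated k f x * partialDeriv 0 φ x :=
      integral_contL2_mul (continuous_separated k hf.continuous) _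
    have i1 : ∫ x in channel L, (modeField L k hf hg).snd x * partialDeriv 1 φ x =
        ∫ x in channel L, separated k g x * partialDeriv 1 φ x :=
      integral_contL2_mul (continuous_separated k hg.continuous) _
    have e2 : (∫ x in channel L, partialDeriv 0 (separated k f) x * φ x) +
        ∫ x in channel L, partialDeriv 1 (separated k g) x * φ x = 0 := by
      rw [← integral_add
        (integrable_channel_mul ((isPeriodicSmooth_separated k hf).continuous_partialDeriv 0)
          hφ.smooth.continuous)
        (integrable_channel_mul ((isPeriodicSmooth_separated k hg).continuous_partialDeriv 1)
          hφ.smooth.continuous)]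
      refine integral_eq_zero_of_ae (Eventually.of_forall fun x => ?_)
      rw [partialDeriv_zero_separated k hf, partialDeriv_one_separated k hg]
      simp only [separated, Pi.zero_apply]
      linear_combination Complex.exp (Complex.I * k * x.1) * φ x * h x.2
    rw [i0, i1]
    linear_combination e0 + e1 - e2
  exact ⟨fun φ hφ => key φ hφ.toIsPeriodicSmooth, key⟩

/-- The divergence condition, together with the vanishing normal trace, for the `k`-th mode. -/
lemma solenoidal_fourierMode {L : ℝ} (u : solenoidal L) (k : ℤ) {η : ℝ → ℂ}
    (hη : ContDiff ℝ ∞ η) : ∫ y in Ioo 0 L, fourierMode (u : L2Vec L).snd k y * deriv η y =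
      Complex.I * k * ∫ y in Ioo 0 L, fourierMode (u : L2Vec L).fst k y * η y := by
  have h := u.2.2 _ (isPeriodicSmooth_separated (-k) hη)
  have c0 : ContDiff ℝ ∞ fun y => Complex.I * ((-k : ℤ) : ℂ) * η y := contDiff_const.mul hη
  rw [partialDeriv_zero_separated (-k) hη, partialDeriv_one_separated (-k) hη,
    integral_mul_separated _ k c0.continuous, integral_mul_separated _ k (contDiff_deriv hη).continuous,
    ← mul_add] at h
  have h' := (mul_eq_zero.1 h).resolve_left two_pi_ne_zero'
  rw [← integral_const_mul, ← sub_eq_zero, ← h', add_comm, sub_eq_add_neg, ← integral_neg]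
  congr 1
  refine integral_congr_ae (Eventually.of_forall fun y => ?_)
  push_cast
  ring

/-- The mean flow has no vertical component. -/
lemma solenoidal_fourierMode_zero {L : ℝ} (u : solenoidal L) :
    ∀ᵐ y ∂volume.restrict (Ioo 0 L), fourierMode (u : L2Vec L).snd 0 y = 0 := by
  refine ae_eq_of_integral_mul_eq (integrableOn_fourierMode _ 0) continuous_const fun η hη => ?_
  have h := solenoidal_fourierMode u 0 (contDiff_integral hη.smooth)
  have e : deriv (fun y => ∫ t in (0 : ℝ)..y, η t) = η := by
    funext y
    exact (hasDerivAt_integral hη.smooth.continuous y).deriv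
  rw [e] at h
  simpa using h

/-- For `k ≠ 0` the vertical component of a solenoidal mode determines the horizontal one. -/
lemma solenoidal_fourierMode_of_ne_zero {L : ℝ} (hL : 0 < L) (u : solenoidal L) {k : ℤ} (hk : k ≠ 0)
    {G : ℝ → ℂ} (hG : ContDiff ℝ ∞ G)
    (hu : ∀ᵐ y ∂volume.restrict (Ioo 0 L), fourierMode (u : L2Vec L).snd k y = G y) :
    (∀ᵐ y ∂volume.restrict (Ioo 0 L),
      fourierMode (u : L2Vec L).fst k y = Complex.I / k * deriv G y) ∧ G 0 = 0 ∧ G L = 0 := by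
  have hk' : (k : ℂ) ≠ 0 := by exact_mod_cast hk
  have h1 : ∀ᵐ y ∂volume.restrict (Ioo 0 L),
      fourierMode (u : L2Vec L).fst k y = Complex.I / k * deriv G y := by
    refine ae_eq_of_integral_mul_eq (integrableOn_fourierMode _ k)
      (continuous_const.mul (contDiff_deriv hG).continuous) fun η hη => ?_
    have e := solenoidal_fourierMode u k hη.smooth
    rw [integral_mul_congr_ae hu, ← neg_eq_iff_eq_neg.2 (integral_mul_deriv_test hL hG hη)] at e
    simp only [mul_assoc]
    rw [integral_const_mul]
    field_simp
    linear_combination Complex.I * e +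
      (k * ∫ y in Ioo 0 L, fourierMode (u : L2Vec L).fst k y * η y) * Complex.I_sq
  refine ⟨h1, boundary_eq_zero hL hG fun η hη => ?_⟩
  have e := solenoidal_fourierMode u k hη
  rw [integral_mul_congr_ae hu, integral_mul_congr_ae h1] at e
  simp only [mul_assoc] at e
  rw [integral_const_mul] at e
  rw [e]
  field_simp
  linear_combination (∫ y in Ioo 0 L, deriv G y * η y) * Complex.I_sq

lemma contDiff_conj {f : ℝ → ℂ} (hf : ContDiff ℝ ∞ f) :
    ContDiff ℝ ∞ fun y => (starRingEnd ℂ) (f y) :=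
  Complex.conjCLE.contDiff.comp hf

lemma deriv_conj {f : ℝ → ℂ} (hf : ContDiff ℝ ∞ f) :
    deriv (fun y => (starRingEnd ℂ) (f y)) = fun y => (starRingEnd ℂ) (deriv f y) := by
  funext y
  exact (Complex.conjCLE.hasFDerivAt.comp_hasDerivAt y (hasDerivAt_of_contDiff hf y)).deriv

/-- The Leray projection annihilates gradients. -/
lemma leray_gradient {L : ℝ} (k : ℤ) {q : ℝ → ℂ} (hq : ContDiff ℝ ∞ q) :
    leray L (modeField L k (f := fun y => Complex.I * k * q y) (contDiff_const.mul hq)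
      (contDiff_deriv hq)) = 0 := by
  rw [leray, Submodule.orthogonalProjectionOnto_eq_zero_iff, Submodule.mem_orthogonal']
  intro v hv
  have e := solenoidal_fourierMode ⟨v, hv⟩ k (contDiff_conj hq)
  rw [deriv_conj hq] at e
  simp only at e
  rw [inner_modeField, e]
  have e' : ∫ y in Ioo 0 L, fourierMode v.fst k y * (starRingEnd ℂ) (Complex.I * k * q y) =
      -(Complex.I * k) * ∫ y in Ioo 0 L, fourierMode v.fst k y * (starRingEnd ℂ) (q y) := by
    rw [← integral_const_mul]
    refine integral_congr_ae (Eventually.of_forall fun y => ?_)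
    simp only [map_mul, Complex.conj_I, map_intCast]
    ring
  rw [e']
  ring

lemma coe_leray_of_mem {L : ℝ} {u : L2Vec L} (hu : u ∈ solenoidal L) : leray L u = ⟨u, hu⟩ :=
  (solenoidal L).orthogonalProjectionOnto_mem_subspace_eq_self ⟨u, hu⟩

lemma mem_stokesGraph_modeField {L : ℝ} (hL : 0 < L) {ν : ℝ} (k : ℤ) {f g f₂ g₂ : ℝ → ℂ}
    (hf : ContDiff ℝ ∞ f) (hg : ContDiff ℝ ∞ g) (hf₂ : ContDiff ℝ ∞ f₂) (hg₂ : ContDiff ℝ ∞ g₂)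
    (h : ∀ y, Complex.I * k * f y + deriv g y = 0) (f0 : f 0 = 0) (f1 : f L = 0) (g0 : g 0 = 0)
    (g1 : g L = 0) (ef : ∀ y, f₂ y = deriv (deriv f) y - k ^ 2 * f y)
    (eg : ∀ y, g₂ y = deriv (deriv g) y - k ^ 2 * g y) {w : solenoidal L}
    (hw : w = (ν : ℂ) • leray L (modeField L k hf₂ hg₂)) :
    (⟨modeField L k hf hg, modeField_mem_solenoidal hL k hf hg h g0 g1⟩, w) ∈ stokesGraph ν L :=
  ⟨hasZeroTrace_sepL2 hL k hf f0 f1, hasZeroTrace_sepL2 hL k hg g0 g1, _, _,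
    hasH2Laplacian_sepL2 hL k hf hf₂ ef, hasH2Laplacian_sepL2 hL k hg hg₂ eg, hw⟩

/-- The smooth profiles `F`, `G` of a velocity `exp (i k x₁) (F(x₂), G(x₂))` that solves the Stokes
eigenvalue problem for `z`; the function `q` is the profile of the pressure, divided by `ν`. -/
structure IsStokesMode (ν L : ℝ) (k : ℤ) (z : ℂ) (F G : ℝ → ℂ) : Prop where
  smooth_fst : ContDiff ℝ ∞ F
  smooth_snd : ContDiff ℝ ∞ G
  div : ∀ y, Complex.I * k * F y + deriv G y = 0
  fst_zero : F 0 = 0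
  fst_length : F L = 0
  snd_zero : G 0 = 0
  snd_length : G L = 0
  pressure : ∃ q : ℝ → ℂ, ContDiff ℝ ∞ q ∧
    (∀ y, deriv (deriv F) y - (k ^ 2 + z / ν) * F y = Complex.I * k * q y) ∧
    ∀ y, deriv (deriv G) y - (k ^ 2 + z / ν) * G y = deriv q y

lemma IsStokesMode.mem_solenoidal {ν L : ℝ} (hL : 0 < L) {k : ℤ} {z : ℂ} {F G : ℝ → ℂ}
    (h : IsStokesMode ν L k z F G) : modeField L k h.smooth_fst h.smooth_snd ∈ solenoidal L :=
  modeField_mem_solenoidal hL k h.smooth_fst h.smooth_snd h.div h.snd_zero h.snd_length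

/-- A Stokes mode gives an eigenfield of the Stokes operator, as the pressure gradient is projected
away. -/
lemma IsStokesMode.mem_stokesGraph {ν L : ℝ} (hν : 0 < ν) (hL : 0 < L) {k : ℤ} {z : ℂ} {F G : ℝ → ℂ}
    (h : IsStokesMode ν L k z F G) :
    ((⟨_, h.mem_solenoidal hL⟩, z • ⟨_, h.mem_solenoidal hL⟩) : solenoidal L × solenoidal L) ∈
      stokesGraph ν L := by
  obtain ⟨q, hq, h1, h2⟩ := h.pressure
  have hν' : (ν : ℂ) ≠ 0 := Complex.ofReal_ne_zero.2 hν.ne'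
  have hF := h.smooth_fst
  have hG := h.smooth_snd
  have hF₂ : ContDiff ℝ ∞ fun y => z / ν * F y + Complex.I * k * q y :=
    (contDiff_const.mul hF).add (contDiff_const.mul hq)
  have hG₂ : ContDiff ℝ ∞ fun y => z / ν * G y + deriv q y :=
    (contDiff_const.mul hG).add (contDiff_deriv hq)
  refine mem_stokesGraph_modeField hL k hF hG hF₂ hG₂ h.div h.fst_zero h.fst_length h.snd_zero
    h.snd_length (fun y => ?_) (fun y => ?_) ?_
  · linear_combination -h1 y
  · linear_combination -h2 y
  · have e : modeField L k hF₂ hG₂ = (z / ν) • modeField L k hF hG +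
        modeField L k (f := fun y => Complex.I * k * q y) (contDiff_const.mul hq)
          (contDiff_deriv hq) := by
      refine (WithLp.ofLp_injective 2) (Prod.ext ?_ ?_)
      · change sepL2 L k hF₂ = (z / ν) • sepL2 L k hF +
          sepL2 L k (f := fun y => Complex.I * k * q y) (contDiff_const.mul hq)
        rw [← sepL2_smul, ← sepL2_add]
      · change sepL2 L k hG₂ = (z / ν) • sepL2 L k hG + sepL2 L k (contDiff_deriv hq)
        rw [← sepL2_smul, ← sepL2_add]
    rw [e, map_add, leray_gradient k hq, add_zero, map_smul, coe_leray_of_mem (h.mem_solenoidal hL),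
      smul_smul, mul_div_cancel₀ _ hν']

/-! ### Eigenfields of the inverse Stokes operator -/

section Test

variable {L : ℝ} {k : ℤ} {ζ : ℝ → ℂ}

/-- The solenoidal test field `exp (i k x₁) (η', -i k η)` with `η` the conjugate of `ζ`. -/
def streamField (L : ℝ) (k : ℤ) (hζ : ContDiff ℝ ∞ ζ) : L2Vec L :=
  modeField L k (contDiff_conj (contDiff_deriv hζ))
    (g := fun y => -(Complex.I * k) * (starRingEnd ℂ) (ζ y)) (contDiff_const.mul (contDiff_conj hζ))

lemma inner_streamField (hk : k ≠ 0) (u : solenoidal L) (hζ : ContDiff ℝ ∞ ζ) :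
    inner ℂ (streamField L k hζ) (u : L2Vec L) = 2 * π * (-Complex.I / k) *
      ∫ y in Ioo 0 L, fourierMode (u : L2Vec L).snd k y * (deriv (deriv ζ) y - k ^ 2 * ζ y) := by
  have e := solenoidal_fourierMode u k (contDiff_deriv hζ)
  have e1 : ∫ y in Ioo 0 L, fourierMode (u : L2Vec L).snd k y *
      (starRingEnd ℂ) (-(Complex.I * k) * (starRingEnd ℂ) (ζ y)) =
      (Complex.I * k) * ∫ y in Ioo 0 L, fourierMode (u : L2Vec L).snd k y * ζ y := by
    rw [← integral_const_mul]
    refine integral_congr_ae (Eventually.of_forall fun y => ?_)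
    simp only [map_mul, map_neg, Complex.conj_I, map_intCast, Complex.conj_conj]
    ring
  have e2 : ∫ y in Ioo 0 L, fourierMode (u : L2Vec L).snd k y *
      (deriv (deriv ζ) y - k ^ 2 * ζ y) =
      (∫ y in Ioo 0 L, fourierMode (u : L2Vec L).snd k y * deriv (deriv ζ) y) -
        k ^ 2 * ∫ y in Ioo 0 L, fourierMode (u : L2Vec L).snd k y * ζ y := by
    rw [← integral_const_mul, ← integral_sub
      (integrableOn_mul_continuous (integrableOn_fourierMode _ k)
        (contDiff_deriv (contDiff_deriv hζ)).continuous)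
      ((integrableOn_mul_continuous (integrableOn_fourierMode _ k) hζ.continuous).const_mul _)]
    refine integral_congr_ae (Eventually.of_forall fun y => ?_)
    ring
  have hk' : (k : ℂ) ≠ 0 := by exact_mod_cast hk
  rw [streamField, inner_modeField, e1, e2, e]
  simp only [Complex.conj_conj]
  field_simp
  linear_combination (∫ y in Ioo 0 L, fourierMode (u : L2Vec L).fst k y * deriv ζ y) * Complex.I_sq

lemma streamField_div (hζ : ContDiff ℝ ∞ ζ) (y : ℝ) :
    Complex.I * k * (starRingEnd ℂ) (deriv ζ y) +
      deriv (fun y => -(Complex.I * k) * (starRingEnd ℂ) (ζ y)) y = 0 := by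
  have h := (hasDerivAt_of_contDiff (contDiff_conj hζ) y).const_mul (-(Complex.I * k : ℂ))
  rw [h.deriv, deriv_conj hζ]
  ring

lemma streamField_mem_solenoidal (hL : 0 < L) (hζ : IsIntervalTest L ζ) :
    streamField L k hζ.smooth ∈ solenoidal L :=
  modeField_mem_solenoidal hL k _ _ (streamField_div hζ.smooth)
    (by simp [hζ.zero_left le_rfl]) (by simp [hζ.zero_right le_rfl])

lemma IsIntervalTest.laplacian (hζ : IsIntervalTest L ζ) (c : ℂ) :
    IsIntervalTest L fun y => _root_.deriv (_root_.deriv ζ) y - c * ζ y :=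
  hζ.deriv.deriv.sub_mul hζ c

lemma streamField_mem_stokesGraph (hL : 0 < L) {ν : ℝ} (hζ : IsIntervalTest L ζ) :
    ((⟨_, streamField_mem_solenoidal (k := k) hL hζ⟩, (ν : ℂ) • ⟨_, streamField_mem_solenoidal
      (k := k) hL (hζ.laplacian (k ^ 2))⟩) : solenoidal L × solenoidal L) ∈ stokesGraph ν L := by
  have h := hζ.laplacian ((k : ℂ) ^ 2)
  have d1 := contDiff_deriv hζ.smooth
  have d2 := contDiff_deriv d1
  refine mem_stokesGraph_modeField hL k (contDiff_conj d1)
    (contDiff_const.mul (contDiff_conj hζ.smooth)) (contDiff_conj (contDiff_deriv h.smooth))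
    (g₂ := fun y => -(Complex.I * k) * (starRingEnd ℂ) (deriv (deriv ζ) y - k ^ 2 * ζ y))
    (contDiff_const.mul (contDiff_conj h.smooth)) (streamField_div hζ.smooth)
    (by simp [hζ.deriv.zero_left le_rfl]) (by simp [hζ.deriv.zero_right le_rfl])
    (by simp [hζ.zero_left le_rfl]) (by simp [hζ.zero_right le_rfl]) (fun y => ?_) (fun y => ?_) ?_
  · rw [deriv_conj d1, deriv_conj d2, deriv_sub_const_mul d2 hζ.smooth]
    simp
  · have e : deriv (fun y => -(Complex.I * k) * (starRingEnd ℂ) (ζ y)) =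
        fun y => -(Complex.I * k) * (starRingEnd ℂ) (deriv ζ y) := by
      funext y
      rw [((hasDerivAt_of_contDiff (contDiff_conj hζ.smooth) y).const_mul
        (-(Complex.I * k : ℂ))).deriv, deriv_conj hζ.smooth]
    have e' : deriv (fun y => -(Complex.I * k) * (starRingEnd ℂ) (deriv ζ y)) y =
        -(Complex.I * k) * (starRingEnd ℂ) (deriv (deriv ζ) y) := by
      rw [((hasDerivAt_of_contDiff (contDiff_conj d1) y).const_mul (-(Complex.I * k : ℂ))).deriv,
        deriv_conj d1]
    rw [e, e']
    simp only [map_sub, map_mul, map_pow, map_intCast]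
    ring
  · rw [← coe_leray_of_mem (streamField_mem_solenoidal (k := k) hL (hζ.laplacian (k ^ 2)))]
    rfl

/-- The mean flow `(η, 0)` with `η` the conjugate of `ζ`. -/
def shearField (L : ℝ) (hζ : ContDiff ℝ ∞ ζ) : L2Vec L :=
  modeField L 0 (contDiff_conj hζ) (g := fun _ => 0) contDiff_const

lemma inner_shearField (u : L2Vec L) (hζ : ContDiff ℝ ∞ ζ) :
    inner ℂ (shearField L hζ) u = 2 * π * ∫ y in Ioo 0 L, fourierMode u.fst 0 y * ζ y := by
  rw [shearField, inner_modeField]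
  simp

lemma shearField_mem_solenoidal (hL : 0 < L) (hζ : ContDiff ℝ ∞ ζ) :
    shearField L hζ ∈ solenoidal L :=
  modeField_mem_solenoidal hL 0 _ _ (by simp) rfl rfl

lemma shearField_mem_stokesGraph (hL : 0 < L) {ν : ℝ} (hζ : IsIntervalTest L ζ) :
    ((⟨_, shearField_mem_solenoidal hL hζ.smooth⟩, (ν : ℂ) • ⟨_, shearField_mem_solenoidal hL
      hζ.deriv.deriv.smooth⟩) : solenoidal L × solenoidal L) ∈ stokesGraph ν L := by
  refine mem_stokesGraph_modeField hL 0 (contDiff_conj hζ.smooth) contDiff_const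
    (contDiff_conj hζ.deriv.deriv.smooth) (g₂ := fun _ => 0) contDiff_const (by simp)
    (by simp [hζ.zero_left le_rfl]) (by simp [hζ.zero_right le_rfl]) rfl rfl (fun y => ?_)
    (fun y => by simp) ?_
  · rw [deriv_conj hζ.smooth, deriv_conj hζ.deriv.smooth]
    simp
  · rw [← coe_leray_of_mem (shearField_mem_solenoidal hL hζ.deriv.deriv.smooth)]
    rfl

end Test

/-- The kernel of `S` is orthogonal to the domain of the Stokes operator; for the fields with
compactly supported stream functions this says that `G'' = k² G` for the vertical component `G` of a
mode, and `G` vanishes at both ends. The mean flow is tested with shear flows. -/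
lemma stokesInverse_injective {L : ℝ} (hL : 0 < L) {ν : ℝ} (hν : 0 < ν) {f : solenoidal L}
    (hf : stokesInverse hL ν f = 0) : f = 0 := by
  have mode : ∀ k : ℤ,
      (∀ᵐ y ∂volume.restrict (Ioo 0 L), fourierMode (f : L2Vec L).fst k y = 0) ∧
      ∀ᵐ y ∂volume.restrict (Ioo 0 L), fourierMode (f : L2Vec L).snd k y = 0 := by
    intro k
    rcases eq_or_ne k 0 with rfl | hk
    · refine ⟨ae_eq_of_integral_mul_eq (integrableOn_fourierMode _ 0) continuous_const
        fun η hη => ?_, solenoidal_fourierMode_zero f⟩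
      have h1 : ∀ ζ, IsIntervalTest L ζ →
          ∫ y in Ioo 0 L, fourierMode (f : L2Vec L).fst 0 y * ζ y = 0 := by
        intro ζ hζ
        have e := inner_eq_zero_of_stokesInverse_eq_zero hL hν hf
          (shearField_mem_stokesGraph (ν := ν) hL hζ)
        rw [Submodule.coe_inner, inner_shearField] at e
        exact (mul_eq_zero.1 e).resolve_left two_pi_ne_zero'
      simpa using h1 η hη
    · have hk' : (k : ℂ) ≠ 0 := by exact_mod_cast hk
      obtain ⟨G, hG, hGu, hGeq⟩ := exists_contDiff_of_weak hL
        (integrableOn_fourierMode (f : L2Vec L).snd k)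
        [(k : ℂ), -(k : ℂ)] (h := fun _ => 0) contDiff_const (fun η hη => by
          rw [diffOpTranspose_cons_neg _ _ hη.smooth]
          simp only [diffOpTranspose]
          have e := inner_eq_zero_of_stokesInverse_eq_zero hL hν hf
            (streamField_mem_stokesGraph (ν := ν) (k := k) hL hη)
          rw [Submodule.coe_inner, inner_streamField hk] at e
          simpa using (mul_eq_zero.1 e).resolve_left (mul_ne_zero two_pi_ne_zero'
            (div_ne_zero (neg_ne_zero.2 Complex.I_ne_zero) hk')))
      rw [diffOp_cons_neg _ _ hG] at hGeq
      obtain ⟨h1, h0, hl⟩ := solenoidal_fourierMode_of_ne_zero hL f hk hG hGu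
      have hz := eq_zero_of_deriv_deriv_eq hL hG (a := (k : ℝ) ^ 2) (by positivity) (fun y => by
        have := congrFun hGeq y
        simp only [diffOp] at this
        push_cast
        linear_combination this) h0 hl
      constructor
      · filter_upwards [h1, ae_restrict_mem measurableSet_Ioo] with y hy hy'
        have e : deriv G y = 0 := by
          have : G =ᶠ[𝓝 y] fun _ => 0 := by
            filter_upwards [isOpen_Ioo.mem_nhds hy'] with t ht using hz t (Ioo_subset_Icc_self ht)
          rw [this.deriv_eq, deriv_const]
        rw [hy, e, mul_zero]
      · filter_upwards [hGu, ae_restrict_mem measurableSet_Ioo] with y hy hy'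
        rw [hy, hz y (Ioo_subset_Icc_self hy')]
  refine Subtype.ext ((WithLp.ofLp_injective 2) (Prod.ext ?_ ?_))
  · exact eq_zero_of_fourierMode hL fun k => (mode k).1
  · exact eq_zero_of_fourierMode hL fun k => (mode k).2

/-- The test identity behind the regularity of eigenfields: a solution of `u = z S u` is orthogonal
to `(A_S - z̄) v` for each `v` in the domain of `A_S`. Here `A_S v = ν f`. -/
lemma inner_eigenfield {L : ℝ} (hL : 0 < L) {ν : ℝ} (hν : 0 < ν) {z : ℂ} {u v f : solenoidal L}
    (hu : u = z • stokesInverse hL ν u) (hv : (v, (ν : ℂ) • f) ∈ stokesGraph ν L) :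
    z * inner ℂ v u = ν * inner ℂ f u := by
  rw [eq_stokesInverse_of_mem hL hν hv, stokesInverse_symm, Submodule.coe_inner, Submodule.coe_smul,
    inner_smul_left, Complex.conj_ofReal, mul_left_comm, ← inner_smul_right, ← Submodule.coe_smul,
    ← hu, Submodule.coe_inner]

lemma HasZeroTrace.smul {L : ℝ} {u : L2 L} (h : HasZeroTrace L u) (a : ℂ) :
    HasZeroTrace L (a • u) := by
  simpa using h.lin h a 0

lemma integral_mul_sub_const_mul {L : ℝ} {f g h : ℝ → ℂ} (hf : IntegrableOn f (Ioo 0 L))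
    (hg : Continuous g) (hh : Continuous h) (c : ℂ) :
    ∫ y in Ioo 0 L, f y * (g y - c * h y) =
      (∫ y in Ioo 0 L, f y * g y) - c * ∫ y in Ioo 0 L, f y * h y := by
  rw [← integral_const_mul, ← integral_sub (integrableOn_mul_continuous hf hg)
    ((integrableOn_mul_continuous hf hh).const_mul _)]
  refine integral_congr_ae (Eventually.of_forall fun y => ?_)
  ring

/-- The weak form of `(D² - k²)(D² - k² - z / ν) G = 0` for the vertical component of an eigenfield.
-/
lemma integral_snd_eigenfield {L : ℝ} (hL : 0 < L) {ν : ℝ} (hν : 0 < ν) {z : ℂ} {u : solenoidal L}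
    (hu : u = z • stokesInverse hL ν u) {k : ℤ} (hk : k ≠ 0) {η ζ : ℝ → ℂ}
    (hη : IsIntervalTest L η) (h : ζ = fun y => deriv (deriv η) y - (k : ℂ) ^ 2 * η y) :
    z * ∫ y in Ioo 0 L, fourierMode (u : L2Vec L).snd k y * ζ y =
      ν * ∫ y in Ioo 0 L, fourierMode (u : L2Vec L).snd k y * (deriv (deriv ζ) y - k ^ 2 * ζ y) := by
  subst h
  have hk' : (k : ℂ) ≠ 0 := by exact_mod_cast hk
  have e := inner_eigenfield hL hν hu (streamField_mem_stokesGraph (ν := ν) (k := k) hL hη)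
  rw [Submodule.coe_inner, inner_streamField hk, Submodule.coe_inner, inner_streamField hk] at e
  have hc : (2 * π * (-Complex.I / k) : ℂ) ≠ 0 := mul_ne_zero two_pi_ne_zero'
    (div_ne_zero (neg_ne_zero.2 Complex.I_ne_zero) hk')
  exact mul_left_cancel₀ hc (by linear_combination e)

lemma exists_sq_eq (a : ℂ) : ∃ r : ℂ, r ^ 2 = a :=
  IsAlgClosed.exists_pow_nat_eq a two_pos

/-- Profiles of Stokes modes from solutions of the fourth order equation for the second component.
-/
lemma isStokesMode_of_fourth_order {ν L : ℝ} {k : ℤ} (hk : k ≠ 0) {z : ℂ} {G : ℝ → ℂ}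
    (hG : ContDiff ℝ ∞ G) (h : ∀ y, deriv (deriv fun y => deriv (deriv G) y - (k ^ 2 + z / ν) * G y) y
      = k ^ 2 * (deriv (deriv G) y - (k ^ 2 + z / ν) * G y)) (h0 : G 0 = 0) (h0' : deriv G 0 = 0)
    (h1 : G L = 0) (h1' : deriv G L = 0) :
    IsStokesMode ν L k z (fun y => Complex.I / k * deriv G y) G := by
  have hk' : (k : ℂ) ≠ 0 := by exact_mod_cast hk
  have d1 := contDiff_deriv hG
  have d2 := contDiff_deriv d1
  have hg : ContDiff ℝ ∞ fun y => deriv (deriv G) y - (k ^ 2 + z / ν) * G y :=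
    d2.sub (contDiff_const.mul hG)
  have hF : ∀ {f : ℝ → ℂ} (c : ℂ), ContDiff ℝ ∞ f →
      deriv (fun y => c * f y) = fun y => c * deriv f y := fun c hf => by
    funext y
    exact ((hasDerivAt_of_contDiff hf y).const_mul c).deriv
  refine ⟨contDiff_const.mul d1, hG, fun y => ?_, by simp [h0'], by simp [h1'], h0, h1,
    fun y => 1 / k ^ 2 * deriv (fun y => deriv (deriv G) y - (k ^ 2 + z / ν) * G y) y,
    contDiff_const.mul (contDiff_deriv hg), fun y => ?_, fun y => ?_⟩
  · field_simp
    linear_combination deriv G y * Complex.I_sq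
  · rw [hF _ d1, hF _ d2, deriv_sub_const_mul d2 hG]
    field_simp
  · rw [hF _ (contDiff_deriv hg)]
    simp only [h]
    field_simp

/-- The Fourier modes of an eigenfield are smooth and solve the Stokes eigenvalue problem. This
replaces the elliptic regularity of the Stokes operator. -/
lemma exists_isStokesMode {L : ℝ} (hL : 0 < L) {ν : ℝ} (hν : 0 < ν) {z : ℂ} {u : solenoidal L}
    (hu : u = z • stokesInverse hL ν u) (k : ℤ) : ∃ F G, IsStokesMode ν L k z F G ∧
      (∀ᵐ y ∂volume.restrict (Ioo 0 L), fourierMode (u : L2Vec L).fst k y = F y) ∧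
      ∀ᵐ y ∂volume.restrict (Ioo 0 L), fourierMode (u : L2Vec L).snd k y = G y := by
  have hν' : (ν : ℂ) ≠ 0 := Complex.ofReal_ne_zero.2 hν.ne'
  obtain ⟨t1, t2⟩ : HasZeroTrace L (u : L2Vec L).fst ∧ HasZeroTrace L (u : L2Vec L).snd := by
    rw [hu, Submodule.coe_smul, WithLp.smul_fst, WithLp.smul_snd]
    exact ⟨(hasZeroTrace_stokesInverse hL ν u).1.smul z, (hasZeroTrace_stokesInverse hL ν u).2.smul z⟩
  obtain ⟨r, hr⟩ := exists_sq_eq ((k : ℂ) ^ 2 + z / ν)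
  rcases eq_or_ne k 0 with rfl | hk
  · rw [Int.cast_zero] at hr
    obtain ⟨F, hF, hFu, hFeq⟩ := exists_contDiff_of_weak hL
      (integrableOn_fourierMode (u : L2Vec L).fst 0) [r, -r] (h := fun _ => 0) contDiff_const
      (fun η hη => by
        rw [diffOpTranspose_cons_neg _ _ hη.smooth]
        simp only [diffOpTranspose]
        have e := inner_eigenfield hL hν hu (shearField_mem_stokesGraph (ν := ν) hL hη)
        rw [Submodule.coe_inner, inner_shearField, Submodule.coe_inner, inner_shearField] at e
        have i0 := integrableOn_fourierMode (u : L2Vec L).fst 0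
        rw [integral_mul_sub_const_mul i0 hη.deriv.deriv.smooth.continuous hη.smooth.continuous, hr]
        simp only [zero_mul, integral_zero]
        have hp := two_pi_ne_zero'
        have e' : z * (∫ y in Ioo 0 L, fourierMode (u : L2Vec L).fst 0 y * η y) =
            ν * ∫ y in Ioo 0 L, fourierMode (u : L2Vec L).fst 0 y * deriv (deriv η) y :=
          mul_left_cancel₀ hp (by linear_combination e)
        field_simp
        linear_combination -e')
    rw [diffOp_cons_neg _ _ hF] at hFeq
    obtain ⟨h0, h1⟩ := t1.fourierMode_eq_zero hL hF hFu
    refine ⟨F, fun _ => 0, ⟨hF, contDiff_const, by simp, h0, h1, rfl, rfl, fun _ => 0,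
      contDiff_const, fun y => ?_, by simp⟩, hFu, solenoidal_fourierMode_zero u⟩
    have := congrFun hFeq y
    simp only [diffOp] at this
    rw [Int.cast_zero, ← hr, this]
    simp
  · have hk' : (k : ℂ) ≠ 0 := by exact_mod_cast hk
    obtain ⟨G, hG, hGu, hGeq⟩ := exists_contDiff_of_weak hL
      (integrableOn_fourierMode (u : L2Vec L).snd k) [(k : ℂ), -(k : ℂ), r, -r] (h := fun _ => 0)
      contDiff_const (fun η hη => by
        have hζ := hη.laplacian ((k : ℂ) ^ 2)
        rw [diffOpTranspose_cons_neg _ _ hη.smooth, diffOpTranspose_cons_neg _ _ hζ.smooth]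
        simp only [diffOpTranspose]
        have e := integral_snd_eigenfield hL hν hu hk hη rfl
        have i0 := integrableOn_fourierMode (u : L2Vec L).snd k
        rw [integral_mul_sub_const_mul i0 hζ.deriv.deriv.smooth.continuous hζ.smooth.continuous]
          at e ⊢
        rw [hr]
        simp only [zero_mul, integral_zero]
        field_simp
        linear_combination -e)
    rw [diffOp_cons_neg _ _ hG, diffOp_cons_neg _ _ hG, hr] at hGeq
    simp only [diffOp] at hGeq
    obtain ⟨h1, -, -⟩ := solenoidal_fourierMode_of_ne_zero hL u hk hG hGu
    obtain ⟨g0, g1⟩ := t2.fourierMode_eq_zero hL hG hGu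
    obtain ⟨f0, f1⟩ := t1.fourierMode_eq_zero hL (contDiff_const.mul (contDiff_deriv hG)) h1
    have hIk : Complex.I / (k : ℂ) ≠ 0 := div_ne_zero Complex.I_ne_zero hk'
    exact ⟨_, G, isStokesMode_of_fourth_order hk hG
      (fun y => by linear_combination congrFun hGeq y) g0 ((mul_eq_zero.1 f0).resolve_left hIk) g1
      ((mul_eq_zero.1 f1).resolve_left hIk), h1, hGu⟩

lemma integral_mul_conj_self {L : ℝ} {f : ℝ → ℂ} :
    ∫ y in Ioo 0 L, f y * (starRingEnd ℂ) (f y) = ((∫ y in Ioo 0 L, ‖f y‖ ^ 2 : ℝ) : ℂ) := by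
  rw [← integral_complex_ofReal]
  refine integral_congr_ae (Eventually.of_forall fun y => ?_)
  simp [Complex.mul_conj, Complex.normSq_eq_norm_sq]

lemma ae_eq_zero_of_integral_norm_sq {L : ℝ} {f : ℝ → ℂ} (hf : Continuous f)
    (h : ∫ y in Ioo 0 L, ‖f y‖ ^ 2 = 0) : ∀ᵐ y ∂volume.restrict (Ioo 0 L), f y = 0 := by
  have hi : IntegrableOn (fun y => ‖f y‖ ^ 2) (Ioo 0 L) :=
    ((hf.norm.pow 2).continuousOn.integrableOn_compact isCompact_Icc).mono_set Ioo_subset_Icc_self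
  filter_upwards [(integral_eq_zero_iff_of_nonneg (fun y => by positivity) hi).1 h] with y hy
  simpa using hy

/-- An eigenfield that is orthogonal to its own modes vanishes. -/
lemma eq_zero_of_inner_modeField {L : ℝ} (hL : 0 < L) {ν : ℝ} (hν : 0 < ν) {z : ℂ}
    {u : solenoidal L} (hu : u = z • stokesInverse hL ν u)
    (h : ∀ (k : ℤ) (F G : ℝ → ℂ) (hm : IsStokesMode ν L k z F G),
      inner ℂ (modeField L k hm.smooth_fst hm.smooth_snd) (u : L2Vec L) = 0) : u = 0 := by
  have mode : ∀ k : ℤ,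
      (∀ᵐ y ∂volume.restrict (Ioo 0 L), fourierMode (u : L2Vec L).fst k y = 0) ∧
      ∀ᵐ y ∂volume.restrict (Ioo 0 L), fourierMode (u : L2Vec L).snd k y = 0 := by
    intro k
    obtain ⟨F, G, hm, hF, hG⟩ := exists_isStokesMode hL hν hu k
    have e := h k F G hm
    rw [inner_modeField, integral_mul_congr_ae hF, integral_mul_congr_ae hG,
      integral_mul_conj_self, integral_mul_conj_self] at e
    have e' := (mul_eq_zero.1 e).resolve_left two_pi_ne_zero'
    norm_cast at e'
    have p1 : 0 ≤ ∫ y in Ioo 0 L, ‖F y‖ ^ 2 := integral_nonneg fun y => by positivity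
    have p2 : 0 ≤ ∫ y in Ioo 0 L, ‖G y‖ ^ 2 := integral_nonneg fun y => by positivity
    constructor
    · filter_upwards [hF, ae_eq_zero_of_integral_norm_sq hm.smooth_fst.continuous (by linarith)]
        with y h1 h2 using h1.trans h2
    · filter_upwards [hG, ae_eq_zero_of_integral_norm_sq hm.smooth_snd.continuous (by linarith)]
        with y h1 h2 using h1.trans h2
  refine Subtype.ext ((WithLp.ofLp_injective 2) (Prod.ext ?_ ?_))
  · exact eq_zero_of_fourierMode hL fun k => (mode k).1
  · exact eq_zero_of_fourierMode hL fun k => (mode k).2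

/-- The modes of the Stokes operator are complete: by the spectral theorem for `S` it suffices to
consider the projections to the eigenspaces of `S`, which contain the modes. -/
lemma eq_zero_of_forall_isStokesMode {L : ℝ} (hL : 0 < L) {ν : ℝ} (hν : 0 < ν) {d : solenoidal L}
    (h : ∀ (k : ℤ) (z : ℂ) (F G : ℝ → ℂ) (hm : IsStokesMode ν L k z F G),
      inner ℂ (modeField L k hm.smooth_fst hm.smooth_snd) (d : L2Vec L) = 0) : d = 0 := by
  have hsym : ((stokesInverse hL ν : solenoidal L →L[ℂ] solenoidal L) :
      solenoidal L →ₗ[ℂ] solenoidal L).IsSymmetric := stokesInverse_symm hL ν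
  have hb := ContinuousLinearMap.orthogonalComplement_iSup_eigenspaces_eq_bot
    (isCompactOperator_stokesInverse hL ν) hsym
  rw [← Submodule.mem_bot ℂ, ← hb, ← Submodule.iInf_orthogonal, Submodule.mem_iInf]
  intro μ
  rcases eq_or_ne μ 0 with rfl | hμ
  · rw [Submodule.mem_orthogonal]
    intro u hu
    rw [Module.End.mem_eigenspace_iff, zero_smul] at hu
    rw [stokesInverse_injective hL hν hu, inner_zero_left]
  · set E := Module.End.eigenspace ((stokesInverse hL ν : solenoidal L →L[ℂ] solenoidal L) :
      solenoidal L →ₗ[ℂ] solenoidal L) μ with hE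
    have : FiniteDimensional ℂ E := ContinuousLinearMap.finite_dimensional_eigenspace
      (isCompactOperator_stokesInverse hL ν) μ hμ
    rw [← Submodule.starProjection_apply_eq_zero_iff]
    have hp := Module.End.mem_eigenspace_iff.1 (E.starProjection_apply_mem d)
    refine eq_zero_of_inner_modeField hL hν (z := μ⁻¹) (Eq.symm ?_) fun k F G hm => ?_
    · rw [← ContinuousLinearMap.coe_coe, hp, smul_smul, inv_mul_cancel₀ hμ, one_smul]
    · have e := eq_stokesInverse_of_mem hL hν (hm.mem_stokesGraph hν hL)
      set m : solenoidal L := ⟨_, hm.mem_solenoidal hL⟩ with hmdef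
      have hmE : m ∈ E := by
        rw [map_smul] at e
        rw [hE, Module.End.mem_eigenspace_iff, ContinuousLinearMap.coe_coe]
        nth_rw 2 [e]
        rw [smul_smul, mul_inv_cancel₀ hμ, one_smul]
      change inner ℂ m (E.starProjection d) = 0
      rw [← Submodule.inner_starProjection_left_eq_right, Submodule.starProjection_eq_self_iff.2 hmE]
      exact h k _ F G hm

/-- If `y` is in the domain of the adjoint of the Stokes operator, with value `w`, then `y = S w`.
This is the self-adjointness of the Stokes operator; it suffices to test with the modes. -/
lemma eq_stokesInverse_of_forall {L : ℝ} (hL : 0 < L) {ν : ℝ} (hν : 0 < ν) {y w : solenoidal L}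
    (h : ∀ x f, (x, f) ∈ stokesGraph ν L → inner ℂ f y = inner ℂ x w) :
    y = stokesInverse hL ν w := by
  rw [← sub_eq_zero]
  refine eq_zero_of_forall_isStokesMode hL hν fun k z F G hm => ?_
  have hg := hm.mem_stokesGraph hν hL
  have e := h _ _ hg
  have e' := eq_stokesInverse_of_mem hL hν hg
  set m : solenoidal L := ⟨_, hm.mem_solenoidal hL⟩ with hmdef
  change inner ℂ m (y - stokesInverse hL ν w) = 0
  rcases eq_or_ne z 0 with rfl | hz
  · rw [zero_smul, map_zero] at e'
    rw [e', inner_zero_left]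
  · have e2 : inner ℂ m (stokesInverse hL ν w) = inner ℂ m y := by
      have hz' : (starRingEnd ℂ) z ≠ 0 := (map_ne_zero _).2 hz
      rw [← stokesInverse_symm]
      refine mul_left_cancel₀ hz' ?_
      refine (inner_smul_left (𝕜 := ℂ) (stokesInverse hL ν m) w z).symm.trans
        (Eq.trans ?_ (inner_smul_left (𝕜 := ℂ) m y z))
      rw [← map_smul, ← e', e]
    rw [inner_sub_right, e2, sub_self]

/-! ### The dispersion relation -/

lemma deriv_const_mul_eq {f : ℝ → ℂ} (hf : ContDiff ℝ ∞ f) (c : ℂ) :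
    deriv (fun y => c * f y) = fun y => c * deriv f y := by
  funext y
  exact ((hasDerivAt_of_contDiff hf y).const_mul c).deriv

lemma eq_zero_of_second_order {W : ℝ → ℂ} (hW : ContDiff ℝ ∞ W) {c : ℂ}
    (h : ∀ y, deriv (deriv W) y = c * W y) (h0 : W 0 = 0) (h0' : deriv W 0 = 0) : ∀ y, W y = 0 := by
  obtain ⟨r, rfl⟩ := exists_sq_eq c
  refine eq_zero_of_diffOp_eq_zero hW [r, -r] (fun y => ?_) fun n hn => ?_
  · rw [diffOp_cons_neg _ _ hW]
    simp [diffOp, h]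
  · simp only [List.length_cons, List.length_nil] at hn
    interval_cases n <;> simp [diffOp, h0, h0']

lemma eq_zero_of_fourth_order {W : ℝ → ℂ} (hW : ContDiff ℝ ∞ W) {a c : ℂ}
    (h : ∀ y, deriv (deriv fun y => deriv (deriv W) y - a * W y) y =
      c * (deriv (deriv W) y - a * W y)) (h0 : W 0 = 0) (h1 : deriv W 0 = 0)
    (h2 : deriv (deriv W) 0 = 0) (h3 : deriv (deriv (deriv W)) 0 = 0) : ∀ y, W y = 0 := by
  have d2 := contDiff_deriv (contDiff_deriv hW)
  have hg : ContDiff ℝ ∞ fun y => deriv (deriv W) y - a * W y := d2.sub (contDiff_const.mul hW)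
  have e := eq_zero_of_second_order hg h (by simp [h0, h2])
    (by rw [deriv_sub_const_mul d2 hW]; simp [h1, h3])
  exact eq_zero_of_second_order hW (fun y => sub_eq_zero.1 (e y)) h0 h1

/-- The combinations of `cosh (k y)`, `sinh (k y)`, `cos (m y)` and `sin (m y)`. -/
def hypTrig (k m : ℝ) (a b c d : ℂ) (y : ℝ) : ℂ :=
  a * Real.cosh (k * y) + b * Real.sinh (k * y) + c * Real.cos (m * y) + d * Real.sin (m * y)

lemma hasDerivAt_hypTrig (k m : ℝ) (a b c d : ℂ) (y : ℝ) :
    HasDerivAt (hypTrig k m a b c d) (hypTrig k m (k * b) (k * a) (m * d) (-m * c) y) y := by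
  have hk : HasDerivAt (fun y : ℝ => k * y) k y := by simpa using (hasDerivAt_id y).const_mul k
  have hm : HasDerivAt (fun y : ℝ => m * y) m y := by simpa using (hasDerivAt_id y).const_mul m
  have h1 := (hk.cosh.ofReal_comp).const_mul a
  have h2 := (hk.sinh.ofReal_comp).const_mul b
  have h3 := (hm.cos.ofReal_comp).const_mul c
  have h4 := (hm.sin.ofReal_comp).const_mul d
  refine (((h1.add h2).add h3).add h4).congr_deriv ?_
  simp only [hypTrig]
  push_cast
  ring

lemma deriv_hypTrig (k m : ℝ) (a b c d : ℂ) :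
    deriv (hypTrig k m a b c d) = hypTrig k m (k * b) (k * a) (m * d) (-m * c) :=
  funext fun y => (hasDerivAt_hypTrig k m a b c d y).deriv

lemma contDiff_hypTrig (k m : ℝ) (a b c d : ℂ) : ContDiff ℝ ∞ (hypTrig k m a b c d) := by
  have h (f : ℝ → ℝ) (hf : ContDiff ℝ ∞ f) (x : ℂ) : ContDiff ℝ ∞ fun y => x * (f y : ℂ) :=
    contDiff_const.mul (Complex.ofRealCLM.contDiff.comp hf)
  have hk : ContDiff ℝ ∞ fun y : ℝ => k * y := contDiff_const.mul contDiff_id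
  have hm : ContDiff ℝ ∞ fun y : ℝ => m * y := contDiff_const.mul contDiff_id
  exact (((h _ (Real.contDiff_cosh.comp hk) a).add (h _ (Real.contDiff_sinh.comp hk) b)).add
    (h _ (Real.contDiff_cos.comp hm) c)).add (h _ (Real.contDiff_sin.comp hm) d)

lemma hypTrig_zero (k m : ℝ) (a b c d : ℂ) : hypTrig k m a b c d 0 = a + c := by
  simp [hypTrig]

/-- Elimination of the pressure and of the horizontal component: `(D² - k²)(D² - k² - z / ν) G = 0`.
-/
lemma IsStokesMode.fourth_order {ν L : ℝ} {k : ℤ} {z : ℂ} {F G : ℝ → ℂ}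
    (h : IsStokesMode ν L k z F G) (y : ℝ) :
    deriv (deriv fun y => deriv (deriv G) y - (k ^ 2 + z / ν) * G y) y =
      k ^ 2 * (deriv (deriv G) y - (k ^ 2 + z / ν) * G y) := by
  obtain ⟨q, hq, h1, h2⟩ := h.pressure
  have hG := h.smooth_snd
  have d1 := contDiff_deriv hG
  have d2 := contDiff_deriv d1
  have e0 : (fun y => (Complex.I * k) * F y) = fun y => (-1) * deriv G y := by
    funext y
    linear_combination h.div y
  have e1 := congrArg deriv e0
  rw [deriv_const_mul_eq h.smooth_fst, deriv_const_mul_eq d1] at e1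
  have e2 := congrArg deriv e1
  rw [deriv_const_mul_eq (contDiff_deriv h.smooth_fst), deriv_const_mul_eq d2] at e2
  have e3 : deriv (fun y => deriv (deriv G) y - (k ^ 2 + z / ν) * G y) = fun y => k ^ 2 * q y := by
    rw [deriv_sub_const_mul d2 hG]
    funext y
    linear_combination -(Complex.I * k) * h1 y + congrFun e2 y -
      (k ^ 2 + z / ν) * h.div y - (k ^ 2 * q y) * Complex.I_sq
  rw [e3, deriv_const_mul_eq hq, h2]

lemma IsStokesMode.deriv_snd {ν L : ℝ} {k : ℤ} {z : ℂ} {F G : ℝ → ℂ}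
    (h : IsStokesMode ν L k z F G) : deriv G 0 = 0 ∧ deriv G L = 0 := by
  have e0 := h.div 0
  have e1 := h.div L
  rw [h.fst_zero] at e0
  rw [h.fst_length] at e1
  exact ⟨by linear_combination e0, by linear_combination e1⟩

/-- A mode that is not identically zero in the channel. -/
def IsNontrivialOn (L : ℝ) (F G : ℝ → ℂ) : Prop := ∃ y ∈ Ioo 0 L, F y ≠ 0 ∨ G y ≠ 0

lemma IsStokesMode.exists_snd_ne_zero {ν L : ℝ} {k : ℤ} (hk : k ≠ 0) {z : ℂ} {F G : ℝ → ℂ}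
    (h : IsStokesMode ν L k z F G) (hne : IsNontrivialOn L F G) : ∃ y ∈ Ioo 0 L, G y ≠ 0 := by
  have hk' : (k : ℂ) ≠ 0 := by exact_mod_cast hk
  by_contra! hcon
  obtain ⟨y, hy, hF | hG⟩ := hne
  · have : G =ᶠ[𝓝 y] fun _ => 0 := by
      filter_upwards [isOpen_Ioo.mem_nhds hy] with t ht using hcon t ht
    have e := h.div y
    rw [this.deriv_eq, deriv_const, add_zero] at e
    exact hF ((mul_eq_zero.1 e).resolve_left (mul_ne_zero Complex.I_ne_zero hk'))
  · exact hG (hcon y hy)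

/-- The dispersion relation is the determinant of the clamped boundary conditions at `L`; here `C`,
`S`, `c`, `s` stand for `cosh (k L)`, `sinh (k L)`, `cos (m L)`, `sin (m L)`. -/
lemma determinant_identity (k m C S c s : ℝ) (h1 : C ^ 2 - S ^ 2 = 1) (h2 : c ^ 2 + s ^ 2 = 1) :
    (C - c) * (m * k * (C - c)) - (m * S - k * s) * (k * S + m * s) =
      -S * s * m ^ 2 + 2 * k * (1 - C * c) * m + k ^ 2 * S * s := by
  linear_combination m * k * (h1 + h2)

/-- The solution of the fourth order equation with the Cauchy data `0`, `0`, `A (k² + m²)`,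
`B m k (k² + m²)` at `0`. -/
def clampedProfile (k m : ℝ) (A B : ℂ) : ℝ → ℂ := hypTrig k m A (m * B) (-A) (-k * B)

lemma clampedProfile_fourth_order (k m : ℝ) (A B : ℂ) (y : ℝ) :
    deriv (deriv fun y => deriv (deriv (clampedProfile k m A B)) y -
      (-m ^ 2 : ℂ) * clampedProfile k m A B y) y =
      k ^ 2 * (deriv (deriv (clampedProfile k m A B)) y - (-m ^ 2) * clampedProfile k m A B y) := by
  have h := contDiff_hypTrig k m A (m * B) (-A) (-k * B)
  have d1 := contDiff_deriv h
  have d2 := contDiff_deriv d1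
  simp only [clampedProfile]
  rw [deriv_sub_const_mul d2 h, deriv_sub_const_mul (contDiff_deriv d2) d1]
  simp only [deriv_hypTrig, hypTrig]
  ring

/-- The two boundary conditions at `0` leave a two-parameter family of solutions. -/
lemma eq_clampedProfile {k m : ℝ} (hk : k ≠ 0) (hm : 0 < m) {G : ℝ → ℂ} (hG : ContDiff ℝ ∞ G)
    (h : ∀ y, deriv (deriv fun y => deriv (deriv G) y - (-m ^ 2 : ℂ) * G y) y =
      k ^ 2 * (deriv (deriv G) y - (-m ^ 2) * G y)) (h0 : G 0 = 0) (h0' : deriv G 0 = 0) :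
    ∃ A B : ℂ, G = clampedProfile k m A B := by
  set A : ℂ := deriv (deriv G) 0 / ((k ^ 2 + m ^ 2 : ℝ) : ℂ) with hA
  set B : ℂ := deriv (deriv (deriv G)) 0 / ((m * k * (k ^ 2 + m ^ 2) : ℝ) : ℂ) with hB
  have n1 : ((k ^ 2 + m ^ 2 : ℝ) : ℂ) ≠ 0 := Complex.ofReal_ne_zero.2 (by positivity)
  have n2 : ((m * k * (k ^ 2 + m ^ 2) : ℝ) : ℂ) ≠ 0 := Complex.ofReal_ne_zero.2
    (mul_ne_zero (mul_ne_zero hm.ne' hk) (by positivity))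
  have eA : deriv (deriv G) 0 = A * ((k ^ 2 + m ^ 2 : ℝ) : ℂ) := by rw [hA, div_mul_cancel₀ _ n1]
  have eB : deriv (deriv (deriv G)) 0 = B * ((m * k * (k ^ 2 + m ^ 2) : ℝ) : ℂ) := by
    rw [hB, div_mul_cancel₀ _ n2]
  push_cast at eA eB
  refine ⟨A, B, ?_⟩
  have hH := contDiff_hypTrig k m A (m * B) (-A) (-k * B)
  have fH := clampedProfile_fourth_order k m A B
  simp only [clampedProfile] at fH ⊢
  set H := hypTrig k m A (m * B) (-A) (-k * B) with hHdef
  have g1 := contDiff_deriv hG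
  have g2 := contDiff_deriv g1
  have k1 := contDiff_deriv hH
  have k2 := contDiff_deriv k1
  have w1 : deriv (fun y => G y - 1 * H y) = fun y => deriv G y - 1 * deriv H y :=
    deriv_sub_const_mul hG hH 1
  have w2 : deriv (deriv (fun y => G y - 1 * H y)) =
      fun y => deriv (deriv G) y - 1 * deriv (deriv H) y := by
    rw [w1, deriv_sub_const_mul g1 k1]
  have w3 : deriv (deriv (deriv (fun y => G y - 1 * H y))) =
      fun y => deriv (deriv (deriv G)) y - 1 * deriv (deriv (deriv H)) y := by
    rw [w2, deriv_sub_const_mul g2 k2]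
  have hz := eq_zero_of_fourth_order (W := fun y => G y - 1 * H y)
    (hG.sub (contDiff_const.mul hH)) (a := -m ^ 2) (c := k ^ 2) (fun y => ?_) ?_ ?_ ?_ ?_
  · funext y
    linear_combination hz y
  · have e : (fun y => deriv (deriv fun y => G y - 1 * H y) y - (-m ^ 2 : ℂ) * (G y - 1 * H y)) =
        fun y => (deriv (deriv G) y - (-m ^ 2 : ℂ) * G y) -
          1 * (deriv (deriv H) y - (-m ^ 2 : ℂ) * H y) := by
      rw [w2]
      funext y
      ring
    have p : ContDiff ℝ ∞ fun y => deriv (deriv G) y - (-m ^ 2 : ℂ) * G y :=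
      g2.sub (contDiff_const.mul hG)
    have p' : ContDiff ℝ ∞ fun y => deriv (deriv H) y - (-m ^ 2 : ℂ) * H y :=
      k2.sub (contDiff_const.mul hH)
    rw [e, deriv_sub_const_mul p p', deriv_sub_const_mul (contDiff_deriv p) (contDiff_deriv p'), w2]
    simp only [h, fH]
    ring
  · simp only [h0, hHdef, hypTrig_zero]
    ring
  · rw [w1]
    simp only [h0', hHdef, deriv_hypTrig, hypTrig_zero]
    ring
  · rw [w2]
    simp only [eA, hHdef, deriv_hypTrig, hypTrig_zero]
    ring
  · rw [w3]
    simp only [eB, hHdef, deriv_hypTrig, hypTrig_zero]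
    ring

lemma clampedProfile_boundary {k m L : ℝ} {A B : ℂ} :
    (clampedProfile k m A B L = A * ((Real.cosh (k * L) - Real.cos (m * L) : ℝ) : ℂ) +
      B * ((m * Real.sinh (k * L) - k * Real.sin (m * L) : ℝ) : ℂ)) ∧
    deriv (clampedProfile k m A B) L =
      A * ((k * Real.sinh (k * L) + m * Real.sin (m * L) : ℝ) : ℂ) +
      B * ((m * k * (Real.cosh (k * L) - Real.cos (m * L)) : ℝ) : ℂ) := by
  simp only [clampedProfile, deriv_hypTrig]
  simp only [hypTrig]
  push_cast
  constructor <;> ring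

lemma IsStokesMode.snd_eq_zero {ν L : ℝ} {z : ℂ} {F G : ℝ → ℂ} (h : IsStokesMode ν L 0 z F G)
    (y : ℝ) : G y = 0 := by
  rw [← h.snd_zero]
  refine is_const_of_deriv_eq_zero (h.smooth_snd.differentiable (by simp)) (fun t => ?_) y 0
  simpa using h.div t

/-- The dispersion relation holds for the nontrivial modes with real `z`: the energy method excludes
`k² + z / ν ≥ 0`, and for `k² + z / ν = -m²` a nontrivial solution makes the determinant vanish. -/
lemma IsStokesMode.mem_stokesModeSet {ν L : ℝ} (hL : 0 < L) {k : ℤ} {z : ℝ} {F G : ℝ → ℂ}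
    (h : IsStokesMode ν L k z F G) (hne : IsNontrivialOn L F G) : z ∈ stokesModeSet ν L k := by
  have hsq : ∀ a : ℝ, a < 0 → ∃ m : ℝ, 0 < m ∧ a = -m ^ 2 := fun a ha =>
    ⟨√(-a), Real.sqrt_pos.2 (by linarith), by rw [Real.sq_sqrt (by linarith)]; ring⟩
  rcases eq_or_ne k 0 with rfl | hk
  · obtain ⟨q, -, h1, -⟩ := h.pressure
    have hF := h.smooth_fst
    have hne' : ∃ y ∈ Ioo 0 L, F y ≠ 0 := by
      obtain ⟨y, hy, h' | h'⟩ := hne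
      · exact ⟨y, hy, h'⟩
      · exact absurd (h.snd_eq_zero y) h'
    have e : ∀ y, deriv (deriv F) y = ((z / ν : ℝ) : ℂ) * F y := fun y => by
      have := h1 y
      push_cast at this ⊢
      linear_combination this
    have ha : z / ν < 0 := by
      by_contra! hcon
      obtain ⟨y, hy, hy'⟩ := hne'
      exact hy' (eq_zero_of_deriv_deriv_eq hL hF hcon e h.fst_zero h.fst_length y
        (Ioo_subset_Icc_self hy))
    obtain ⟨m, hm, hma⟩ := hsq _ ha
    refine ⟨m, hm, by rw [← hma]; simp, ?_⟩
    rw [stokesDispersion, if_pos rfl]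
    have hm' : (m : ℂ) ≠ 0 := Complex.ofReal_ne_zero.2 hm.ne'
    have hH := contDiff_hypTrig 0 m 0 0 0 (deriv F 0 / m)
    have hz := eq_zero_of_second_order (W := fun y => F y - 1 * hypTrig 0 m 0 0 0 (deriv F 0 / m) y)
      (hF.sub (contDiff_const.mul hH)) (c := ((z / ν : ℝ) : ℂ)) (fun y => by
        rw [deriv_sub_const_mul hF hH, deriv_sub_const_mul (contDiff_deriv hF) (contDiff_deriv hH),
          deriv_hypTrig, deriv_hypTrig]
        simp only [e, hma, hypTrig]
        push_cast
        ring) (by simp [h.fst_zero, hypTrig_zero])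
        (by
          rw [deriv_sub_const_mul hF hH, deriv_hypTrig]
          simp only [hypTrig_zero]
          field_simp
          simp)
    have hrep : ∀ y, F y = deriv F 0 / m * (Real.sin (m * y) : ℂ) := fun y => by
      have := hz y
      simp only [hypTrig] at this
      linear_combination this
    have hl := hrep L
    rw [h.fst_length] at hl
    rcases mul_eq_zero.1 hl.symm with h0 | h0
    · obtain ⟨y, hy, hy'⟩ := hne'
      exact absurd (by rw [hrep y, h0, zero_mul]) hy'
    · exact_mod_cast h0
  · have hk' : (k : ℝ) ≠ 0 := by exact_mod_cast hk
    obtain ⟨y, hy, hGy⟩ := h.exists_snd_ne_zero hk hne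
    have hG := h.smooth_snd
    have d1 := contDiff_deriv hG
    have d2 := contDiff_deriv d1
    have e := h.fourth_order
    have ec : ((k : ℂ) ^ 2 + (z : ℂ) / ν) = (((k : ℝ) ^ 2 + z / ν : ℝ) : ℂ) := by push_cast; rfl
    rw [ec] at e
    have ha : (k : ℝ) ^ 2 + z / ν < 0 := by
      by_contra! hcon
      refine hGy (eq_zero_of_clamped hL hG hk' hcon (fun t => ?_) h.snd_zero h.deriv_snd.1
        h.snd_length h.deriv_snd.2 y (Ioo_subset_Icc_self hy))
      have := e t
      rw [deriv_sub_const_mul d2 hG, deriv_sub_const_mul (contDiff_deriv d2) d1] at this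
      push_cast at this ⊢
      linear_combination this
    obtain ⟨m, hm, hma⟩ := hsq _ ha
    refine ⟨m, hm, hma, ?_⟩
    rw [stokesDispersion, if_neg hk]
    rw [hma] at e
    obtain ⟨A, B, hAB⟩ := eq_clampedProfile hk' hm hG (fun t => by
      have := e t
      push_cast at this ⊢
      exact this) h.snd_zero h.deriv_snd.1
    obtain ⟨b1, b2⟩ := clampedProfile_boundary (k := (k : ℝ)) (m := m) (L := L) (A := A) (B := B)
    rw [← hAB, h.snd_length] at b1
    rw [← hAB, h.deriv_snd.2] at b2
    have det := determinant_identity k m _ _ _ _ (Real.cosh_sq_sub_sinh_sq (k * L))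
      (Real.cos_sq_add_sin_sq (m * L))
    rw [← det]
    by_contra hD
    rw [← Complex.ofReal_inj.not, Complex.ofReal_zero] at hD
    set p₁₁ := Real.cosh (k * L) - Real.cos (m * L)
    set p₁₂ := m * Real.sinh (k * L) - k * Real.sin (m * L)
    set p₂₁ := k * Real.sinh (k * L) + m * Real.sin (m * L)
    push_cast at b1 b2 hD
    have hA : A = 0 := (mul_eq_zero.1 (show (p₁₁ * (m * k * p₁₁) - p₁₂ * p₂₁ : ℂ) * A = 0 by
      linear_combination (-m * k * p₁₁ : ℂ) * b1 + (p₁₂ : ℂ) * b2)).resolve_left hD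
    have hB : B = 0 := (mul_eq_zero.1 (show (p₁₁ * (m * k * p₁₁) - p₁₂ * p₂₁ : ℂ) * B = 0 by
      linear_combination (p₂₁ : ℂ) * b1 - (p₁₁ : ℂ) * b2)).resolve_left hD
    refine hGy ?_
    rw [hAB, hA, hB]
    simp [clampedProfile, hypTrig]

lemma eq_zero_left_of_forall_Ioo {L : ℝ} (hL : 0 < L) {f : ℝ → ℂ} (hf : Continuous f)
    (h : ∀ y ∈ Ioo 0 L, f y = 0) : f 0 = 0 := by
  have : EqOn f (fun _ => 0) (closure (Ioo 0 L)) :=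
    EqOn.closure (fun y hy => h y hy) hf continuous_const
  exact this (by rw [closure_Ioo hL.ne]; exact ⟨le_rfl, hL.le⟩)

/-- Each solution of the dispersion relation belongs to a nontrivial mode. -/
lemma exists_isStokesMode_of_mem {ν L : ℝ} (hL : 0 < L) {k : ℤ} {z : ℝ}
    (h : z ∈ stokesModeSet ν L k) :
    ∃ F G, IsStokesMode ν L k z F G ∧ IsNontrivialOn L F G := by
  obtain ⟨m, hm, hz, hd⟩ := h
  have hz' : (k : ℂ) ^ 2 + (z : ℂ) / ν = -m ^ 2 := by exact_mod_cast congrArg ((↑) : ℝ → ℂ) hz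
  rcases eq_or_ne k 0 with rfl | hk
  · rw [stokesDispersion, if_pos rfl] at hd
    refine ⟨hypTrig 0 m 0 0 0 1, fun _ => 0, ⟨contDiff_hypTrig _ _ _ _ _ _, contDiff_const, by simp,
      by simp [hypTrig], by simp [hypTrig, hd], rfl, rfl, fun _ => 0, contDiff_const, fun y => ?_,
      by simp⟩, ?_⟩
    · rw [hz']
      simp only [deriv_hypTrig]
      simp only [hypTrig]
      push_cast
      ring
    · -- at a quarter of the wave length, or at the middle if that lies beyond the channel
      refine ⟨min (π / (2 * m)) (L / 2), ⟨by positivity, (min_le_right _ _).trans_lt (by linarith)⟩,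
        Or.inl ?_⟩
      have hs : 0 < Real.sin (m * min (π / (2 * m)) (L / 2)) := by
        refine Real.sin_pos_of_pos_of_lt_pi (by positivity) ?_
        calc m * min (π / (2 * m)) (L / 2) ≤ m * (π / (2 * m)) := by gcongr; exact min_le_left _ _
          _ = π / 2 := by field_simp
          _ < π := by linarith [pi_pos]
      simpa [hypTrig] using Complex.ofReal_ne_zero.2 hs.ne'
  · have hk' : (k : ℝ) ≠ 0 := by exact_mod_cast hk
    rw [stokesDispersion, if_neg hk] at hd
    have det := determinant_identity k m _ _ _ _ (Real.cosh_sq_sub_sinh_sq (k * L))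
      (Real.cos_sq_add_sin_sq (m * L))
    rw [hd] at det
    have hpos : 0 < Real.cosh (k * L) - Real.cos (m * L) := by
      have := Real.one_lt_cosh.2 (mul_ne_zero hk' hL.ne')
      linarith [Real.cos_le_one (m * L)]
    obtain ⟨b1, b2⟩ := clampedProfile_boundary (k := (k : ℝ)) (m := m) (L := L)
      (A := ((m * Real.sinh (k * L) - k * Real.sin (m * L) : ℝ) : ℂ))
      (B := ((-(Real.cosh (k * L) - Real.cos (m * L)) : ℝ) : ℂ))
    set A : ℝ := m * Real.sinh (k * L) - k * Real.sin (m * L) with hA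
    set B : ℝ := -(Real.cosh (k * L) - Real.cos (m * L)) with hB
    have hG := contDiff_hypTrig k m A (m * B) (-A) (-k * B)
    refine ⟨_, clampedProfile k m A B, isStokesMode_of_fourth_order hk hG (fun y => ?_) ?_ ?_ ?_ ?_, ?_⟩
    · rw [hz']
      have := clampedProfile_fourth_order k m A B y
      push_cast at this
      exact this
    · simp [clampedProfile, hypTrig_zero]
    · simp only [clampedProfile, deriv_hypTrig, hypTrig_zero]
      ring
    · refine b1.trans ?_
      rw [hB]
      push_cast
      ring
    · refine b2.trans ?_
      norm_cast
      rw [hB]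
      linear_combination -det
    · have h3 : deriv (deriv (deriv (clampedProfile k m A B))) 0 ≠ 0 := by
        have hne : m * k * B * ((k : ℝ) ^ 2 + m ^ 2) ≠ 0 :=
          mul_ne_zero (mul_ne_zero (mul_ne_zero hm.ne' hk') (neg_ne_zero.2 hpos.ne')) (by positivity)
        intro h0
        simp only [clampedProfile, deriv_hypTrig, hypTrig_zero] at h0
        refine hne (Complex.ofReal_injective ?_)
        push_cast at h0 ⊢
        linear_combination h0
      by_contra hcon
      have hzero : ∀ y ∈ Ioo 0 L, clampedProfile k m A B y = 0 := fun y hy => by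
        by_contra hy'
        exact hcon ⟨y, hy, Or.inr hy'⟩
      refine h3 (eq_zero_left_of_forall_Ioo hL
        (contDiff_deriv (contDiff_deriv (contDiff_deriv hG))).continuous fun y hy => ?_)
      have step : ∀ f : ℝ → ℂ, (∀ y ∈ Ioo 0 L, f y = 0) → ∀ y ∈ Ioo 0 L, deriv f y = 0 := by
        intro f hf y hy
        have : f =ᶠ[𝓝 y] fun _ => 0 := by
          filter_upwards [isOpen_Ioo.mem_nhds hy] with t ht using hf t ht
        rw [this.deriv_eq, deriv_const]
      exact step _ (step _ (step _ hzero)) y hy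

/-! ### Infinitely many solutions of the dispersion relation -/

/-- The left-hand side of the dispersion relation, multiplied by `k` so that the coefficient
`k sinh (k L)` of the leading term is positive. -/
def dispersionFun (L k m : ℝ) : ℝ :=
  k * (-sinh (k * L) * sin (m * L) * m ^ 2 + 2 * k * (1 - cosh (k * L) * cos (m * L)) * m
      + k ^ 2 * sinh (k * L) * sin (m * L))

/-- The values at the zeros of `cos (m L)`, where `sin (m L)` alternates. -/
lemma dispersionFun_eq {L : ℝ} (hL : 0 < L) (k : ℝ) (n : ℕ) :
    dispersionFun L k ((π / 2 + n * π) / L) =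
      k * sinh (k * L) * (-1) ^ n * (k ^ 2 - ((π / 2 + n * π) / L) ^ 2) +
        2 * k ^ 2 * ((π / 2 + n * π) / L) := by
  have e : (π / 2 + n * π) / L * L = π / 2 + n * π := div_mul_cancel₀ _ hL.ne'
  rw [dispersionFun, e, Real.sin_add_nat_mul_pi, Real.cos_add_nat_mul_pi, Real.sin_pi_div_two,
    Real.cos_pi_div_two]
  ring

/-- The dispersion function changes sign between consecutive points at which `cos (m L) = 0`, once
the leading term dominates. -/
lemma exists_dispersion_root {L : ℝ} (hL : 0 < L) {k : ℝ} (hk : k ≠ 0) (R : ℝ) :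
    ∃ m > R, 0 < m ∧ dispersionFun L k m = 0 := by
  have hS : 0 < k * sinh (k * L) := by
    rcases hk.lt_or_gt with h | h
    · exact mul_pos_of_neg_of_neg h (Real.sinh_neg_iff.2 (mul_neg_of_neg_of_pos h hL))
    · exact mul_pos h (Real.sinh_pos_iff.2 (mul_pos h hL))
  set T := k * sinh (k * L) with hT
  set f : ℕ → ℝ := fun n => (π / 2 + n * π) / L with hf
  -- beyond `k² + 1 + 2 k² / T` the leading term of the dispersion relation dominates
  obtain ⟨n, hn⟩ : ∃ n : ℕ, max R (k ^ 2 + 1 + 2 * k ^ 2 / T) < f n := by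
    have h1 : Tendsto f atTop atTop := by
      refine Tendsto.atTop_div_const hL (tendsto_atTop_add_const_left _ _ ?_)
      exact tendsto_natCast_atTop_atTop.atTop_mul_const pi_pos
    exact (h1.eventually_gt_atTop _).exists
  have hmono : f n ≤ f (n + 1) := by
    simp only [hf]
    gcongr
    simp
  have hpos : 0 < k ^ 2 + 1 + 2 * k ^ 2 / T := by positivity
  have hdom : ∀ m, k ^ 2 + 1 + 2 * k ^ 2 / T < m → 2 * k ^ 2 * m < T * (m ^ 2 - k ^ 2) := by
    intro m hm
    have h1 : 2 * k ^ 2 < T * (m - k ^ 2 - 1) := by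
      have : 2 * k ^ 2 / T < m - k ^ 2 - 1 := by linarith
      rw [div_lt_iff₀ hS] at this
      linarith
    have hm1 : 1 < m := by
      have : 0 ≤ 2 * k ^ 2 / T := by positivity
      nlinarith [sq_nonneg k]
    have h2 : m * (m - k ^ 2 - 1) ≤ m ^ 2 - k ^ 2 := by nlinarith [sq_nonneg k]
    nlinarith [mul_lt_mul_of_pos_right h1 (by linarith : 0 < m), mul_le_mul_of_nonneg_left h2 hS.le]
  have hn1 := (le_max_left _ _).trans_lt hn
  have hn2 := (le_max_right _ _).trans_lt hn
  have e1 := dispersionFun_eq hL k n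
  have e2 := dispersionFun_eq hL k (n + 1)
  have d1 := hdom _ hn2
  have d2 := hdom _ (hn2.trans_le hmono)
  have cont : Continuous (dispersionFun L k) := by
    unfold dispersionFun
    fun_prop
  have hfn : 0 < f n := hpos.trans hn2
  have hfn' : 0 < f (n + 1) := hfn.trans_le hmono
  have hk2 : 0 < k ^ 2 := by positivity
  obtain ⟨m, hm, hm0⟩ : ∃ m ∈ Icc (f n) (f (n + 1)), dispersionFun L k m = 0 := by
    rcases Nat.even_or_odd n with h | h
    · rw [h.neg_one_pow] at e1
      rw [h.add_one.neg_one_pow] at e2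
      exact intermediate_value_Icc hmono cont.continuousOn
        ⟨by rw [e1]; nlinarith, by rw [e2]; nlinarith⟩
    · rw [h.neg_one_pow] at e1
      rw [h.add_one.neg_one_pow] at e2
      exact intermediate_value_Icc' hmono cont.continuousOn
        ⟨by rw [e2]; nlinarith, by rw [e1]; nlinarith⟩
  exact ⟨m, hn1.trans_le hm.1, hfn.trans_le hm.1, hm0⟩

lemma exists_stokesDispersion {L : ℝ} (hL : 0 < L) (k : ℤ) (R : ℝ) :
    ∃ m > R, 0 < m ∧ stokesDispersion L k m := by
  rcases eq_or_ne k 0 with rfl | hk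
  · obtain ⟨n, hn⟩ := exists_nat_gt (max R 0 / (π / L))
    have hpL : 0 < π / L := by positivity
    rw [div_lt_iff₀ hpL] at hn
    refine ⟨n * (π / L), (le_max_left _ _).trans_lt hn, (le_max_right _ _).trans_lt hn, ?_⟩
    rw [stokesDispersion, if_pos rfl, mul_assoc, div_mul_cancel₀ _ hL.ne', Real.sin_nat_mul_pi]
  · have hk' : (k : ℝ) ≠ 0 := by exact_mod_cast hk
    obtain ⟨m, h1, h2, h3⟩ := exists_dispersion_root hL hk' R
    refine ⟨m, h1, h2, ?_⟩
    rw [stokesDispersion, if_neg hk]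
    exact (mul_eq_zero.1 h3).resolve_left hk'

lemma infinite_stokesModeSet {ν L : ℝ} (hν : 0 < ν) (hL : 0 < L) (k : ℤ) :
    (stokesModeSet ν L k).Infinite := by
  refine Set.infinite_of_forall_exists_lt fun R => ?_
  obtain ⟨m, h1, h2, h3⟩ := exists_stokesDispersion hL k (|R| / ν + 1)
  refine ⟨-ν * (k ^ 2 + m ^ 2), ⟨m, h2, by field_simp; ring, h3⟩, ?_⟩
  have h4 : |R| / ν < m ^ 2 := by
    have : 0 ≤ |R| / ν := by positivity
    nlinarith
  rw [div_lt_iff₀ hν] at h4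
  nlinarith [neg_abs_le R, sq_nonneg (k : ℝ)]

/-! ### Unbounded operators with compact inverse -/

section CompactInverse

variable {E : Type*} [NormedAddCommGroup E] [NormedSpace ℂ E] {T : E →ₗ.[ℂ] E} {B : E →L[ℂ] E}

lemma mem_eigenspace_iff_mem_graph {z : ℂ} {x : E} : x ∈ eigenspace T z ↔ (x, z • x) ∈ T.graph := by
  rw [mem_eigenspace, LinearPMap.mem_graph_iff]
  constructor
  · rintro ⟨h, e⟩
    exact ⟨⟨x, h⟩, rfl, e⟩
  · rintro ⟨⟨y, h⟩, rfl, e⟩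
    exact ⟨h, e⟩

/-- `(T - z) x = w` in terms of the inverse `B` of `T`. -/
lemma mem_rootSpace_succ (hB : ∀ x y, (x, y) ∈ T.graph ↔ x = B y) {z : ℂ} {n : ℕ} {x : E} :
    x ∈ rootSpace T z (n + 1) ↔ ∃ w ∈ rootSpace T z n, x = B (w + z • x) := by
  simp only [rootSpace, Submodule.mem_map, Submodule.mem_comap]
  constructor
  · rintro ⟨y, hy, rfl⟩
    refine ⟨_, hy, (hB _ _).1 ?_⟩
    rw [LinearPMap.mem_graph_iff]
    exact ⟨y, rfl, by simp⟩
  · rintro ⟨w, hw, e⟩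
    obtain ⟨y, hy, e'⟩ := (LinearPMap.mem_graph_iff T).1 ((hB _ _).2 e)
    refine ⟨y, ?_, hy⟩
    have : (T.toFun - z • T.domain.subtype) y = w := by
      change T y - z • (y : E) = w
      simp only at hy e'
      rw [e', hy, add_sub_cancel_right]
    rwa [this]

/-- The Fredholm alternative for `1 - z B`. -/
lemma exists_inverse_of_compact [CompleteSpace E] (hc : IsCompactOperator B) {z : ℂ}
    (hz : ∀ x, x = z • B x → x = 0) :
    ∃ R : E →L[ℂ] E, ∀ x, R (x - z • B x) = x ∧ R x - z • B (R x) = x := by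
  rcases eq_or_ne z 0 with rfl | hz0
  · exact ⟨ContinuousLinearMap.id ℂ E, by simp⟩
  have hne : ¬ Module.End.HasEigenvalue (B : Module.End ℂ E) z⁻¹ := by
    intro h
    obtain ⟨v, hv⟩ := h.exists_hasEigenvector
    have e := hv.apply_eq_smul
    refine hv.2 (hz v ?_)
    rw [ContinuousLinearMap.coe_coe] at e
    rw [e, smul_smul, mul_inv_cancel₀ hz0, one_smul]
  have hr := (hc.hasEigenvalue_or_mem_resolventSet (inv_ne_zero hz0)).resolve_left hne
  obtain ⟨u, hu⟩ := spectrum.mem_resolventSet_iff.1 hr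
  have h1 : ∀ x, (↑u : E →L[ℂ] E) x = z⁻¹ • (x - z • B x) := fun x => by
    rw [hu, smul_sub, smul_smul, inv_mul_cancel₀ hz0, one_smul]
    simp [Algebra.algebraMap_eq_smul_one]
  have h2 : ∀ x, (↑u⁻¹ : E →L[ℂ] E) ((↑u : E →L[ℂ] E) x) = x := fun x => by
    rw [← mul_apply_eq_comp, u.inv_mul, one_apply_eq_self]
  have h3 : ∀ x, (↑u : E →L[ℂ] E) ((↑u⁻¹ : E →L[ℂ] E) x) = x := fun x => by
    rw [← mul_apply_eq_comp, u.mul_inv, one_apply_eq_self]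
  refine ⟨z⁻¹ • (↑u⁻¹ : E →L[ℂ] E), fun x => ⟨?_, ?_⟩⟩
  · rw [smul_apply, ← map_smul, ← h1, h2]
  · have := h1 ((z⁻¹ • (↑u⁻¹ : E →L[ℂ] E)) x)
    rw [smul_apply, map_smul, h3] at this
    exact (smul_right_injective E (inv_ne_zero hz0) this).symm

/-- The spectrum of an operator `T` with compact inverse `B` consists of its eigenvalues; the
resolvent is `-(1 - z B)⁻¹ B`. -/
lemma mem_unboundedSpectrum_iff [CompleteSpace E] (hB : ∀ x y, (x, y) ∈ T.graph ↔ x = B y)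
    (hc : IsCompactOperator B) {z : ℂ} :
    z ∈ unboundedSpectrum T ↔ ∃ x, x ≠ 0 ∧ x = z • B x := by
  have hval : ∀ {y : E} (h : B y ∈ T.domain), T ⟨B y, h⟩ = y := fun {y} h => by
    obtain ⟨⟨w, hw⟩, hw', e⟩ := (LinearPMap.mem_graph_iff T).1 ((hB (B y) y).2 rfl)
    simp only at hw' e
    subst hw'
    exact e
  have hdom : ∀ y, B y ∈ T.domain := fun y => LinearPMap.mem_domain_of_mem_graph ((hB _ _).2 rfl)
  have hinv : ∀ y : T.domain, B (T y) = y := fun y => ((hB _ _).1 (T.mem_graph y)).symm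
  rw [unboundedSpectrum, mem_ofPred_eq, not_iff_comm]
  constructor
  · intro hcon
    push Not at hcon
    obtain ⟨R, hR⟩ := exists_inverse_of_compact hc (z := z) fun x hx => by
      by_contra h
      exact hcon x h hx
    have e : ∀ x, -R (B x) = B (-(x + z • R (B x))) := fun x => by
      have := (hR (B x)).2
      rw [map_neg, map_add, map_smul]
      nth_rw 2 [← this]
      simp
    refine ⟨-(R ∘L B), fun x => ?_, fun y => ?_⟩
    · have h : (-(R ∘L B)) x = B (-(x + z • R (B x))) := e x
      have h' : (-(R ∘L B)) x ∈ T.domain := by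
        rw [h]
        exact hdom _
      refine ⟨h', ?_⟩
      have : T ⟨(-(R ∘L B)) x, h'⟩ = -(x + z • R (B x)) := by
        simp only [h]
        exact hval _
      rw [this]
      simp
    · change -R (B (z • (y : E) - T y)) = y
      rw [map_sub, map_smul, hinv, ← map_neg, neg_sub, (hR _).1]
  · rintro ⟨R, h1, h2⟩ ⟨x, hx, e⟩
    have hd : x ∈ T.domain := by
      rw [e]
      exact T.domain.smul_mem z (hdom x)
    have hT : T ⟨x, hd⟩ = z • x := by
      have : (x, z • x) ∈ T.graph := (hB _ _).2 (by rwa [map_smul])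
      obtain ⟨⟨w, hw⟩, hw', e⟩ := (LinearPMap.mem_graph_iff T).1 this
      simp only at hw' e
      subst hw'
      exact e
    have := h2 ⟨x, hd⟩
    rw [hT, sub_self, map_zero] at this
    exact hx this.symm

end CompactInverse

section CompactSymmetric

variable {H : Type*} [NormedAddCommGroup H] [InnerProductSpace ℂ H] {K : H →L[ℂ] H}

lemma hasEigenvalue_inv {z : ℂ} {x : H} (hx : x ≠ 0) (h : x = z • K x) :
    z ≠ 0 ∧ Module.End.HasEigenvalue (K : Module.End ℂ H) z⁻¹ := by
  have hz : z ≠ 0 := by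
    rintro rfl
    exact hx (by simpa using h)
  refine ⟨hz, Module.End.hasEigenvalue_of_hasEigenvector (x := x) ⟨?_, hx⟩⟩
  rw [Module.End.mem_eigenspace_iff, ContinuousLinearMap.coe_coe]
  nth_rw 2 [h]
  rw [smul_smul, inv_mul_cancel₀ hz, one_smul]

lemma im_eq_zero_of_symm (hK : ∀ x y, inner ℂ (K x) y = inner ℂ x (K y)) {z : ℂ} {x : H}
    (hx : x ≠ 0) (h : x = z • K x) : z.im = 0 := by
  have hs : (K : H →ₗ[ℂ] H).IsSymmetric := hK
  have e := hs.conj_eigenvalue_eq_self (hasEigenvalue_inv hx h).2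
  rw [map_inv₀, inv_inj] at e
  exact Complex.conj_eq_iff_im.1 e

/-- The eigenvalues of a compact symmetric operator accumulate only at zero; in terms of the inverse
operator, there are finitely many eigenvalues in each disc. -/
lemma finite_inverse_eigenvalues (hc : IsCompactOperator K)
    (hK : ∀ x y, inner ℂ (K x) y = inner ℂ x (K y)) (R : ℝ) :
    {z : ℂ | ‖z‖ ≤ R ∧ ∃ x, x ≠ 0 ∧ x = z • K x}.Finite := by
  by_contra hinf
  have hs : (K : H →ₗ[ℂ] H).IsSymmetric := hK
  let z := Set.Infinite.natEmbedding _ hinf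
  have hz : ∀ n, ∃ v : H, ‖v‖ = 1 ∧ v = (z n : ℂ) • K v := by
    intro n
    obtain ⟨x, hx, e⟩ := (z n).2.2
    refine ⟨(‖x‖⁻¹ : ℂ) • x, norm_smul_inv_norm hx, ?_⟩
    rw [map_smul, smul_comm, ← e]
  choose v hv1 hv2 using hz
  have horth : ∀ i j, i ≠ j → inner ℂ (v i) (v j) = 0 := by
    intro i j hij
    have hne : ∀ n, v n ≠ 0 := fun n => norm_ne_zero_iff.1 (by simp [hv1])
    have hzn : ∀ n, (z n : ℂ) ≠ 0 := fun n => (hasEigenvalue_inv (hne n) (hv2 n)).1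
    have hmem : ∀ n, v n ∈ Module.End.eigenspace (K : Module.End ℂ H) (z n : ℂ)⁻¹ := fun n => by
      rw [Module.End.mem_eigenspace_iff, ContinuousLinearMap.coe_coe]
      nth_rw 2 [hv2 n]
      rw [smul_smul, inv_mul_cancel₀ (hzn n), one_smul]
    have hd : (z i : ℂ)⁻¹ ≠ (z j : ℂ)⁻¹ := fun h =>
      hij (z.injective (Subtype.ext (inv_injective h)))
    exact hs.orthogonalFamily_eigenspaces hd ⟨v i, hmem i⟩ ⟨v j, hmem j⟩
  obtain ⟨C, hC, hC'⟩ := hc.image_closedBall_subset_compact (f := (K : H →ₗ[ℂ] H)) 1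
  obtain ⟨y, -, φ, hφ, hφy⟩ := hC.tendsto_subseq (x := fun n => K (v n))
    fun n => hC' ⟨v n, by simp [hv1], rfl⟩
  have hcau := Metric.cauchySeq_iff'.1 hφy.cauchySeq
  obtain ⟨N, hN⟩ := hcau (|R| + 1)⁻¹ (by positivity)
  have h1 := hN (N + 1) (Nat.le_succ N)
  rw [dist_eq_norm] at h1
  simp only [Function.comp_apply] at h1
  set i := φ (N + 1)
  set j := φ N
  have hij : i ≠ j := fun h => by simpa using hφ.injective h
  -- testing `K v_i - K v_j` against `v_i` bounds it below by the modulus of the eigenvalue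
  have h2 : (z i : ℂ) * inner ℂ (v i) (K (v i) - K (v j)) = 1 := by
    have h3 : inner ℂ (v i) (K (v j)) = 0 := by
      have e := horth i j hij
      have hne : v j ≠ 0 := norm_ne_zero_iff.1 (by simp [hv1])
      rw [hv2 j, inner_smul_right] at e
      exact (mul_eq_zero.1 e).resolve_left (hasEigenvalue_inv hne (hv2 j)).1
    rw [inner_sub_right, h3, sub_zero, ← inner_smul_right, ← hv2, inner_self_eq_norm_sq_to_K, hv1]
    simp
  have h3 : (1 : ℝ) ≤ ‖(z i : ℂ)‖ * ‖K (v i) - K (v j)‖ := by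
    calc (1 : ℝ) = ‖(z i : ℂ)‖ * ‖inner ℂ (v i) (K (v i) - K (v j))‖ := by
          rw [← norm_mul, h2, norm_one]
      _ ≤ _ := by
          gcongr
          exact (norm_inner_le_norm _ _).trans (by rw [hv1, one_mul])
  have h4 : ‖(z i : ℂ)‖ ≤ |R| := (z i).2.1.trans (le_abs_self R)
  have h5 : (|R| + 1) * (|R| + 1)⁻¹ = 1 := mul_inv_cancel₀ (by positivity)
  have h6 : 0 < (|R| + 1)⁻¹ := by positivity
  nlinarith [mul_le_mul h4 h1.le (norm_nonneg _) (abs_nonneg R)]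

end CompactSymmetric

/-! ### Eigenvalues of the Stokes operator and of the Dirichlet Laplacian -/

lemma eq_zero_of_sepL2_eq_zero {L : ℝ} {k : ℤ} {f : ℝ → ℂ} (hf : ContDiff ℝ ∞ f)
    (h : sepL2 L k hf = 0) : ∀ y ∈ Ioo 0 L, f y = 0 := by
  have e := inner_separated (L := L) k k hf.continuous hf.continuous
  rw [if_pos rfl, integral_mul_conj_self] at e
  have h0 : inner ℂ (sepL2 L k hf) (sepL2 L k hf) = 0 := by rw [h, inner_zero_left]
  have e' := (mul_eq_zero.1 (e.symm.trans h0)).resolve_left two_pi_ne_zero'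
  have hae := ae_eq_zero_of_integral_norm_sq hf.continuous (Complex.ofReal_eq_zero.1 e')
  exact Measure.eqOn_open_of_ae_eq hae isOpen_Ioo hf.continuous.continuousOn continuousOn_const

lemma modeField_ne_zero {L : ℝ} {k : ℤ} {f g : ℝ → ℂ} (hf : ContDiff ℝ ∞ f)
    (hg : ContDiff ℝ ∞ g) (hne : IsNontrivialOn L f g) : modeField L k hf hg ≠ 0 := by
  intro h
  obtain ⟨y, hy, h' | h'⟩ := hne
  · exact h' (eq_zero_of_sepL2_eq_zero hf (congrArg WithLp.fst h) y hy)
  · exact h' (eq_zero_of_sepL2_eq_zero hg (congrArg WithLp.snd h) y hy)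

/-- The dispersion relation characterizes the `z` for which `1 - z S` has a kernel. -/
lemma mem_SpS_iff {L : ℝ} (hL : 0 < L) {ν : ℝ} (hν : 0 < ν) {z : ℂ} :
    z ∈ SpS ν L ↔ ∃ u, u ≠ 0 ∧ u = z • stokesInverse hL ν u := by
  constructor
  · intro h
    obtain ⟨k, r, hr, rfl⟩ := mem_iUnion.1 h
    obtain ⟨F, G, hm, hne⟩ := exists_isStokesMode_of_mem hL hr
    refine ⟨⟨_, hm.mem_solenoidal hL⟩, fun h0 => ?_, ?_⟩
    · exact modeField_ne_zero hm.smooth_fst hm.smooth_snd hne (congrArg Subtype.val h0)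
    · rw [← map_smul]
      exact eq_stokesInverse_of_mem hL hν (hm.mem_stokesGraph hν hL)
  · rintro ⟨u, hu, e⟩
    have him := im_eq_zero_of_symm (stokesInverse_symm hL ν) hu e
    obtain ⟨r, rfl⟩ : ∃ r : ℝ, (r : ℂ) = z := ⟨z.re, Complex.ext rfl (by simp [him])⟩
    have : ∃ k F G, IsStokesMode ν L k (r : ℂ) F G ∧ IsNontrivialOn L F G := by
      by_contra! hcon
      refine hu (eq_zero_of_inner_modeField hL hν e fun k F G hm => ?_)
      have hn := hcon k F G hm
      rw [IsNontrivialOn] at hn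
      push Not at hn
      rw [inner_modeField, integral_eq_zero_of_ae, integral_eq_zero_of_ae]
      · simp
      all_goals
        filter_upwards [ae_restrict_mem measurableSet_Ioo] with y hy
        simp [hn y hy]
    obtain ⟨k, F, G, hm, hne⟩ := this
    exact mem_iUnion.2 ⟨k, r, hm.mem_stokesModeSet hL hne, rfl⟩

lemma SpS_eq_eigenvalues {L : ℝ} (hL : 0 < L) {ν : ℝ} (hν : 0 < ν) :
    SpS ν L = {z | IsEigenvalue (stokesOperator ν L) z} := by
  ext z
  rw [mem_ofPred_eq, IsEigenvalue, Submodule.ne_bot_iff]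
  constructor
  · intro h
    obtain ⟨k, r, hr, rfl⟩ := mem_iUnion.1 h
    obtain ⟨F, G, hm, hne⟩ := exists_isStokesMode_of_mem hL hr
    refine ⟨⟨_, hm.mem_solenoidal hL⟩, ?_, fun h0 => ?_⟩
    · rw [mem_eigenspace_iff_mem_graph, stokesOperator_graph]
      exact hm.mem_stokesGraph hν hL
    · exact modeField_ne_zero hm.smooth_fst hm.smooth_snd hne (congrArg Subtype.val h0)
  · rintro ⟨u, hu, hne⟩
    rw [mem_eigenspace_iff_mem_graph, stokesOperator_graph] at hu
    refine (mem_SpS_iff hL hν).2 ⟨u, hne, ?_⟩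
    rw [← map_smul]
    exact eq_stokesInverse_of_mem hL hν hu

lemma exists_enumeration {L : ℝ} (hL : 0 < L) {ν : ℝ} (hν : 0 < ν) (k : ℤ) :
    ∃ lam : ℕ → ℝ, Function.Injective lam ∧ Set.range lam = stokesModeSet ν L k := by
  have hinf := infinite_stokesModeSet hν hL k
  have hfin : ∀ n : ℕ, {r : ℝ | r ∈ stokesModeSet ν L k ∧ |r| ≤ n}.Finite := fun n => by
    refine Set.Finite.of_finite_image ((finite_inverse_eigenvalues
      (isCompactOperator_stokesInverse hL ν) (stokesInverse_symm hL ν) n).subset ?_)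
      Complex.ofReal_injective.injOn
    rintro - ⟨r, ⟨hr, hrn⟩, rfl⟩
    exact ⟨by simpa using hrn, (mem_SpS_iff hL hν).1 (mem_iUnion.2 ⟨k, r, hr, rfl⟩)⟩
  have hcount : (stokesModeSet ν L k).Countable := by
    refine (Set.countable_iUnion fun n => (hfin n).countable).mono fun r hr => ?_
    obtain ⟨n, hn⟩ := exists_nat_ge |r|
    exact mem_iUnion.2 ⟨n, hr, hn⟩
  have := hinf.to_subtype
  have := hcount.to_subtype
  obtain ⟨e⟩ := nonempty_equiv_of_countable (α := ℕ) (β := stokesModeSet ν L k)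
  refine ⟨fun n => e n, Subtype.val_injective.comp e.injective, ?_⟩
  rw [show (fun n => (e n : ℝ)) = Subtype.val ∘ e from rfl, e.surjective.range_comp, Subtype.range_val]

lemma dirichletValue_succ (α L : ℝ) (p : ℤ × ℕ) :
    dirichletValue α L p.1 (p.2 + 1) = ((-α * symbol L p : ℝ) : ℂ) := by
  rw [dirichletValue, symbol, freq]
  congr 1
  push_cast
  ring

lemma inner_sinMode_dirichletInverse {L : ℝ} (hL : 0 < L) (α : ℝ) (p : ℤ × ℕ) (x : L2 L) :
    inner ℂ (sinMode L p) (dirichletInverse hL α x) =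
      -(α : ℂ)⁻¹ * ((symbol L p)⁻¹ : ℝ) * inner ℂ (sinMode L p) x := by
  rw [dirichletInverse_apply, inner_smul_right, inner_dirichletRoot_twice, mul_assoc]

/-- The solutions of `ξ = z T ξ` have Fourier coefficients only at the indices that belong to `z`.
-/
lemma eq_smul_dirichletInverse_iff {L : ℝ} (hL : 0 < L) {α : ℝ} (hα : 0 < α) {z : ℂ} {ξ : L2 L} :
    ξ = z • dirichletInverse hL α ξ ↔
      ∀ p, inner ℂ (sinMode L p) ξ ≠ 0 → z = dirichletValue α L p.1 (p.2 + 1) := by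
  have hα' : (α : ℂ) ≠ 0 := Complex.ofReal_ne_zero.2 hα.ne'
  have key : ∀ p, inner ℂ (sinMode L p) ξ = inner ℂ (sinMode L p) (z • dirichletInverse hL α ξ) ↔
      (inner ℂ (sinMode L p) ξ ≠ 0 → z = dirichletValue α L p.1 (p.2 + 1)) := by
    intro p
    have hs : ((symbol L p : ℝ) : ℂ) ≠ 0 := Complex.ofReal_ne_zero.2 (symbol_pos hL p).ne'
    rw [inner_smul_right, inner_sinMode_dirichletInverse, dirichletValue_succ]
    push_cast
    generalize inner ℂ (sinMode L p) ξ = c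
    constructor
    · intro h hc
      field_simp at h
      linear_combination h
    · intro h
      rcases eq_or_ne c 0 with rfl | hc
      · simp
      · rw [h hc]
        field_simp
  constructor
  · intro h p
    rw [← key p, ← h]
  · intro h
    exact eq_of_inner_sinMode hL fun p => (key p).2 (h p)

lemma inner_sinMode_sinMode {L : ℝ} (hL : 0 < L) (p q : ℤ × ℕ) :
    inner ℂ (sinMode L p) (sinMode L q) = if p = q then 1 else 0 :=
  orthonormal_iff_ite.1 (orthonormal_sinMode hL) p q

lemma sinMode_eq_smul {L : ℝ} (hL : 0 < L) {α : ℝ} (hα : 0 < α) (p : ℤ × ℕ) :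
    sinMode L p = dirichletValue α L p.1 (p.2 + 1) • dirichletInverse hL α (sinMode L p) := by
  rw [eq_smul_dirichletInverse_iff hL hα]
  intro q hq
  rw [inner_sinMode_sinMode hL] at hq
  have : q = p := by
    by_contra h
    exact hq (if_neg h)
  rw [this]

lemma mem_SpL_iff {L : ℝ} (hL : 0 < L) {α : ℝ} (hα : 0 < α) {z : ℂ} :
    z ∈ SpL α L ↔ ∃ ξ, ξ ≠ 0 ∧ ξ = z • dirichletInverse hL α ξ := by
  constructor
  · rintro ⟨k, j, hj, rfl⟩
    obtain ⟨i, rfl⟩ := Nat.exists_eq_add_of_le' hj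
    exact ⟨sinMode L (k, i), (orthonormal_sinMode hL).ne_zero _, sinMode_eq_smul hL hα (k, i)⟩
  · rintro ⟨ξ, hne, h⟩
    rw [eq_smul_dirichletInverse_iff hL hα] at h
    obtain ⟨p, hp⟩ : ∃ p, inner ℂ (sinMode L p) ξ ≠ 0 := by
      by_contra! hcon
      exact hne (eq_zero_of_inner_sinMode_eq_zero hL hcon)
    exact ⟨p.1, p.2 + 1, by lia, h p hp⟩

lemma dirichletMode_succ {L : ℝ} (hL : 0 < L) (k : ℤ) (j : ℕ) :
    dirichletMode L k (j + 1) = ((√(π * L) : ℝ) : ℂ) • WithLp.toLp 2 (0, sinMode L (k, j)) := by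
  have hs : ((√(π * L) : ℝ) : ℂ) ≠ 0 :=
    Complex.ofReal_ne_zero.2 (Real.sqrt_pos.2 (by positivity)).ne'
  refine (WithLp.ofLp_injective 2) (Prod.ext ?_ ?_)
  · exact (smul_zero (A := solenoidal L) ((√(π * L) : ℝ) : ℂ)).symm
  · change contL2 L (continuous_dirichletFun L k (j + 1)) =
      ((√(π * L) : ℝ) : ℂ) • sepL2 L k (contDiff_sinProfile L j)
    rw [← sepL2_smul]
    refine contL2_congr ?_
    funext x
    simp only [dirichletFun, separated, sinProfile, freq]
    push_cast
    field_simp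

/-! ### The adjoint of the linearized Boussinesq operator -/

lemma inner_coupling {L : ℝ} (θ : L2 L) (ψ : solenoidal L) :
    inner ℂ (coupling L θ) ψ = inner ℂ θ (ψ : L2Vec L).snd := by
  rw [coupling, leray, Submodule.inner_orthogonalProjectionOnto_eq_of_mem_right,
    WithLp.prod_inner_apply]
  change inner ℂ (0 : L2 L) (ψ : L2Vec L).fst + inner ℂ θ (ψ : L2Vec L).snd = _
  rw [inner_zero_left, zero_add]

/-- The inverse of `A*`: the solution of `A* (ψ, ξ) = (f, g)` is `ψ = S f`, `ξ = T (g - ψ₂)`, where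
`S = stokesInverse` and `T = dirichletInverse`. -/
def adjointInverse {L : ℝ} (hL : 0 < L) (ν α : ℝ) : StateSpace L →L[ℂ] StateSpace L :=
  ((WithLp.prodContinuousLinearEquiv 2 ℂ (solenoidal L) (L2 L)).symm : _ →L[ℂ] StateSpace L) ∘L
    (ContinuousLinearMap.inl ℂ (solenoidal L) (L2 L) ∘L
        (stokesInverse hL ν ∘L WithLp.fstL 2 ℂ (solenoidal L) (L2 L)) +
      ContinuousLinearMap.inr ℂ (solenoidal L) (L2 L) ∘L (dirichletInverse hL α ∘L
        (WithLp.sndL 2 ℂ (solenoidal L) (L2 L) - (WithLp.sndL 2 ℂ (L2 L) (L2 L) ∘L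
          (solenoidal L).subtypeL) ∘L stokesInverse hL ν ∘L WithLp.fstL 2 ℂ (solenoidal L) (L2 L))))

lemma adjointInverse_fst {L : ℝ} (hL : 0 < L) (ν α : ℝ) (Φ : StateSpace L) :
    (adjointInverse hL ν α Φ).fst = stokesInverse hL ν Φ.fst := by
  simp [adjointInverse]

lemma adjointInverse_snd {L : ℝ} (hL : 0 < L) (ν α : ℝ) (Φ : StateSpace L) :
    (adjointInverse hL ν α Φ).snd =
      dirichletInverse hL α (Φ.snd - (stokesInverse hL ν Φ.fst : L2Vec L).snd) := by
  simp [adjointInverse]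

lemma isCompactOperator_adjointInverse {L : ℝ} (hL : 0 < L) (ν α : ℝ) :
    IsCompactOperator (adjointInverse hL ν α) := by
  have h1 := ((isCompactOperator_stokesInverse hL ν).comp_clm
    (WithLp.fstL 2 ℂ (solenoidal L) (L2 L))).clm_comp
      (ContinuousLinearMap.inl ℂ (solenoidal L) (L2 L))
  have h2 := ((isCompactOperator_dirichletInverse hL α).comp_clm
    (WithLp.sndL 2 ℂ (solenoidal L) (L2 L) - (WithLp.sndL 2 ℂ (L2 L) (L2 L) ∘L
      (solenoidal L).subtypeL) ∘L stokesInverse hL ν ∘L WithLp.fstL 2 ℂ (solenoidal L) (L2 L))).clm_comp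
      (ContinuousLinearMap.inr ℂ (solenoidal L) (L2 L))
  exact (h1.add h2).clm_comp
    ((WithLp.prodContinuousLinearEquiv 2 ℂ (solenoidal L) (L2 L)).symm : _ →L[ℂ] StateSpace L)

lemma state_ext {L : ℝ} {Φ Ψ : StateSpace L} (h1 : Φ.fst = Ψ.fst) (h2 : Φ.snd = Ψ.snd) : Φ = Ψ :=
  (WithLp.ofLp_injective 2) (Prod.ext h1 h2)

lemma inner_state {L : ℝ} (Φ Ψ : StateSpace L) :
    inner ℂ Φ Ψ = inner ℂ Φ.fst Ψ.fst + inner ℂ Φ.snd Ψ.snd :=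
  WithLp.prod_inner_apply Φ Ψ

lemma inner_toLp {L : ℝ} (x : solenoidal L) (θ : L2 L) (Φ : StateSpace L) :
    inner ℂ (WithLp.toLp 2 (x, θ)) Φ = inner ℂ x Φ.fst + inner ℂ θ Φ.snd :=
  inner_state _ _

lemma mem_boussinesqGraph_of_stokes {ν α L : ℝ} {x f : solenoidal L}
    (h : (x, f) ∈ stokesGraph ν L) :
    ((WithLp.toLp 2 (x, 0), WithLp.toLp 2 (f, 0)) : StateSpace L × StateSpace L) ∈
      boussinesqGraph ν α L := by
  refine ⟨⟨f, h, ?_⟩, zero_mem (dirichletGraph α L)⟩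
  have e := coupling_lin (0 : L2 L) 0 0 0
  simp only [smul_zero, add_zero, zero_smul] at e
  change f = f + coupling L 0
  rw [e, add_zero]

lemma mem_boussinesqGraph_of_dirichlet {ν α L : ℝ} {θ g : L2 L} (h : (θ, g) ∈ dirichletGraph α L) :
    ((WithLp.toLp 2 (0, θ), WithLp.toLp 2 (coupling L θ, g)) : StateSpace L × StateSpace L) ∈
      boussinesqGraph ν α L :=
  ⟨⟨0, zero_mem (stokesGraph ν L), (zero_add _).symm⟩, h⟩

/-- A vector orthogonal to the domain lies in the kernels of `S` and `T`, which are trivial. -/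
lemma dense_boussinesqOperator {ν α L : ℝ} (hν : 0 < ν) (hα : 0 < α) (hL : 0 < L) :
    Dense ((boussinesqOperator ν α L).domain : Set (StateSpace L)) := by
  rw [Submodule.dense_iff_topologicalClosure_eq_top, Submodule.topologicalClosure_eq_top_iff,
    Submodule.eq_bot_iff]
  intro Φ hΦ
  rw [Submodule.mem_orthogonal] at hΦ
  have hd : ∀ {x y : StateSpace L}, (x, y) ∈ boussinesqGraph ν α L → inner ℂ x Φ = 0 := by
    intro x y h
    rw [← boussinesqOperator_graph] at h
    exact hΦ x (LinearPMap.mem_domain_of_mem_graph h)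
  refine state_ext ?_ ?_
  · refine stokesInverse_injective hL hν
      (eq_stokesInverse_of_forall hL hν (y := 0) fun x f h => ?_).symm
    have e := hd (mem_boussinesqGraph_of_stokes h)
    rw [inner_toLp, inner_zero_left, add_zero] at e
    rw [inner_zero_right, e]
  · refine dirichletInverse_injective hL hα ?_
    have e := hd (mem_boussinesqGraph_of_dirichlet
      ((mem_dirichletGraph_iff hL hα (g := dirichletInverse hL α Φ.snd)).2 rfl))
    rwa [inner_toLp, inner_zero_left, zero_add, dirichletInverse_symm, inner_self_eq_zero] at e

/-- The graph of `A*`. Testing with `(x, 0)` and `(0, θ)` decouples the two components; for the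
first one this uses the self-adjointness of the Stokes operator. -/
lemma mem_boussinesqAdjoint_graph_iff {ν α L : ℝ} (hν : 0 < ν) (hα : 0 < α) (hL : 0 < L)
    (Φ Ψ : StateSpace L) : (Φ, Ψ) ∈ (boussinesqAdjoint ν α L).graph ↔ Φ = adjointInverse hL ν α Ψ := by
  rw [boussinesqAdjoint, LinearPMap.adjoint_graph_eq_graph_adjoint (dense_boussinesqOperator hν hα hL),
    Submodule.mem_adjoint_iff, boussinesqOperator_graph]
  constructor
  · intro h
    have h1 : Φ.fst = stokesInverse hL ν Ψ.fst := by
      refine eq_stokesInverse_of_forall hL hν fun x f hx => ?_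
      have e := h _ _ (mem_boussinesqGraph_of_stokes hx)
      rw [inner_toLp, inner_toLp, inner_zero_left, inner_zero_left, add_zero, add_zero] at e
      exact sub_eq_zero.1 e
    refine state_ext (by rw [h1, adjointInverse_fst]) ?_
    rw [adjointInverse_snd, ← h1]
    refine ext_inner_left ℂ fun g => ?_
    have e := h _ _ (mem_boussinesqGraph_of_dirichlet ((mem_dirichletGraph_iff hL hα (g := g)).2 rfl))
    rw [inner_toLp, inner_toLp, inner_zero_left, zero_add, inner_coupling] at e
    rw [← dirichletInverse_symm, inner_sub_right]
    linear_combination e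
  · rintro rfl Φ' Ψ' ⟨⟨f, h1, h2⟩, h3⟩
    have e1 := eq_stokesInverse_of_mem hL hν h1
    have e2 := (mem_dirichletGraph_iff hL hα).1 h3
    simp only at e1 e2 h2
    rw [inner_state, inner_state, h2, adjointInverse_fst, adjointInverse_snd, inner_add_left, inner_coupling,
      ← dirichletInverse_symm, ← e2, ← stokesInverse_symm, ← e1, inner_sub_right]
    ring

/-! ### The spectrum of the adjoint -/

section Adjoint

variable {ν α L : ℝ}

lemma mem_eigenspace_adjoint_iff (hν : 0 < ν) (hα : 0 < α) (hL : 0 < L) {z : ℂ}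
    {Φ : StateSpace L} : Φ ∈ eigenspace (boussinesqAdjoint ν α L) z ↔
      Φ.fst = z • stokesInverse hL ν Φ.fst ∧
        Φ.snd = dirichletInverse hL α (z • Φ.snd - (Φ.fst : L2Vec L).snd) := by
  rw [mem_eigenspace_iff_mem_graph, mem_boussinesqAdjoint_graph_iff hν hα hL]
  have h1 : (adjointInverse hL ν α (z • Φ)).fst = z • stokesInverse hL ν Φ.fst := by
    rw [adjointInverse_fst, WithLp.smul_fst, map_smul]
  have h2 : (adjointInverse hL ν α (z • Φ)).snd = dirichletInverse hL α
      (z • Φ.snd - ((z • stokesInverse hL ν Φ.fst : solenoidal L) : L2Vec L).snd) := by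
    rw [adjointInverse_snd, WithLp.smul_fst, map_smul, WithLp.smul_snd]
  constructor
  · intro h
    have e1 := (congrArg WithLp.fst h).trans h1
    have e2 := (congrArg WithLp.snd h).trans h2
    rw [← e1] at e2
    exact ⟨e1, e2⟩
  · rintro ⟨e1, e2⟩
    refine state_ext (e1.trans h1.symm) ?_
    rw [h2, ← e1, ← e2]

lemma mem_spectrum_adjoint_iff (hν : 0 < ν) (hα : 0 < α) (hL : 0 < L) {z : ℂ} :
    z ∈ unboundedSpectrum (boussinesqAdjoint ν α L) ↔
      IsEigenvalue (boussinesqAdjoint ν α L) z := by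
  rw [mem_unboundedSpectrum_iff (mem_boussinesqAdjoint_graph_iff hν hα hL)
    (isCompactOperator_adjointInverse hL ν α), IsEigenvalue, Submodule.ne_bot_iff]
  refine exists_congr fun Φ => ?_
  rw [mem_eigenspace_iff_mem_graph, mem_boussinesqAdjoint_graph_iff hν hα hL, map_smul, and_comm]

lemma mem_eigenspace_adjoint_of_fst_eq_zero (hν : 0 < ν) (hα : 0 < α) (hL : 0 < L) {z : ℂ}
    {Φ : StateSpace L} (h : Φ.fst = 0) : Φ ∈ eigenspace (boussinesqAdjoint ν α L) z ↔
      Φ.snd = z • dirichletInverse hL α Φ.snd := by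
  rw [mem_eigenspace_adjoint_iff hν hα hL, h]
  simp

/-- The spectrum of `A*` is the union of those of the Stokes operator and the Dirichlet Laplacian.
-/
lemma spectrum_adjoint (hν : 0 < ν) (hα : 0 < α) (hL : 0 < L) :
    unboundedSpectrum (boussinesqAdjoint ν α L) = SpS ν L ∪ SpL α L := by
  ext z
  rw [mem_spectrum_adjoint_iff hν hα hL, mem_union, mem_SpS_iff hL hν, mem_SpL_iff hL hα,
    IsEigenvalue, Submodule.ne_bot_iff]
  constructor
  · rintro ⟨Φ, h, hne⟩
    by_cases h0 : Φ.fst = 0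
    · rw [mem_eigenspace_adjoint_of_fst_eq_zero hν hα hL h0] at h
      exact Or.inr ⟨Φ.snd, fun h' => hne (state_ext h0 h'), h⟩
    · exact Or.inl ⟨Φ.fst, h0, ((mem_eigenspace_adjoint_iff hν hα hL).1 h).1⟩
  · intro h
    by_cases hT : ∃ ξ, ξ ≠ 0 ∧ ξ = z • dirichletInverse hL α ξ
    · obtain ⟨ξ, hne, e⟩ := hT
      refine ⟨WithLp.toLp 2 (0, ξ), ?_, fun h' => hne (congrArg WithLp.snd h')⟩
      rw [mem_eigenspace_adjoint_of_fst_eq_zero hν hα hL rfl]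
      exact e
    · -- off the Dirichlet part the equation for the temperature component can be solved
      obtain ⟨ψ, hne, e⟩ := h.resolve_right hT
      obtain ⟨R, hR⟩ := exists_inverse_of_compact (isCompactOperator_dirichletInverse hL α) (z := z)
        fun ξ hξ => by
          by_contra hξ0
          exact hT ⟨ξ, hξ0, hξ⟩
      refine ⟨WithLp.toLp 2 (ψ, R (-dirichletInverse hL α (ψ : L2Vec L).snd)), ?_,
        fun h' => hne (congrArg WithLp.fst h')⟩
      rw [mem_eigenspace_adjoint_iff hν hα hL]
      refine ⟨e, ?_⟩
      have := (hR (-dirichletInverse hL α (ψ : L2Vec L).snd)).2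
      simp only [WithLp.toLp_fst, WithLp.toLp_snd]
      rw [map_sub, map_smul]
      exact (sub_eq_iff_eq_add.1 this).trans (neg_add_eq_sub _ _)

lemma im_eq_zero_of_mem_SpS_union {z : ℂ} (h : z ∈ SpS ν L ∪ SpL α L) : z.im = 0 := by
  rcases h with h | ⟨k, j, -, rfl⟩
  · obtain ⟨k, r, -, rfl⟩ := mem_iUnion.1 h
    exact Complex.ofReal_im r
  · exact Complex.ofReal_im _

lemma finite_spectrum_inter (hν : 0 < ν) (hα : 0 < α) (hL : 0 < L) (R : ℝ) :
    {z | z ∈ SpS ν L ∪ SpL α L ∧ ‖z‖ ≤ R}.Finite := by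
  refine ((finite_inverse_eigenvalues (isCompactOperator_stokesInverse hL ν)
    (stokesInverse_symm hL ν) R).union (finite_inverse_eigenvalues
      (isCompactOperator_dirichletInverse hL α) (dirichletInverse_symm hL α) R)).subset ?_
  rintro z ⟨h | h, hR⟩
  · exact Or.inl ⟨hR, (mem_SpS_iff hL hν).1 h⟩
  · exact Or.inr ⟨hR, (mem_SpL_iff hL hα).1 h⟩

lemma exists_isolating_ball (hν : 0 < ν) (hα : 0 < α) (hL : 0 < L) {z : ℂ}
    (hz : z ∈ SpS ν L ∪ SpL α L) :
    ∃ ε > 0, Metric.ball z ε ∩ (SpS ν L ∪ SpL α L) = {z} := by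
  have hfin := (finite_spectrum_inter hν hα hL (‖z‖ + 1)).subset (sdiff_subset (t := {z}))
  have hnhds : ({w | w ∈ SpS ν L ∪ SpL α L ∧ ‖w‖ ≤ ‖z‖ + 1} \ {z})ᶜ ∈ 𝓝 z :=
    hfin.isClosed.isOpen_compl.mem_nhds fun h => h.2 rfl
  obtain ⟨ε, hε, hsub⟩ := Metric.mem_nhds_iff.1 hnhds
  refine ⟨min ε 1, lt_min hε one_pos, ?_⟩
  ext w
  constructor
  · rintro ⟨hw, hw'⟩
    by_contra hne
    refine hsub (Metric.ball_subset_ball (min_le_left _ _) hw) ⟨⟨hw', ?_⟩, hne⟩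
    have h1 : ‖w - z‖ < 1 := by
      rw [← dist_eq_norm]
      exact (Metric.mem_ball.1 hw).trans_le (min_le_right _ _)
    have h2 : ‖w‖ ≤ ‖w - z‖ + ‖z‖ := by simpa using norm_add_le (w - z) z
    linarith
  · rintro rfl
    exact ⟨Metric.mem_ball_self (lt_min hε one_pos), hz⟩

/-- A symmetric operator has no Jordan chains: if `w` is in the kernel of `1 - z K` and `K w` in its
range, then `w = 0`. -/
lemma eq_zero_of_smul_symm {H : Type*} [NormedAddCommGroup H] [InnerProductSpace ℂ H]
    {K : H →L[ℂ] H} (hK : ∀ x y, inner ℂ (K x) y = inner ℂ x (K y)) {z : ℂ} (hz : z.im = 0)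
    {x w : H} (hw : w = z • K w) (hx : x - z • K x = K w) : w = 0 := by
  have hc : (starRingEnd ℂ) z = z := Complex.conj_eq_iff_im.2 hz
  have h1 : inner ℂ (x - z • K x) w = 0 := by
    rw [inner_sub_left, inner_smul_left, hc, hK, ← inner_smul_right, ← hw, sub_self]
  rw [hx] at h1
  rw [← inner_self_eq_zero (𝕜 := ℂ)]
  nth_rw 1 [hw]
  rw [inner_smul_left, h1, mul_zero]

/-- The velocity component of a root vector lies in `ker (1 - z S)`. -/
lemma fst_of_mem_rootSpace (hν : 0 < ν) (hα : 0 < α) (hL : 0 < L) {z : ℂ} (hz : z.im = 0) (n : ℕ) :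
    ∀ Φ ∈ rootSpace (boussinesqAdjoint ν α L) z n, Φ.fst = z • stokesInverse hL ν Φ.fst := by
  induction n with
  | zero =>
    intro Φ h
    rw [(Submodule.mem_bot ℂ).1 h]
    change (0 : solenoidal L) = z • stokesInverse hL ν 0
    simp
  | succ n ih =>
    intro Φ h
    obtain ⟨w, hw, e⟩ := (mem_rootSpace_succ (mem_boussinesqAdjoint_graph_iff hν hα hL)).1 h
    have e1 : Φ.fst = stokesInverse hL ν (w.fst + z • Φ.fst) := by
      rw [← WithLp.smul_fst, ← WithLp.add_fst, ← adjointInverse_fst hL ν α, ← e]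
    rw [map_add, map_smul] at e1
    have h0 := eq_zero_of_smul_symm (stokesInverse_symm hL ν) hz (ih w hw)
      (sub_eq_iff_eq_add.2 e1)
    rw [h0, map_zero, zero_add] at e1
    exact e1

/-- The temperature component of a root vector without velocity lies in `ker (1 - z T)`. -/
lemma snd_of_mem_rootSpace (hν : 0 < ν) (hα : 0 < α) (hL : 0 < L) {z : ℂ} (hz : z.im = 0) (n : ℕ) :
    ∀ Φ ∈ rootSpace (boussinesqAdjoint ν α L) z n, Φ.fst = 0 →
      Φ.snd = z • dirichletInverse hL α Φ.snd := by
  induction n with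
  | zero =>
    intro Φ h _
    rw [(Submodule.mem_bot ℂ).1 h]
    change (0 : L2 L) = z • dirichletInverse hL α 0
    simp
  | succ n ih =>
    intro Φ h hΦ
    obtain ⟨w, hw, e⟩ := (mem_rootSpace_succ (mem_boussinesqAdjoint_graph_iff hν hα hL)).1 h
    have e1 : Φ.fst = stokesInverse hL ν (w.fst + z • Φ.fst) := by
      rw [← WithLp.smul_fst, ← WithLp.add_fst, ← adjointInverse_fst hL ν α, ← e]
    have e2 : Φ.snd = dirichletInverse hL α ((w.snd + z • Φ.snd) -
        (stokesInverse hL ν (w.fst + z • Φ.fst) : L2Vec L).snd) := by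
      rw [← WithLp.smul_fst, ← WithLp.add_fst, ← WithLp.smul_snd, ← WithLp.add_snd,
        ← adjointInverse_snd hL ν α, ← e]
    rw [← e1, hΦ] at e2
    rw [hΦ, smul_zero, add_zero] at e1
    have e3 : Φ.snd = dirichletInverse hL α (w.snd + z • Φ.snd) := e2.trans (by simp)
    rw [map_add, map_smul] at e3
    have h0 := eq_zero_of_smul_symm (dirichletInverse_symm hL α) hz
      (ih w hw (stokesInverse_injective hL hν e1.symm)) (sub_eq_iff_eq_add.2 e3)
    rw [h0, map_zero, zero_add] at e3
    exact e3

/-- The algebraic multiplicities are finite: the root vectors are annihilated by `(1 - z B)²`, where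
`B` is the compact inverse of `A*`. -/
lemma hasFiniteAlgebraicMultiplicity_adjoint (hν : 0 < ν) (hα : 0 < α) (hL : 0 < L) {z : ℂ}
    (hz : z.im = 0) : HasFiniteAlgebraicMultiplicity (boussinesqAdjoint ν α L) z := by
  set B := adjointInverse hL ν α with hB
  -- `C = 1 - (1 - z B)²` is compact, and the root vectors are its fixed points
  set C : StateSpace L →L[ℂ] StateSpace L :=
    B ∘L ((2 * z) • ContinuousLinearMap.id ℂ (StateSpace L) - z ^ 2 • B) with hC
  have hc : IsCompactOperator C := (isCompactOperator_adjointInverse hL ν α).comp_clm _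
  have hfd := ContinuousLinearMap.finite_dimensional_eigenspace hc 1 one_ne_zero
  refine Submodule.finiteDimensional_of_le (S₂ := Module.End.eigenspace C.toLinearMap 1)
    (iSup_le fun n Φ h => ?_)
  rw [Module.End.mem_eigenspace_iff, one_smul, ContinuousLinearMap.coe_coe]
  cases n with
  | zero => rw [(Submodule.mem_bot ℂ).1 h, map_zero]
  | succ n =>
    have h1 := fst_of_mem_rootSpace hν hα hL hz _ Φ h
    obtain ⟨w, hw, e⟩ := (mem_rootSpace_succ (mem_boussinesqAdjoint_graph_iff hν hα hL)).1 h
    have e1 : Φ.fst = stokesInverse hL ν (w.fst + z • Φ.fst) := by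
      rw [← WithLp.smul_fst, ← WithLp.add_fst, ← adjointInverse_fst hL ν α, ← e]
    rw [map_add, map_smul, ← h1, right_eq_add] at e1
    have w1 := stokesInverse_injective hL hν e1
    have w2 := snd_of_mem_rootSpace hν hα hL hz _ w hw w1
    rw [← mem_eigenspace_adjoint_of_fst_eq_zero hν hα hL w1, mem_eigenspace_iff_mem_graph,
      mem_boussinesqAdjoint_graph_iff hν hα hL, ← hB, map_smul] at w2
    rw [← hB, map_add, map_smul] at e
    have e3 : B w = Φ - z • B Φ := eq_sub_of_add_eq e.symm
    have e4 : B w = z • B (B w) := by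
      nth_rw 1 [w2]
      rw [map_smul]
    rw [e3, map_sub, map_smul] at e4
    have e5 : C Φ = (2 * z) • B Φ - z ^ 2 • B (B Φ) := by
      change B ((2 * z) • Φ - z ^ 2 • B Φ) = _
      rw [map_sub, map_smul, map_smul]
    rw [e5, ← sub_eq_zero, ← sub_eq_zero.2 e4.symm]
    module

end Adjoint

/-! ### Eigenfunctions and pressures -/

lemma deriv_linear {f g : ℝ → ℂ} (hf : ContDiff ℝ ∞ f) (hg : ContDiff ℝ ∞ g) (a b : ℂ) :
    deriv (fun y => a * f y - b * g y) = fun y => a * deriv f y - b * deriv g y := by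
  rw [deriv_sub_const_mul (f := fun y => a * f y) (contDiff_const.mul hf) hg, deriv_const_mul_eq hf]

lemma integral_fourierMode_lin {L : ℝ} (u v : L2 L) (k : ℤ) (a b : ℂ) {η : ℝ → ℂ}
    (hη : Continuous η) : ∫ y in Ioo 0 L, fourierMode (a • u - b • v) k y * η y =
      a * (∫ y in Ioo 0 L, fourierMode u k y * η y) -
        b * ∫ y in Ioo 0 L, fourierMode v k y * η y := by
  refine mul_left_cancel₀ two_pi_ne_zero' ?_
  rw [mul_sub, mul_left_comm _ a, mul_left_comm _ b, ← integral_mul_separated _ k hη,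
    ← integral_mul_separated _ k hη, ← integral_mul_separated _ k hη]
  simp only [integral_mul_eq_inner (continuous_separated _ hη), inner_sub_right, inner_smul_right]

/-- The second order equation for the modes of the temperature component of an eigenfunction; the
second component of the velocity is its right-hand side. -/
lemma exists_temperature_mode {ν α L : ℝ} (hν : 0 < ν) (hα : 0 < α) (hL : 0 < L) {z : ℂ}
    {Φ : StateSpace L} (h : Φ ∈ eigenspace (boussinesqAdjoint ν α L) z) (k : ℤ) :
    ∃ X F G : ℝ → ℂ, ContDiff ℝ ∞ X ∧ IsStokesMode ν L k z F G ∧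
      (∀ᵐ y ∂(volume.restrict (Set.Ioo 0 L)), fourierMode Φ.snd k y = X y) ∧
      (∀ y, deriv (deriv X) y = (z / α + k ^ 2) * X y - 1 / α * G y) ∧ X 0 = 0 ∧ X L = 0 := by
  have hα' : (α : ℂ) ≠ 0 := Complex.ofReal_ne_zero.2 hα.ne'
  rw [mem_eigenspace_adjoint_iff hν hα hL] at h
  obtain ⟨h1, h2⟩ := h
  obtain ⟨F, G, hm, -, hG⟩ := exists_isStokesMode hL hν h1 k
  rw [← mem_dirichletGraph_iff hL hα] at h2
  obtain ⟨ht, w, hw, e⟩ := h2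
  simp only at ht hw e
  obtain ⟨r, hr⟩ := exists_sq_eq (z / α + (k : ℂ) ^ 2)
  have hh : ContDiff ℝ ∞ fun y => -(1 / (α : ℂ)) * G y := contDiff_const.mul hm.smooth_snd
  obtain ⟨X, hX, hXu, hXe⟩ := exists_contDiff_of_weak hL (integrableOn_fourierMode Φ.snd k) [r, -r]
    hh (fun η hη => by
      rw [diffOpTranspose_cons_neg _ _ hη.smooth]
      simp only [diffOpTranspose]
      have i0 := integrableOn_fourierMode Φ.snd k
      have c2 := hη.deriv.deriv.smooth.continuous
      have c0 := hη.smooth.continuous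
      have e1 := hw.integral_fourierMode k hη
      rw [integral_mul_sub_const_mul i0 c2 c0] at e1 ⊢
      have e2 := integral_fourierMode_lin Φ.snd (Φ.fst : L2Vec L).snd k z 1 c0
      rw [one_smul, e, integral_mul_congr_ae hG] at e2
      have e3 := integral_fourierMode_lin w 0 k α 0 c0
      rw [zero_smul, sub_zero, e2, e1] at e3
      simp only [mul_assoc]
      rw [integral_const_mul, hr]
      field_simp
      linear_combination -e3)
  rw [diffOp_cons_neg _ _ hX] at hXe
  obtain ⟨b0, b1⟩ := ht.fourierMode_eq_zero hL hX hXu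
  refine ⟨X, F, G, hX, hm, hXu, fun y => ?_, b0, b1⟩
  have := congrFun hXe y
  simp only [diffOp, hr] at this
  linear_combination this

/-- Applying `(D² - k²)(D² - k² - z / ν)` to the second order equation eliminates `G`; the boundary
conditions are those of a clamped `G`, by `G = -α (D² - k² - z / α) X`. -/
lemma sixthOrder_of_temperature_mode {ν α L : ℝ} (hα : 0 < α) {k : ℤ} {z : ℂ} {X F G : ℝ → ℂ}
    (hX : ContDiff ℝ ∞ X) (hm : IsStokesMode ν L k z F G)
    (h : ∀ y, deriv (deriv X) y = (z / α + k ^ 2) * X y - 1 / α * G y) (h0 : X 0 = 0)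
    (h1 : X L = 0) :
    SixthOrderODE ν α L k z X ∧ SixthOrderBC α k z X 0 ∧ SixthOrderBC α k z X L := by
  have hα' : (α : ℂ) ≠ 0 := Complex.ofReal_ne_zero.2 hα.ne'
  have hG := hm.smooth_snd
  have x1 := contDiff_deriv hX
  have x2 := contDiff_deriv x1
  have x3 := contDiff_deriv x2
  have g1 := contDiff_deriv hG
  have g2 := contDiff_deriv g1
  set c : ℂ := z / α + (k : ℂ) ^ 2 with hc
  have e2 : deriv (deriv X) = fun y => c * X y - 1 / α * G y := funext h
  have e3 : deriv (deriv (deriv X)) = fun y => c * deriv X y - 1 / α * deriv G y := by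
    rw [e2, deriv_linear hX hG]
  have e4 : deriv (deriv (deriv (deriv X))) =
      fun y => c * deriv (deriv X) y - 1 / α * deriv (deriv G) y := by
    rw [e3, deriv_linear x1 g1]
  have e5 : deriv (deriv (deriv (deriv (deriv X)))) =
      fun y => c * deriv (deriv (deriv X)) y - 1 / α * deriv (deriv (deriv G)) y := by
    rw [e4, deriv_linear x2 g2]
  have e6 : deriv (deriv (deriv (deriv (deriv (deriv X))))) =
      fun y => c * deriv (deriv (deriv (deriv X))) y - 1 / α * deriv (deriv (deriv (deriv G))) y := by
    rw [e5, deriv_linear x3 (contDiff_deriv g2)]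
  have eG : ∀ y, deriv (deriv (deriv (deriv G))) y = (k ^ 2 + z / ν) * deriv (deriv G) y +
      k ^ 2 * (deriv (deriv G) y - (k ^ 2 + z / ν) * G y) := fun y => by
    have := hm.fourth_order y
    rw [deriv_sub_const_mul g2 hG, deriv_sub_const_mul (contDiff_deriv g2) g1] at this
    linear_combination this
  have bc : ∀ y, X y = 0 → G y = 0 → deriv G y = 0 → SixthOrderBC α k z X y := by
    intro y hx hg hg'
    refine ⟨hx, ?_, ?_⟩
    · simp only [iteratedDeriv_succ, iteratedDeriv_zero]
      rw [h, hx, hg]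
      ring
    · simp only [iteratedDeriv_succ, iteratedDeriv_zero]
      rw [e3]
      simp only [hg']
      ring
  refine ⟨fun y _ => ?_, bc 0 h0 hm.snd_zero hm.deriv_snd.1, bc L h1 hm.snd_length hm.deriv_snd.2⟩
  simp only [iteratedDeriv_succ, iteratedDeriv_zero]
  have f2 := congrFun e2 y
  have f4 := congrFun e4 y
  have f6 := congrFun e6 y
  simp only [eG] at f6
  rw [f6, f4, f2, hc]
  ring

/-- The solutions of `ξ = z T ξ` are finite combinations of sine modes. -/
lemma mem_dirichletSpan_of_eq {α L : ℝ} (hα : 0 < α) (hL : 0 < L) {z : ℂ} {ξ : L2 L}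
    (h : ξ = z • dirichletInverse hL α ξ) :
    (WithLp.toLp 2 (0, ξ) : StateSpace L) ∈ dirichletSpan α L z := by
  let ι : L2 L →L[ℂ] StateSpace L :=
    ((WithLp.prodContinuousLinearEquiv 2 ℂ (solenoidal L) (L2 L)).symm : _ →L[ℂ] StateSpace L) ∘L
      ContinuousLinearMap.inr ℂ (solenoidal L) (L2 L)
  have hι : ∀ x, ι x = WithLp.toLp 2 (0, x) := fun x => rfl
  rw [eq_smul_dirichletInverse_iff hL hα] at h
  set s := (finite_symbol_le hL (-z.re / α)).toFinset with hs
  have hsum : ξ = ∑ p ∈ s, inner ℂ (sinMode L p) ξ • sinMode L p := by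
    refine (hasSum_sinMode hL ξ).unique (hasSum_sum_of_ne_finset_zero fun p hp => ?_)
    by_contra hne
    have hc : inner ℂ (sinMode L p) ξ ≠ 0 := fun h0 => hne (by rw [h0, zero_smul])
    refine hp ?_
    rw [hs, Set.Finite.mem_toFinset, mem_ofPred_eq, h p hc, dirichletValue_succ, Complex.ofReal_re,
      neg_mul, neg_neg, mul_div_cancel_left₀ _ hα.ne']
  rw [← hι, hsum, map_sum]
  refine Submodule.sum_mem _ fun p _ => ?_
  rw [map_smul]
  rcases eq_or_ne (inner ℂ (sinMode L p) ξ) 0 with h0 | h0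
  · rw [h0, zero_smul]
    exact zero_mem _
  · refine Submodule.smul_mem _ _ ?_
    have hr : ((√(π * L) : ℝ) : ℂ) ≠ 0 :=
      Complex.ofReal_ne_zero.2 (Real.sqrt_pos.2 (by positivity)).ne'
    have e : ι (sinMode L p) = ((√(π * L) : ℝ) : ℂ)⁻¹ • dirichletMode L p.1 (p.2 + 1) := by
      rw [dirichletMode_succ hL, smul_smul, inv_mul_cancel₀ hr, one_smul]
      rfl
    rw [e]
    exact Submodule.smul_mem _ _ (Submodule.subset_span ⟨p.1, p.2 + 1, by lia, h p h0, rfl⟩)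

lemma dirichletMode_mem {ν α L : ℝ} (hν : 0 < ν) (hα : 0 < α) (hL : 0 < L) (k : ℤ) {j : ℕ}
    (hj : 1 ≤ j) : dirichletMode L k j ≠ 0 ∧
      dirichletMode L k j ∈ eigenspace (boussinesqAdjoint ν α L) (dirichletValue α L k j) := by
  obtain ⟨i, rfl⟩ := Nat.exists_eq_add_of_le' hj
  have hr : ((√(π * L) : ℝ) : ℂ) ≠ 0 :=
    Complex.ofReal_ne_zero.2 (Real.sqrt_pos.2 (by positivity)).ne'
  rw [dirichletMode_succ hL]
  constructor
  · refine smul_ne_zero hr fun h => (orthonormal_sinMode hL).ne_zero (k, i) ?_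
    exact congrArg WithLp.snd h
  · refine Submodule.smul_mem _ _ ?_
    rw [mem_eigenspace_adjoint_of_fst_eq_zero hν hα hL rfl]
    exact sinMode_eq_smul hL hα (k, i)

lemma mem_dirichletSpan_iff {ν α L : ℝ} (hν : 0 < ν) (hα : 0 < α) (hL : 0 < L) (z : ℂ)
    (Φ : StateSpace L) :
    (Φ ∈ eigenspace (boussinesqAdjoint ν α L) z ∧ Φ.fst = 0) ↔ Φ ∈ dirichletSpan α L z := by
  constructor
  · rintro ⟨h, h0⟩
    rw [mem_eigenspace_adjoint_of_fst_eq_zero hν hα hL h0] at h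
    have e : Φ = WithLp.toLp 2 (0, Φ.snd) := state_ext h0 rfl
    rw [e]
    exact mem_dirichletSpan_of_eq hα hL h
  · intro h
    constructor
    · refine (Submodule.span_le.2 ?_ : dirichletSpan α L z ≤ _) h
      rintro - ⟨k, j, hj, rfl, rfl⟩
      exact (dirichletMode_mem hν hα hL k hj).2
    · refine (Submodule.span_le.2 ?_ : dirichletSpan α L z ≤
        LinearMap.ker (WithLp.fstL 2 ℂ (solenoidal L) (L2 L)).toLinearMap) h
      rintro - ⟨k, j, -, -, rfl⟩
      rfl

lemma eigenspace_adjoint_eq {ν α L : ℝ} (hν : 0 < ν) (hα : 0 < α) (hL : 0 < L) {z : ℂ}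
    (hz : z ∉ SpS ν L) : eigenspace (boussinesqAdjoint ν α L) z = dirichletSpan α L z := by
  ext Φ
  rw [← mem_dirichletSpan_iff hν hα hL, iff_self_and]
  intro h
  by_contra h0
  exact hz ((mem_SpS_iff hL hν).2 ⟨_, h0, ((mem_eigenspace_adjoint_iff hν hα hL).1 h).1⟩)

lemma integral_zero_mul {L : ℝ} (g : ℝ × ℝ → ℂ) : ∫ x in channel L, (0 : L2 L) x * g x = 0 := by
  refine integral_eq_zero_of_ae ?_
  filter_upwards [Lp.coeFn_zero ℂ 2 (volume.restrict (channel L))] with x hx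
  simp only [hx, Pi.zero_apply, zero_mul]

/-- A function whose weak gradient vanishes is constant: its modes with `k ≠ 0` vanish and the mean
has vanishing derivative. -/
lemma ae_eq_const_of_gradient {L : ℝ} (hL : 0 < L) {q : L2 L}
    (h : ∀ φ, IsTestFunction L φ → ∀ i, ∫ x in channel L, q x * partialDeriv i φ x = 0) :
    ∃ c : ℂ, ∀ᵐ x ∂(volume.restrict (channel L)), q x = c := by
  have hk : ∀ k : ℤ, k ≠ 0 → ∀ᵐ y ∂volume.restrict (Ioo 0 L), fourierMode q k y = 0 := by
    intro k hk
    refine ae_eq_of_integral_mul_eq (integrableOn_fourierMode q k) continuous_const fun η hη => ?_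
    have c0 : ContDiff ℝ ∞ fun y => Complex.I * ((-k : ℤ) : ℂ) * η y :=
      contDiff_const.mul hη.smooth
    have e := h _ (isTestFunction_separated (-k) hη) 0
    rw [partialDeriv_zero_separated (-k) hη.smooth,
      integral_mul_separated q k c0.continuous] at e
    have e' := (mul_eq_zero.1 e).resolve_left two_pi_ne_zero'
    simp only [mul_left_comm _ (Complex.I * ((-k : ℤ) : ℂ))] at e'
    rw [integral_const_mul] at e'
    rw [(mul_eq_zero.1 e').resolve_left (mul_ne_zero Complex.I_ne_zero (by simpa using hk))]
    simp
  obtain ⟨W, hW, hWu, hWe⟩ := exists_contDiff_of_weak hL (integrableOn_fourierMode q 0) [0]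
    (h := fun _ => 0) contDiff_const (fun η hη => by
      have e := h _ (isTestFunction_separated (-0) hη) 1
      rw [partialDeriv_one_separated (-0) hη.smooth,
        integral_mul_separated q 0 hη.deriv.smooth.continuous] at e
      have e' := (mul_eq_zero.1 e).resolve_left two_pi_ne_zero'
      simp only [diffOpTranspose, zero_mul, sub_zero, mul_neg, integral_neg, e', neg_zero,
        integral_zero])
  have hc : ∀ y, W y = W 0 := fun y => by
    refine is_const_of_deriv_eq_zero (hW.differentiable (by simp)) (fun t => ?_) y 0
    simpa [diffOp] using congrFun hWe t
  have hq : q = sepL2 L 0 (f := fun _ => W 0) contDiff_const := by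
    refine eq_of_inner_sinMode hL fun p => ?_
    have e1 := inner_contL2_separated q p.1 (contDiff_sinProfile L p.2).continuous
    have e2 := inner_separated (L := L) p.1 0 (contDiff_sinProfile L p.2).continuous
      (g := fun _ => W 0) continuous_const
    refine e1.trans (Eq.trans ?_ e2.symm)
    by_cases hp : p.1 = 0
    · rw [if_pos hp, hp]
      congr 1
      refine integral_congr_ae ?_
      filter_upwards [hWu] with y hy
      rw [hy, hc]
    · rw [if_neg hp, integral_eq_zero_of_ae, mul_zero]
      filter_upwards [hk p.1 hp] with y hy
      simp [hy]
  refine ⟨W 0, ?_⟩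
  have e := coeFn_contL2 L (continuous_separated 0 (f := fun _ => W 0) continuous_const)
  rw [hq]
  filter_upwards [e] with x hx
  refine hx.trans ?_
  simp [separated]

lemma isPressure_zero_iff {ν L : ℝ} (hL : 0 < L) (z : ℂ) (q : L2 L) : IsPressure ν L z 0 q ↔
    ∃ c : ℂ, ∀ᵐ x ∂(volume.restrict (channel L)), q x = c := by
  have h0 : ∀ g : ℝ × ℝ → ℂ, ∫ x in channel L, ((0 : solenoidal L) : L2Vec L).fst x * g x = 0 :=
    fun g => integral_zero_mul g
  have h1 : ∀ g : ℝ × ℝ → ℂ, ∫ x in channel L, ((0 : solenoidal L) : L2Vec L).snd x * g x = 0 :=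
    fun g => integral_zero_mul g
  have hiff : IsPressure ν L z 0 q ↔
      ∀ φ, IsTestFunction L φ → ∀ i, ∫ x in channel L, q x * partialDeriv i φ x = 0 := by
    simp only [IsPressure, h0, h1, Fin.forall_fin_two, eq_comm (a := (0 : ℂ))]
  rw [hiff]
  refine ⟨ae_eq_const_of_gradient hL, ?_⟩
  rintro ⟨c, hc⟩ φ hφ i
  have e : ∫ x in channel L, q x * partialDeriv i φ x =
      c * ∫ x in channel L, partialDeriv i φ x := by
    rw [← integral_const_mul]
    refine integral_congr_ae ?_
    filter_upwards [hc] with x hx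
    rw [hx]
  obtain ⟨a, b, ha, hb, hs⟩ := hφ.support
  have hz : ∀ x : ℝ × ℝ, x.2 ≤ 0 ∨ L ≤ x.2 → φ x = 0 := fun x hx => by
    by_contra hne
    obtain ⟨h1, h2⟩ := hs x hne
    rcases hx with hx | hx <;> linarith
  rw [e]
  fin_cases i
  · exact mul_eq_zero_of_right c (integral_partialDeriv_zero hφ.toIsPeriodicSmooth)
  · exact mul_eq_zero_of_right c (integral_partialDeriv_one hL hφ.toIsPeriodicSmooth
      (fun x => hz _ (Or.inl le_rfl)) fun x => hz _ (Or.inr le_rfl))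

end Boussinesq

end

theorem mainTheorem3 (ν α L : ℝ) (hν : 0 < ν) (hα : 0 < α) (hL : 0 < L) (hαν : α ≠ ν) :
    -- `A` is densely defined, so that `A*` is a well-defined operator
    Dense ((boussinesqOperator ν α L).domain : Set (StateSpace L)) ∧
    -- the spectrum of `A*` consists of isolated real eigenvalues of finite algebraic multiplicity
    (∀ z ∈ unboundedSpectrum (boussinesqAdjoint ν α L),
      z.im = 0 ∧ IsEigenvalue (boussinesqAdjoint ν α L) z ∧
      (∃ ε > 0, Metric.ball z ε ∩ unboundedSpectrum (boussinesqAdjoint ν α L) = {z}) ∧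
      HasFiniteAlgebraicMultiplicity (boussinesqAdjoint ν α L) z) ∧
    -- the splitting of the spectrum
    unboundedSpectrum (boussinesqAdjoint ν α L) = SpS ν L ∪ SpL α L ∧
    -- the first part consists of the Stokes eigenvalues
    SpS ν L = {z | IsEigenvalue (stokesOperator ν L) z} ∧
    -- for each `k` it is a sequence indexed by `j ∈ ℕ`
    (∀ k : ℤ, ∃ lam : ℕ → ℝ, Function.Injective lam ∧ Set.range lam = stokesModeSet ν L k) ∧
    -- the sixth order problem for the modes of the temperature component of the eigenfunctions
    (∀ (z : ℂ) (Φ : StateSpace L), Φ ∈ eigenspace (boussinesqAdjoint ν α L) z → ∀ k : ℤ,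
      ∃ f : ℝ → ℂ, ContDiff ℝ ∞ f ∧
        (∀ᵐ y ∂(volume.restrict (Set.Ioo 0 L)), fourierMode Φ.snd k y = f y) ∧
        SixthOrderODE ν α L k z f ∧ SixthOrderBC α k z f 0 ∧ SixthOrderBC α k z f L) ∧
    -- the eigenfunctions associated to the second part, with their pressure
    (∀ (k : ℤ) (j : ℕ), 1 ≤ j → dirichletMode L k j ≠ 0 ∧
      dirichletMode L k j ∈ eigenspace (boussinesqAdjoint ν α L) (dirichletValue α L k j)) ∧
    (∀ (z : ℂ) (Φ : StateSpace L), (Φ ∈ eigenspace (boussinesqAdjoint ν α L) z ∧ Φ.fst = 0) ↔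
      Φ ∈ dirichletSpan α L z) ∧
    (∀ z ∈ SpL α L, z ∉ SpS ν L →
      eigenspace (boussinesqAdjoint ν α L) z = dirichletSpan α L z) ∧
    (∀ (z : ℂ) (q : L2 L), IsPressure ν L z 0 q ↔
      ∃ c : ℂ, ∀ᵐ x ∂(volume.restrict (channel L)), q x = c) := by
  have hspec := spectrum_adjoint (α := α) hν hα hL
  refine ⟨dense_boussinesqOperator hν hα hL, fun z hz => ?_, hspec, SpS_eq_eigenvalues hL hν,
    exists_enumeration hL hν, fun z Φ hΦ k => ?_, fun k j hj => dirichletMode_mem hν hα hL k hj,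
    mem_dirichletSpan_iff hν hα hL, fun z _ hz => eigenspace_adjoint_eq hν hα hL hz,
    isPressure_zero_iff hL⟩
  · have him := im_eq_zero_of_mem_SpS_union (hspec ▸ hz)
    refine ⟨him, (mem_spectrum_adjoint_iff hν hα hL).1 hz, ?_,
      hasFiniteAlgebraicMultiplicity_adjoint hν hα hL him⟩
    rw [hspec] at hz ⊢
    exact exists_isolating_ball hν hα hL hz
  · obtain ⟨X, F, G, hX, hm, hXu, h, h0, h1⟩ := exists_temperature_mode hν hα hL hΦ k
    exact ⟨X, hX, hXu, sixthOrder_of_temperature_mode hα hX hm h h0 h1⟩
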